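/- Let $\mathbb{R}^\infty$ be the set of finite sequences of real numbers and $\mathbb{R}_\infty=\bigoplus_{i\in\mathbb{Z}}\mathbb{R}$. A \emph{(Blum--Shub--Smale) machine over $\mathbb{R}$} is a finite connected directed graph with a unique input node (with no incoming edge and one outgoing edge) and with computation, branch, shift and output nodes. Its states are elements of $\mathbb{R}_\infty$. The input node writes an input $(x_1,\dots,x_n)\in\mathbb{R}^\infty$ on the coordinates $1,\dots,n$, records $n$ in unary by ones on the coordinates $0,-1,\dots,-(n-1)$, and applies a linear map; a computation node applies a rational map (the computation does not proceed where a denominator vanishes); a branch node chooses one of its two outgoing edges according to whether a polynomial $h$ satisfies $h(x)\ge 0$ or $h(x)<0$; a shift node replaces $(x_i)_i$ by $(x_{i+1})_i$ or by $(x_{i-1})_i$; an output node applies a linear map and reads off $(x_1,\dots,x_\ell)$, where $\ell$ is the number of consecutive ones on the coordinates $0,-1,-2,\dots$. The linear and rational maps change only finitely many coordinates and depend there on only finitely many, so that a machine is given by finitely many real numbers (the matrix entries and the coefficients of the polynomials, numerators and denominators), called its \emph{parameters}. A set $S\subseteq\mathbb{R}^\infty$ is decided by a machine if the machine computes the characteristic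 function of $S$. Let $L$ be a first-order language with finitely or countably many function and relation symbols (constants being $0$-ary functions), numbered by fixed injections into $\mathbb{N}$. The \emph{atomic diagram} of an $L$-structure is the set of all atomic and negated atomic sentences, with constants for the elements of the structure, that are true in it. For a structure with universe $U\subseteq\mathbb{R}^\infty$ it is coded as a subset of $\mathbb{R}^\infty$, and for a structure with universe $D\subseteq\mathbb{N}$ as a set of finite sequences of natural numbers, by writing sentences in prefix notation with symbols replaced by their numbers and each element written after a marker and its length. A structure with universe $U\subseteq\mathbb{R}^\infty$ is \emph{$\mathbb{R}$-computable} if some machine over $\mathbb{R}$ decides its atomic diagram; a structure with universe $D\subseteq\mathbb{N}$ is \emph{computable} if its atomic diagram is Turing computable. For structures $\mathcal{A},\mathcal{B}$ in the same language, write $\mathcal{A}\le_1\mathcal{B}$ if $\mathcal{A}$ is a substructure of $\mathcal{B}$ and, for every existential formula $\varphi(\bar x)$ and every tuple $\bar a$ from $\mathcal{A}$, $\mathcal{B}\models\varphi(\bar a)$ implies $\mathcal{A}\models\varphi(\bar a)$. \textbf{Corollary.} Let $\mathcal{M}$ be an $\mathbb{R}$-computable $L$-structure whose atomic diagram is decided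 by a machine all of whose parameters are computable real numbers. Then there is a structure $\mathcal{M}^*\le_1\mathcal{M}$ which is computable, in the sense that $\mathcal{M}^*$ is isomorphic to a computable structure with universe a subset of $\mathbb{N}$. -/

import Mathlib

open FirstOrder

/-! ### Machines over the reals -/

namespace BSS

/-- The space `ℝ_∞`: the direct sum of copies of `ℝ` indexed by `ℤ`. Finite sequences of reals,
the elements of `ℝ^∞`, are represented by `List ℝ`. -/
abbrev Tape : Type := ℤ →₀ ℝ

/-- A real number is computable if there is a Turing computable sequence of dyadic rationals
`(p n - q n) / 2 ^ n` whose `n`-th term is within `1 / 2 ^ n` of it. -/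
def IsComputableReal (x : ℝ) : Prop :=
  ∃ p q : ℕ → ℕ, Computable p ∧ Computable q ∧
    ∀ n : ℕ, |x - ((p n : ℝ) - (q n : ℝ)) / 2 ^ n| ≤ 1 / 2 ^ n

/-- A linear self-map of `ℝ_∞` given by finitely many real numbers: a matrix acting on the
coordinates in a finite window, all the other coordinates being kept. -/
structure LinearData where
  window : Finset ℤ
  mat : Matrix window window ℝ

/-- The linear map described by `g`. -/
noncomputable def LinearData.apply (g : LinearData) (x : Tape) : Tape :=
  Finsupp.onFinset (g.window ∪ x.support)
    (fun i => if h : i ∈ g.window then ∑ j, g.mat ⟨i, h⟩ j * x j else x i)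
    (fun i hi => by
      by_cases h : i ∈ g.window
      · exact Finset.mem_union_left _ h
      · simp only [h, dif_neg, not_false_eq_true] at hi
        exact Finset.mem_union_right _ (Finsupp.mem_support_iff.mpr hi))

/-- A rational self-map of `ℝ_∞` given by finitely many real numbers: the coordinates in a finite
window are replaced by quotients of polynomials in (finitely many of) the coordinates, all the
other coordinates are kept. -/
structure RationalData where
  window : Finset ℤ
  num : window → MvPolynomial ℤ ℝ
  den : window → MvPolynomial ℤ ℝ
  den_ne_zero : ∀ i, den i ≠ 0

/-- The rational map `g` is defined at the points at which no denominator vanishes. -/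
def RationalData.DefinedAt (g : RationalData) (x : Tape) : Prop :=
  ∀ i, MvPolynomial.eval (fun j => x j) (g.den i) ≠ 0

/-- The value of the rational map `g` at `x` (meaningful if `g` is defined at `x`). -/
noncomputable def RationalData.apply (g : RationalData) (x : Tape) : Tape :=
  Finsupp.onFinset (g.window ∪ x.support)
    (fun i => if h : i ∈ g.window then
        MvPolynomial.eval (fun j => x j) (g.num ⟨i, h⟩) /
          MvPolynomial.eval (fun j => x j) (g.den ⟨i, h⟩)
      else x i)
    (fun i hi => by
      by_cases h : i ∈ g.window
      · exact Finset.mem_union_left _ h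
      · simp only [h, dif_neg, not_false_eq_true] at hi
        exact Finset.mem_union_right _ (Finsupp.mem_support_iff.mpr hi))

/-- The shift by `d`, that is `x ↦ (i ↦ x (i + d))`. -/
noncomputable def shiftBy (d : ℤ) (x : Tape) : Tape :=
  Finsupp.equivMapDomain (Equiv.subRight d) x

theorem shiftBy_apply (d : ℤ) (x : Tape) (i : ℤ) : shiftBy d x i = x (i + d) := by
  simp [shiftBy, Finsupp.equivMapDomain_apply]

/-- The standard embedding of `ℝ^∞` in `ℝ_∞`: the sequence `(x₁, …, xₙ)` is written on the
coordinates `1, …, n`, and its length is recorded in unary by `n` ones on the coordinates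
`0, -1, …, -(n - 1)`. -/
noncomputable def embed (l : List ℝ) : Tape :=
  Finsupp.onFinset (Finset.Icc (-(l.length : ℤ)) (l.length : ℤ))
    (fun i => if 1 ≤ i then l.getD (i - 1).toNat 0
      else if -(l.length : ℤ) < i then 1 else 0)
    (fun i hi => by
      rw [Finset.mem_Icc]
      by_cases h1 : 1 ≤ i
      · simp only [h1, if_true] at hi
        by_contra hcon
        exact hi (List.getD_eq_default _ _ (by omega))
      · simp only [h1, if_false] at hi
        by_cases h2 : -(l.length : ℤ) < i
        · omega
        · simp [h2] at hi)

/-- The standard way to read a finite sequence off an element of `ℝ_∞`: its length is the number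
of consecutive ones on the coordinates `0, -1, -2, …`, its entries are on the coordinates
`1, 2, …`. -/
noncomputable def readOff (x : Tape) : List ℝ :=
  (List.range (sInf {n : ℕ | x (-(n : ℤ)) ≠ 1})).map fun i : ℕ => x ((i : ℤ) + 1)

/-- A node of a machine with `k` nodes, with the map associated with it and with the targets of
the edges that leave it. -/
inductive Node (k : ℕ) : Type
  | input (g : LinearData) (next : Fin k) : Node k
  | compute (g : RationalData) (next : Fin k) : Node k
  | branch (h : MvPolynomial ℤ ℝ) (next₀ next₁ : Fin k) : Node k
  | shiftLeft (next : Fin k) : Node k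
  | shiftRight (next : Fin k) : Node k
  | output (g : LinearData) : Node k

/-- The nodes to which an edge leads from a given node. -/
def Node.targets {k : ℕ} : Node k → Set (Fin k)
  | .input _ next => {next}
  | .compute _ next => {next}
  | .branch _ next₀ next₁ => {next₀, next₁}
  | .shiftLeft next => {next}
  | .shiftRight next => {next}
  | .output _ => ∅

/-- All the real numbers that describe the map associated with the node are computable. -/
def Node.HasComputableParameters {k : ℕ} : Node k → Prop
  | .input g _ => ∀ i j, IsComputableReal (g.mat i j)
  | .compute g _ => ∀ i m, IsComputableReal ((g.num i).coeff m) ∧ IsComputableReal ((g.den i).coeff m)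
  | .branch h _ _ => ∀ m, IsComputableReal (h.coeff m)
  | .shiftLeft _ => True
  | .shiftRight _ => True
  | .output g => ∀ i j, IsComputableReal (g.mat i j)

/-- A machine over `ℝ`: a finite connected directed graph whose nodes are labelled as above, with
a unique input node, which has no incoming edge. -/
structure Machine where
  size : ℕ
  node : Fin size → Node size
  start : Fin size
  startMap : LinearData
  startNext : Fin size
  node_start : node start = Node.input startMap startNext
  input_unique : ∀ v g w, node v = Node.input g w → v = start
  no_incoming : ∀ v, start ∉ (node v).targets
  connected : ∀ v w, Relation.EqvGen (fun a b => b ∈ (node a).targets) v w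

/-- All the real parameters of the machine are computable. -/
def Machine.HasComputableParameters (K : Machine) : Prop :=
  ∀ v, (K.node v).HasComputableParameters

/-- One step of a computation, at a node that is neither the input node nor an output node. -/
inductive Machine.Step (K : Machine) : Fin K.size × Tape → Fin K.size × Tape → Prop
  | compute {v w : Fin K.size} {g : RationalData} {x : Tape}
      (hv : K.node v = Node.compute g w) (hx : g.DefinedAt x) : Machine.Step K (v, x) (w, g.apply x)
  | branch_zero {v w₀ w₁ : Fin K.size} {h : MvPolynomial ℤ ℝ} {x : Tape}
      (hv : K.node v = Node.branch h w₀ w₁) (hx : MvPolynomial.eval (fun j => x j) h < 0) :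
      Machine.Step K (v, x) (w₀, x)
  | branch_one {v w₀ w₁ : Fin K.size} {h : MvPolynomial ℤ ℝ} {x : Tape}
      (hv : K.node v = Node.branch h w₀ w₁) (hx : 0 ≤ MvPolynomial.eval (fun j => x j) h) :
      Machine.Step K (v, x) (w₁, x)
  | shiftLeft {v w : Fin K.size} {x : Tape}
      (hv : K.node v = Node.shiftLeft w) : Machine.Step K (v, x) (w, shiftBy 1 x)
  | shiftRight {v w : Fin K.size} {x : Tape}
      (hv : K.node v = Node.shiftRight w) : Machine.Step K (v, x) (w, shiftBy (-1) x)

/-- `K.Computes z y`: there is a computation of `K` on input `z`, and its result is `y`; in other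
words `φ_K z` is defined and equal to `y`. -/
def Machine.Computes (K : Machine) (z y : List ℝ) : Prop :=
  ∃ (v : Fin K.size) (x : Tape) (g : LinearData),
    Relation.ReflTransGen K.Step (K.startNext, K.startMap.apply (embed z)) (v, x) ∧
      K.node v = Node.output g ∧ y = readOff (g.apply x)

/-- `K` computes the characteristic function of the set `A` of finite sequences of reals. -/
def Machine.Decides (K : Machine) (A : Set (List ℝ)) : Prop :=
  ∀ z, (z ∈ A → K.Computes z [1]) ∧ (z ∉ A → K.Computes z [0])

end BSS

/-! ### Atomic diagrams -/

namespace Diagram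

/-- Atomic sentences of `L` expanded by a constant for each element of `M`; terms in these are
`L`-terms whose variables are elements of `M`. -/
inductive Atom (L : Language) (M : Type*)
  | eq (s t : L.Term M) : Atom L M
  | rel {n : ℕ} (R : L.Relations n) (ts : Fin n → L.Term M) : Atom L M

/-- Truth of an atomic sentence in the structure `M`. -/
def Atom.Holds {L : Language} {M : Type*} [L.Structure M] : Atom L M → Prop
  | .eq s t => s.realize id = t.realize id
  | .rel R ts => Language.Structure.RelMap R fun i => (ts i).realize id

variable {L : Language} [Encodable (Σ n, L.Functions n)] [Encodable (Σ n, L.Relations n)]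
variable {M X : Type*}

/-- The code of a term, in prefix notation, as a word over an alphabet `X`. The letter for the
natural number `n` is `num n`, and an element `a` of `M` is represented by the word `el a`, which
is written with its length in front. -/
def termCode (num : ℕ → X) (el : M → List X) : L.Term M → List X
  | .var a => num 0 :: num (el a).length :: el a
  | @Language.Term.func _ _ n f ts =>
      num (Encodable.encode (⟨n, f⟩ : Σ n, L.Functions n) + 1) ::
        (List.ofFn fun i => termCode num el (ts i)).flatten

/-- The code of an atomic sentence, in prefix notation. -/
def Atom.code (num : ℕ → X) (el : M → List X) : Atom L M → List X
  | .eq s t => num 0 :: (termCode num el s ++ termCode num el t)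
  | @Atom.rel _ _ n R ts =>
      num (Encodable.encode (⟨n, R⟩ : Σ n, L.Relations n) + 1) ::
        (List.ofFn fun i => termCode num el (ts i)).flatten

/-- The atomic diagram of `M`, as a set of words: the codes of the atomic sentences that hold
in `M`, preceded by the letter for `1`, and of those that fail in `M`, preceded by the letter for
`0` (the negated atomic sentences). -/
def atomicDiagram (L : Language) [Encodable (Σ n, L.Functions n)] [Encodable (Σ n, L.Relations n)]
    {M : Type*} [L.Structure M] {X : Type*} (num : ℕ → X) (el : M → List X) : Set (List X) :=
  {w | ∃ A : Atom L M, (A.Holds ∧ w = num 1 :: A.code num el) ∨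
    (¬ A.Holds ∧ w = num 0 :: A.code num el)}

end Diagram

/-- The machine `K` decides the atomic diagram of the `L`-structure whose universe is the set `U`
of finite sequences of reals. The structure is `ℝ`-computable if there is such a machine. -/
def BSS.Machine.Defines (K : BSS.Machine) (L : Language)
    [Encodable (Σ n, L.Functions n)] [Encodable (Σ n, L.Relations n)]
    (U : Set (List ℝ)) [L.Structure U] : Prop :=
  K.Decides (Diagram.atomicDiagram L (Nat.cast : ℕ → ℝ) (fun a : U => (a : List ℝ)))

/-- The `L`-structure `N` with universe a set `D` of natural numbers is (Turing) computable: its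
atomic diagram is Turing computable. -/
def IsComputableStructure (L : Language)
    [Encodable (Σ n, L.Functions n)] [Encodable (Σ n, L.Relations n)]
    (D : Set ℕ) [L.Structure D] : Prop :=
  ComputablePred fun w : List ℕ =>
    w ∈ Diagram.atomicDiagram L (id : ℕ → ℕ) (fun a : D => [(a : ℕ)])

/-- `A ≤₁ M` for a substructure `A` of `M`: every existential formula, with parameters in `A`,
that is true in `M` is true in `A`. -/
def FirstOrder.Language.Substructure.LeOne {L : Language} {M : Type*} [L.Structure M]
    (A : L.Substructure M) : Prop :=
  ∀ (n : ℕ) (φ : L.Formula (Fin n)), φ.IsExistential → ∀ a : Fin n → A,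
    φ.Realize (fun i => (a i : M)) → φ.Realize a

set_option linter.unusedSectionVars false


/-! ### Specialization of finitely many reals to a subring closed under real roots -/

namespace RealSpec

open Filter Topology

/-! The machine has finitely many parameters. Let `F` be the field of all reals algebraic over them.
The structure sought consists of the elements of the given one all of whose entries lie in `F`; two
independent facts about `F` are needed.

The first is a transfer principle, for any subring `F` closed under real roots. A halting
computation meets only finitely many reals. Every finite set of reals can be moved into `F` by a map
`σ` that keeps its order, keeps all its polynomial relations over `F`, and fixes `F` pointwise
(`exists_isSpecMap`, from `exists_specialization_near`). If the parameters lie in `F`, the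
computation on the moved input follows the same path and gives the moved output
(`Machine.Computes.exists_transfer`). Sentences of the atomic diagram therefore survive the move.
Moving the value of a function shows that it already has entries in `F`, so there is a substructure;
moving the witnesses of an existential formula gives `≤₁` (`Machine.Defines.restrict_leOne`).

The second is that `F` has a presentation with decidable equality and order
(`exists_computable_rootClosed`). Let `t` be a maximal algebraically independent set among the
parameters, shifted to be nonnegative. A polynomial relation among the `t` holds only formally, so
equality in `ℤ[t]` is decidable, and approximations then decide the order. Bisection of polynomials
over `ℤ[t]` yields a uniformly computable family of roots, and with `t` it generates `F` as a ring.
In this ring inequality is semidecided by approximation. Equality is semidecided by a search for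
certificates: the known relations of the generators determine all others up to a factor that does
not vanish and a power (`exists_mul_pow_mem_of_algebraic`).

A Turing machine can now simulate the given machine on codes of elements of `F`, guessing quotients
and checking them. Both answers become semidecidable, so the diagram of the substructure is
decidable on codes (`decides_computablePred`). Taking the least code of each element gives an
isomorphic computable structure on a set of natural numbers (`exists_isComputableStructure`). -/

theorem exists_sign_near_simple_root (P : Polynomial ℝ) (x : ℝ) (h0 : P.eval x = 0)
    (h1 : P.derivative.eval x ≠ 0) :
    ∃ δ > 0, ∀ y, y ≠ x → |y - x| ≤ δ → 0 < P.derivative.eval x * P.eval y * (y - x) := by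
  -- With `P = (X - x) * Q` one has `P'(x) = Q(x)`, and the product in the goal is `Q(x) Q(y) (y -
  -- x)²`; continuity of `Q` keeps `Q(x) Q(y)` positive near `x`.
  obtain ⟨Q, rfl⟩ := Polynomial.dvd_iff_isRoot.mpr h0
  have hd : (Polynomial.derivative ((Polynomial.X - Polynomial.C x) * Q)).eval x = Q.eval x := by
    simp [Polynomial.derivative_mul]
  rw [hd] at h1 ⊢
  have hc : ContinuousAt (fun y => Q.eval x * Q.eval y) x := by fun_prop
  have hpos : 0 < Q.eval x * Q.eval x := mul_self_pos.mpr h1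
  obtain ⟨δ, hδ, h⟩ := Metric.eventually_nhds_iff.mp (hc.eventually (lt_mem_nhds hpos))
  refine ⟨δ / 2, by positivity, fun y hy hyx => ?_⟩
  have h2 := h (y := y) (by rw [Real.dist_eq]; linarith)
  have h3 : 0 < (y - x) ^ 2 := by
    have := sub_ne_zero.mpr hy
    positivity
  have h4 := mul_pos h2 h3
  simp only [Polynomial.eval_mul, Polynomial.eval_sub, Polynomial.eval_X, Polynomial.eval_C]
  linarith [h4]

/-- `P` is a relation of least degree among those that `φ` does not kill. Minimality makes its
leading coefficient and its derivative at `x` nonzero. Pseudo-division by `P` reduces every other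
relation of `x` to zero without inverting coefficients, so the reduction remains valid under any
`φ'` that kills what `φ` kills and keeps the leading coefficient alive. -/
theorem exists_minimal_relation {R : Type*} [CommRing R] (φ : R →+* ℝ) (x : ℝ)
    (hx : ∃ P : Polynomial R, P.map φ ≠ 0 ∧ (P.map φ).eval x = 0) :
    ∃ P : Polynomial R, (P.map φ).eval x = 0 ∧ φ P.leadingCoeff ≠ 0 ∧
      (P.map φ).derivative.eval x ≠ 0 ∧
      ∀ φ' : R →+* ℝ, (∀ c, φ c = 0 → φ' c = 0) → φ' P.leadingCoeff ≠ 0 →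
        ∀ x', (P.map φ').eval x' = 0 →
          ∀ q : Polynomial R, (q.map φ).eval x = 0 → (q.map φ').eval x' = 0 := by
  classical
  obtain ⟨P, ⟨hP0, hPx⟩, hmin'⟩ := (measure (Polynomial.natDegree (R := R))).wf.has_min
    {P | P.map φ ≠ 0 ∧ (P.map φ).eval x = 0} hx
  have hmin : ∀ Q : Polynomial R, Q.map φ ≠ 0 ∧ (Q.map φ).eval x = 0 →
      P.natDegree ≤ Q.natDegree := fun Q hQ => not_lt.mp (hmin' Q hQ)
  have hlc : φ P.leadingCoeff ≠ 0 := by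
    intro h
    have hm : P.eraseLead.map φ = P.map φ := by
      rw [← Polynomial.self_sub_C_mul_X_pow]
      simp only [Polynomial.map_sub, Polynomial.map_mul, Polynomial.map_C, h, map_zero, zero_mul,
        sub_zero]
    have hlt : P.eraseLead.natDegree < P.natDegree := by
      refine (Polynomial.eraseLead_natDegree_lt_or_eraseLead_eq_zero P).resolve_right fun h0 => ?_
      rw [h0] at hm
      exact hP0 (by simpa using hm.symm)
    exact absurd (hmin P.eraseLead ⟨by rwa [hm], by rwa [hm]⟩) (not_le.mpr hlt)
  have hdeg : (P.map φ).natDegree = P.natDegree :=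
    Polynomial.natDegree_map_of_leadingCoeff_ne_zero φ hlc
  have hpos : 0 < P.natDegree := by
    rw [← hdeg]
    refine Nat.pos_of_ne_zero fun h => hP0 ?_
    rw [Polynomial.eq_C_of_natDegree_eq_zero h] at hPx ⊢
    simpa using hPx
  refine ⟨P, hPx, hlc, fun hd => ?_, fun φ' hφ' hlc' x' hx' q => ?_⟩
  · rw [Polynomial.derivative_map] at hd
    refine absurd (hmin P.derivative ⟨fun h => ?_, hd⟩)
      (not_le.mpr (Polynomial.natDegree_derivative_lt hpos.ne'))
    rw [← Polynomial.derivative_map] at h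
    have := Polynomial.derivative_eq_zero.mp h
    omega
  · induction hn : q.natDegree using Nat.strong_induction_on generalizing q with
    | _ n ih =>
    intro hq
    by_cases hq0 : q.map φ = 0
    · have : q.map φ' = 0 := by
        ext i
        have := congrArg (fun r => r.coeff i) hq0
        simp only [Polynomial.coeff_map, Polynomial.coeff_zero] at this ⊢
        exact hφ' _ this
      simp [this]
    · have hle := hmin q ⟨hq0, hq⟩
      -- The pseudo-remainder step: the terms of degree `q.natDegree` cancel, and at `x'` only the
      -- multiple of `q` survives.
      set r := Polynomial.C P.leadingCoeff * q -
        Polynomial.C q.leadingCoeff * Polynomial.X ^ (q.natDegree - P.natDegree) * P with hr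
      have hrx : (r.map φ).eval x = 0 := by
        simp [hr, hq, hPx]
      have hrdeg : r.natDegree < n := by
        subst hn
        have h1 : r.natDegree ≤ q.natDegree := by
          refine (Polynomial.natDegree_sub_le _ _).trans (max_le ?_ ?_)
          · exact Polynomial.natDegree_C_mul_le _ _
          · rw [mul_assoc]
            refine (Polynomial.natDegree_C_mul_le _ _).trans
              ((Polynomial.natDegree_mul_le).trans ?_)
            have := Polynomial.natDegree_X_pow_le (R := R) (q.natDegree - P.natDegree)
            omega
        refine lt_of_le_of_ne h1 fun heq => ?_
        have h2 : r.coeff q.natDegree = 0 := by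
          rw [hr, Polynomial.coeff_sub, Polynomial.coeff_C_mul, mul_assoc, Polynomial.coeff_C_mul]
          have : (Polynomial.X ^ (q.natDegree - P.natDegree) * P).coeff q.natDegree
              = P.leadingCoeff := by
            conv_lhs => rw [show q.natDegree = P.natDegree + (q.natDegree - P.natDegree) by omega]
            rw [Nat.add_sub_cancel_left, Polynomial.coeff_X_pow_mul]; rfl
          rw [this, Polynomial.coeff_natDegree]
          ring
        rw [← heq] at h2
        have h3 : r = 0 := Polynomial.leadingCoeff_eq_zero.mp h2
        rw [h3] at heq
        simp at heq
        omega
      have h4 := ih _ hrdeg r rfl hrx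
      simp only [hr, Polynomial.map_sub, Polynomial.map_mul, Polynomial.map_C, Polynomial.eval_sub,
        Polynomial.eval_mul, Polynomial.eval_C, hx', mul_zero, sub_zero, mul_eq_zero] at h4
      exact h4.resolve_left hlc'

/-- Every real root of a nonzero polynomial with coefficients in `F` lies in `F`. -/
def RootClosed (F : Subring ℝ) : Prop :=
  ∀ (p : Polynomial F) (x : ℝ), p ≠ 0 → Polynomial.aeval x p = 0 → x ∈ F

theorem RootClosed.inv_mem {F : Subring ℝ} (hF : RootClosed F) {x : ℝ} (hx : x ∈ F) :
    x⁻¹ ∈ F := by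
  by_cases h : x = 0
  · simp [h]
  refine hF (Polynomial.C ⟨x, hx⟩ * Polynomial.X - 1) _ (fun h0 => ?_) ?_
  · have := congrArg (fun p => p.coeff 0) h0
    simp at this
  · have h2 : (algebraMap F ℝ) ⟨x, hx⟩ = x := rfl
    simp [h, h2]

theorem RootClosed.ratCast_mem {F : Subring ℝ} (hF : RootClosed F) (q : ℚ) : (q : ℝ) ∈ F := by
  rw [Rat.cast_def, div_eq_mul_inv]
  exact F.mul_mem (intCast_mem F _) (hF.inv_mem (natCast_mem F _))

/-- `B'` is a point with coordinates in `F` that satisfies all the algebraic relations over `F`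
that `B` satisfies. -/
def IsSpecialization (F : Subring ℝ) {ι : Type*} (B B' : ι → ℝ) : Prop :=
  (∀ i, B' i ∈ F) ∧
    ∀ p : MvPolynomial ι F, MvPolynomial.aeval B p = 0 → MvPolynomial.aeval B' p = 0

theorem aeval_cons_eq {F : Subring ℝ} {n : ℕ} (x : ℝ) (B : Fin n → ℝ)
    (p : MvPolynomial (Fin (n + 1)) F) :
    MvPolynomial.aeval (Fin.cons x B : Fin (n + 1) → ℝ) p =
      ((MvPolynomial.finSuccEquiv F n p).map
        (MvPolynomial.aeval B : MvPolynomial (Fin n) F →ₐ[F] ℝ).toRingHom).eval x := by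
  induction p using MvPolynomial.induction_on with
  | C a => simp [MvPolynomial.finSuccEquiv_apply]
  | add p q hp hq => simp [hp, hq]
  | mul_X p i hp =>
    rw [map_mul, map_mul, hp, Polynomial.map_mul, Polynomial.eval_mul, MvPolynomial.aeval_X]
    congr 1
    refine Fin.cases ?_ (fun i => ?_) i
    · simp [MvPolynomial.finSuccEquiv_X_zero]
    · simp [MvPolynomial.finSuccEquiv_X_succ]

theorem continuous_aeval {F : Subring ℝ} {ι : Type*} (p : MvPolynomial ι F) :
    Continuous fun B : ι → ℝ => MvPolynomial.aeval B p := by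
  simp only [MvPolynomial.aeval_def, ← MvPolynomial.eval_map]
  exact MvPolynomial.continuous_eval _

/-- Induction on the number of coordinates, splitting off the first one, `x`. If `x` is algebraic
over the others, its minimal relation has a simple root there, hence changes sign around `x`. The
sign change and the nonvanishing leading coefficient persist when the other coordinates are
specialized nearby, and the intermediate value theorem supplies a root `x'` near `x`. It lies in `F`
by root closure and inherits all relations by minimality. If `x` satisfies no nontrivial relation,
any nearby rational serves. -/
theorem exists_specialization_near {F : Subring ℝ} (hF : RootClosed F) :
    ∀ {n : ℕ} (B : Fin n → ℝ), ∀ t ∈ 𝓝 B, ∃ B' ∈ t, IsSpecialization F B B'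
  | 0, B, t, ht => ⟨B, mem_of_mem_nhds ht, fun i => i.elim0, fun _ h => h⟩
  | n + 1, B, t, ht => by
    obtain ⟨x, B, rfl⟩ : ∃ x B₀, B = (Fin.cons x B₀ : Fin (n + 1) → ℝ) :=
      ⟨B 0, Fin.tail B, (Fin.cons_self_tail B).symm⟩
    have hcons : Continuous fun z : ℝ × (Fin n → ℝ) => (Fin.cons z.1 z.2 : Fin (n + 1) → ℝ) := by
      refine continuous_pi fun i => Fin.cases ?_ (fun j => ?_) i
      · simpa using continuous_fst
      · simpa [Function.comp_def] using
          (continuous_apply (A := fun _ : Fin n => ℝ) j).comp (continuous_snd (X := ℝ))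
    have ht' := hcons.continuousAt.preimage_mem_nhds (x := (x, B)) ht
    rw [nhds_prod_eq, Filter.mem_prod_iff] at ht'
    obtain ⟨t₁, ht₁, t₂, ht₂, hsub⟩ := ht'
    obtain ⟨ε, hε, hball⟩ := Metric.mem_nhds_iff.mp ht₁
    have mem_t : ∀ x' B', |x' - x| < ε → B' ∈ t₂ → (Fin.cons x' B' : Fin (n + 1) → ℝ) ∈ t :=
      fun x' B' h1 h2 => hsub (show (x', B') ∈ t₁ ×ˢ t₂ from
        ⟨hball (by rwa [Metric.mem_ball, Real.dist_eq]), h2⟩)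
    let φ : MvPolynomial (Fin n) F →+* ℝ := (MvPolynomial.aeval B : _ →ₐ[F] ℝ).toRingHom
    by_cases hx : ∃ P : Polynomial (MvPolynomial (Fin n) F), P.map φ ≠ 0 ∧ (P.map φ).eval x = 0
    · obtain ⟨P, hPx, hlc, hder, hspec⟩ := exists_minimal_relation φ x hx
      obtain ⟨δ, hδ, hsign⟩ := exists_sign_near_simple_root _ x hPx hder
      -- The bound `δ` gives the sign change at `x ± η`; the bound `ε / 2` keeps the new root in the
      -- prescribed neighbourhood.
      set η := min δ (ε / 2) with hη
      have hηpos : 0 < η := by positivity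
      let ev : ℝ → (Fin n → ℝ) → ℝ := fun y B' =>
        MvPolynomial.aeval (Fin.cons y B' : Fin (n + 1) → ℝ) ((MvPolynomial.finSuccEquiv F n).symm P)
      have hev : ∀ y B', ev y B' = (P.map (MvPolynomial.aeval B' : MvPolynomial (Fin n) F →ₐ[F] ℝ).toRingHom).eval y := by
        intro y B'
        simp only [ev, aeval_cons_eq, AlgEquiv.apply_symm_apply]
      have hevc : ∀ y, Continuous (ev y) := fun y =>
        (continuous_aeval _).comp (hcons.comp (continuous_const.prodMk continuous_id))
      have hneg : ev (x - η) B * ev (x + η) B < 0 := by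
        have h1 := hsign (x - η) (by linarith) (by
          rw [sub_sub_cancel_left, abs_neg, abs_of_pos hηpos]; exact min_le_left _ _)
        have h2 := hsign (x + η) (by linarith) (by
          rw [add_sub_cancel_left, abs_of_pos hηpos]; exact min_le_left _ _)
        rw [hev, hev]
        change Polynomial.eval (x - η) (P.map φ) * Polynomial.eval (x + η) (P.map φ) < 0
        -- The product is `-(P'(x) η)² P(x - η) P(x + η)`.
        have h3 := mul_pos h1 h2
        have h4 : 0 < (Polynomial.eval x (Polynomial.derivative (P.map φ)) * η) ^ 2 := by positivity
        by_contra hcon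
        push Not at hcon
        nlinarith [mul_nonneg h4.le hcon]
      have hopen : {B' | ev (x - η) B' * ev (x + η) B' < 0} ∩
          {B' | MvPolynomial.aeval B' P.leadingCoeff ≠ 0} ∩ t₂ ∈ 𝓝 B :=
        Filter.inter_mem (Filter.inter_mem
          ((isOpen_lt ((hevc _).mul (hevc _)) continuous_const).mem_nhds hneg)
          ((isOpen_ne_fun (continuous_aeval _) continuous_const).mem_nhds hlc)) ht₂
      obtain ⟨B', ⟨⟨hneg', hlc'⟩, hB't⟩, hB'F, hB'⟩ := exists_specialization_near hF B _ hopen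
      obtain ⟨x', hx'mem, hx'0⟩ : ∃ x' ∈ Set.Icc (x - η) (x + η), ev x' B' = 0 := by
        have hcont : ContinuousOn (fun y => ev y B') (Set.uIcc (x - η) (x + η)) :=
          ((continuous_aeval _).comp (hcons.comp
            (continuous_id.prodMk continuous_const))).continuousOn
        have := intermediate_value_uIcc hcont
        rw [Set.uIcc_of_le (a := x - η) (by linarith)] at this
        refine this ?_
        rw [Set.mem_uIcc]
        rcases mul_neg_iff.mp (show ev (x - η) B' * ev (x + η) B' < 0 from hneg') with h | h
        · exact Or.inr ⟨h.2.le, h.1.le⟩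
        · exact Or.inl ⟨h.1.le, h.2.le⟩
      have hclose : |x' - x| < ε := by
        have : η ≤ ε / 2 := min_le_right _ _
        rw [abs_lt]; constructor <;> linarith [hx'mem.1, hx'mem.2]
      rw [hev] at hx'0
      refine ⟨Fin.cons x' B', mem_t _ _ hclose hB't, ?_, ?_⟩
      · refine Fin.cases ?_ (fun i => by simpa using hB'F i)
        -- The specialized relation has coefficients in `F` and a nonzero leading coefficient, so
        -- root closure applies to `x'`.
        let ψ : MvPolynomial (Fin n) F →ₐ[F] F := MvPolynomial.aeval fun i => ⟨B' i, hB'F i⟩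
        have hψ : ∀ c, ((ψ c : F) : ℝ) = MvPolynomial.aeval B' c := by
          intro c
          have := MvPolynomial.comp_aeval_apply (R := F) (fun i => (⟨B' i, hB'F i⟩ : F)) (Algebra.ofId F ℝ) c
          exact this
        refine hF (P.map ψ.toRingHom) x' (fun h0 => ?_) ?_
        · have := congrArg (fun p => ((p.coeff P.natDegree : F) : ℝ)) h0
          simp only [Polynomial.coeff_map, Polynomial.coeff_zero] at this
          exact hlc' ((hψ _).symm.trans this)
        · rw [Polynomial.aeval_def, ← Polynomial.eval_map, Polynomial.map_map]
          have : (algebraMap F ℝ).comp ψ.toRingHom =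
              (MvPolynomial.aeval B' : MvPolynomial (Fin n) F →ₐ[F] ℝ).toRingHom := by
            ext c
            · exact hψ _
            · exact hψ _
          simp only [this]
          exact hx'0
      · intro p hp
        rw [aeval_cons_eq] at hp ⊢
        exact hspec _ hB' hlc' x' hx'0 _ hp
    · push Not at hx
      obtain ⟨B', hB't, hB'F, hB'⟩ := exists_specialization_near hF B _ ht₂
      obtain ⟨q, hq1, hq2⟩ := exists_rat_btwn (show x < x + ε by linarith)
      refine ⟨Fin.cons (q : ℝ) B', mem_t _ _ (by rw [abs_lt]; constructor <;> linarith) hB't,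
        Fin.cases (by simpa using hF.ratCast_mem q) (fun i => by simpa using hB'F i), ?_⟩
      intro p hp
      rw [aeval_cons_eq] at hp ⊢
      have h0 : (MvPolynomial.finSuccEquiv F n p).map φ = 0 := by
        by_contra hne
        exact hx _ hne hp
      have : (MvPolynomial.finSuccEquiv F n p).map
          (MvPolynomial.aeval B' : MvPolynomial (Fin n) F →ₐ[F] ℝ).toRingHom = 0 := by
        ext i
        have := congrArg (fun r => r.coeff i) h0
        simp only [Polynomial.coeff_map, Polynomial.coeff_zero] at this ⊢
        exact hB' _ this
      rw [this, Polynomial.eval_zero]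

/-- `σ` is order preserving on the finite set `S` and maps it to `F`, it preserves the algebraic
relations over `F` between elements of `S`, and it fixes the elements of `F`. -/
structure IsSpecMap (F : Subring ℝ) (S : Finset ℝ) (σ : ℝ → ℝ) : Prop where
  mem : ∀ x ∈ S, σ x ∈ F
  strictMono : StrictMonoOn σ S
  rel : ∀ p : MvPolynomial ℝ F, (p.vars : Set ℝ) ⊆ S →
    MvPolynomial.aeval id p = (0 : ℝ) → MvPolynomial.aeval σ p = (0 : ℝ)
  fix : ∀ x ∈ F, σ x = x

theorem IsSpecMap.mono {F : Subring ℝ} {S T : Finset ℝ} {σ : ℝ → ℝ} (h : IsSpecMap F T σ)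
    (hST : S ⊆ T) : IsSpecMap F S σ where
  mem x hx := h.mem x (hST hx)
  strictMono := h.strictMono.mono (by exact_mod_cast hST)
  rel p hp := h.rel p (hp.trans (by exact_mod_cast hST))
  fix := h.fix

/-- The elements of `S` are the coordinates of one point, and their strict inequalities hold in a
neighbourhood of it. Off `S` the map is the identity; an element `a` of `S` lying in `F` is fixed
because `X - a` is a relation over `F`. -/
theorem exists_isSpecMap {F : Subring ℝ} (hF : RootClosed F) (S : Finset ℝ) :
    ∃ σ, IsSpecMap F S σ := by
  classical
  let e := S.equivFin
  let B : Fin S.card → ℝ := fun i => (e.symm i : ℝ)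
  have hnhds : {B' : Fin S.card → ℝ | ∀ i j, B i < B j → B' i < B' j} ∈ 𝓝 B := by
    have : {B' : Fin S.card → ℝ | ∀ i j, B i < B j → B' i < B' j} =
        ⋂ i, ⋂ j, {B' | B i < B j → B' i < B' j} := by ext; simp
    rw [this, Filter.iInter_mem]
    intro i
    rw [Filter.iInter_mem]
    intro j
    by_cases hij : B i < B j
    · simp only [hij, true_imp_iff]
      exact (isOpen_lt (continuous_apply i) (continuous_apply j)).mem_nhds hij
    · simp [hij]
  obtain ⟨B', hB'1, hB'F, hB'⟩ := exists_specialization_near hF B _ hnhds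
  have hB : ∀ x (hx : x ∈ S), B (e ⟨x, hx⟩) = x := fun x hx => by simp [B]
  refine ⟨fun x => if h : x ∈ S then B' (e ⟨x, h⟩) else x, fun x hx => ?_,
    fun x hx y hy hxy => ?_, fun p hp hp0 => ?_, fun x hx => ?_⟩
  · simp only [hx, dif_pos]; exact hB'F _
  · simp only [Finset.mem_coe] at hx hy
    simp only [hx, hy, dif_pos]
    exact hB'1 _ _ (by rwa [hB, hB])
  · have hr : (p.vars : Set ℝ) ⊆ Set.range B := fun x hx => ⟨e ⟨x, hp hx⟩, hB _ _⟩
    obtain ⟨q, rfl⟩ := MvPolynomial.exists_rename_eq_of_vars_subset_range p B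
      (Subtype.val_injective.comp e.symm.injective) hr
    rw [MvPolynomial.aeval_rename] at hp0 ⊢
    have := hB' q hp0
    convert this using 2
    ext i
    simp [B]
  · split_ifs with h
    · have := hB' (MvPolynomial.X (e ⟨x, h⟩) - MvPolynomial.C ⟨x, hx⟩) (by
        rw [map_sub, MvPolynomial.aeval_X, MvPolynomial.aeval_C, hB]
        exact sub_self x)
      rw [map_sub, MvPolynomial.aeval_X, MvPolynomial.aeval_C] at this
      exact sub_eq_zero.mp this
    · rfl

namespace IsSpecMap

variable {F : Subring ℝ} {S : Finset ℝ} {σ : ℝ → ℝ}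

theorem map_zero (h : IsSpecMap F S σ) : σ 0 = 0 := h.fix 0 F.zero_mem

theorem map_one (h : IsSpecMap F S σ) : σ 1 = 1 := h.fix 1 F.one_mem

theorem map_mul (h : IsSpecMap F S σ) {x y z : ℝ} (hx : x ∈ S) (hy : y ∈ S) (hz : z ∈ S)
    (hxyz : x * y = z) : σ x * σ y = σ z := by
  classical
  have := h.rel (MvPolynomial.X x * MvPolynomial.X y - MvPolynomial.X z) (by
    refine (Finset.coe_subset.mpr ((MvPolynomial.vars_sub_subset _ ).trans
      (Finset.union_subset_union_left (MvPolynomial.vars_mul _ _)))).trans ?_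
    rw [MvPolynomial.vars_X, MvPolynomial.vars_X, MvPolynomial.vars_X]
    intro a
    simp only [Finset.coe_union, Finset.coe_singleton, Set.mem_union, Set.mem_singleton_iff]
    rintro ((rfl | rfl) | rfl) <;> assumption) (by simp [hxyz])
  simpa [sub_eq_zero] using this

theorem map_eval (h : IsSpecMap F S σ) {ι : Type*} (p : MvPolynomial ι F) (x : ι → ℝ)
    (hx : ∀ i ∈ p.vars, x i ∈ S) (hp : MvPolynomial.aeval x p ∈ S) :
    MvPolynomial.aeval (fun i => σ (x i)) p = σ (MvPolynomial.aeval x p) := by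
  classical
  -- The value of `p` is treated as one more variable, so evaluation becomes a relation between
  -- elements of `S`.
  have := h.rel (MvPolynomial.rename x p - MvPolynomial.X (MvPolynomial.aeval x p)) (by
    intro a ha
    have h1 := MvPolynomial.vars_sub_subset _ ha
    rw [MvPolynomial.vars_X, Finset.mem_union, Finset.mem_singleton] at h1
    rcases h1 with h1 | rfl
    · obtain ⟨i, hi, rfl⟩ := Finset.mem_image.mp (MvPolynomial.vars_rename _ _ h1)
      exact hx i hi
    · exact hp) (by simp [MvPolynomial.aeval_rename])
  simpa [sub_eq_zero, MvPolynomial.aeval_rename, Function.comp_def] using this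

end IsSpecMap

end RealSpec

/-! ### Computations of machines with parameters in a subring -/

namespace BSS

open RealSpec

theorem LinearData.apply_apply (g : LinearData) (x : Tape) (i : ℤ) :
    g.apply x i = if h : i ∈ g.window then ∑ j, g.mat ⟨i, h⟩ j * x j else x i := rfl

theorem RationalData.apply_apply (g : RationalData) (x : Tape) (i : ℤ) :
    g.apply x i = if h : i ∈ g.window then
        MvPolynomial.eval (fun j => x j) (g.num ⟨i, h⟩) /
          MvPolynomial.eval (fun j => x j) (g.den ⟨i, h⟩)
      else x i := rfl

theorem embed_apply (l : List ℝ) (i : ℤ) :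
    embed l i = if 1 ≤ i then l.getD (i - 1).toNat 0
      else if -(l.length : ℤ) < i then 1 else 0 := rfl

/-- A linear map, seen as a rational map. -/
noncomputable def LinearData.toRational (g : LinearData) : RationalData where
  window := g.window
  num i := ∑ j, MvPolynomial.C (g.mat i j) * MvPolynomial.X (j : ℤ)
  den _ := 1
  den_ne_zero _ := one_ne_zero

theorem LinearData.toRational_definedAt (g : LinearData) (x : Tape) :
    g.toRational.DefinedAt x := fun i => by simp [toRational]

theorem LinearData.toRational_apply (g : LinearData) (x : Tape) :
    g.toRational.apply x = g.apply x := by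
  ext i
  rw [LinearData.apply_apply, RationalData.apply_apply]
  simp [toRational]

/-- The polynomial `h` has coefficients in `F`. -/
def PolyOver (F : Subring ℝ) (h : MvPolynomial ℤ ℝ) : Prop :=
  ∃ p : MvPolynomial ℤ F, p.map F.subtype = h

theorem polyOver_of_coeff_mem {F : Subring ℝ} {h : MvPolynomial ℤ ℝ} (hh : ∀ m, h.coeff m ∈ F) :
    PolyOver F h := by
  have : h ∈ (MvPolynomial.map (σ := ℤ) F.subtype).range := by
    rw [← SetLike.mem_coe, RingHom.coe_range, MvPolynomial.mem_range_map_iff_coeffs_subset]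
    intro c hc
    obtain ⟨m, -, rfl⟩ := MvPolynomial.mem_coeffs_iff.mp hc
    exact ⟨⟨_, hh m⟩, rfl⟩
  exact this

/-- All the polynomials in the rational map `g` have coefficients in `F`. -/
def RationalData.Over (F : Subring ℝ) (g : RationalData) : Prop :=
  ∀ i, PolyOver F (g.num i) ∧ PolyOver F (g.den i)

theorem LinearData.toRational_over {F : Subring ℝ} {g : LinearData} (hg : ∀ i j, g.mat i j ∈ F) :
    g.toRational.Over F := fun i =>
  ⟨⟨∑ j : g.window, MvPolynomial.C ⟨g.mat i j, hg i j⟩ * MvPolynomial.X (j : ℤ), by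
    simp [toRational, map_sum]⟩, ⟨1, by simp [toRational]⟩⟩

/-- All the polynomials at the node have coefficients in `F`. -/
def Node.Over (F : Subring ℝ) {k : ℕ} : Node k → Prop
  | .input g _ => g.toRational.Over F
  | .compute g _ => g.Over F
  | .branch h _ _ => PolyOver F h
  | .shiftLeft _ => True
  | .shiftRight _ => True
  | .output g => g.toRational.Over F

/-- All transfer statements share this form: the finite set `S` of reals that matter is fixed by the
original computation, and afterwards every `σ` good for `S` works. Pieces are combined by taking
unions of these sets. -/
theorem PolyOver.exists_transfer {F : Subring ℝ} {h : MvPolynomial ℤ ℝ} (hh : PolyOver F h)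
    (x : Tape) : ∃ S : Finset ℝ, ∀ σ, IsSpecMap F S σ → ∀ x' : Tape, (∀ i, x' i = σ (x i)) →
      MvPolynomial.eval (fun i => x' i) h = σ (MvPolynomial.eval (fun i => x i) h) := by
  classical
  obtain ⟨p, rfl⟩ := hh
  refine ⟨insert (MvPolynomial.eval (fun i => x i) (p.map F.subtype)) (p.vars.image fun i => x i),
    fun σ hσ x' hx' => ?_⟩
  have key : ∀ y : ℤ → ℝ, MvPolynomial.eval y (p.map F.subtype) = MvPolynomial.aeval y p :=
    fun y => by rw [MvPolynomial.eval_map]; rfl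
  rw [key, key, ← hσ.map_eval p _ (fun i hi => Finset.mem_insert_of_mem
    (Finset.mem_image_of_mem _ hi)) (by rw [← key]; exact Finset.mem_insert_self _ _)]
  simp only [hx']

theorem RationalData.Over.exists_transfer {F : Subring ℝ} {g : RationalData} (hg : g.Over F)
    (x : Tape) (hx : g.DefinedAt x) : ∃ S : Finset ℝ, ∀ σ, IsSpecMap F S σ →
      ∀ x' : Tape, (∀ i, x' i = σ (x i)) →
        g.DefinedAt x' ∧ ∀ i, g.apply x' i = σ (g.apply x i) := by
  classical
  choose S₁ h₁ using fun i => (hg i).1.exists_transfer x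
  choose S₂ h₂ using fun i => (hg i).2.exists_transfer x
  let nu : g.window → ℝ := fun i => MvPolynomial.eval (fun j => x j) (g.num i)
  let de : g.window → ℝ := fun i => MvPolynomial.eval (fun j => x j) (g.den i)
  -- The element `0` is included so that injectivity on the set keeps denominators nonzero.
  -- Quotients are included because division is transferred through the relation `(nu / de) * de =
  -- nu`.
  refine ⟨insert 0 (Finset.univ.biUnion fun i => S₁ i ∪ (S₂ i ∪ {nu i, de i, nu i / de i})),
    fun σ hσ x' hx' => ?_⟩
  have sub : ∀ i, (S₁ i ∪ (S₂ i ∪ {nu i, de i, nu i / de i})) ⊆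
      insert 0 (Finset.univ.biUnion fun i => S₁ i ∪ (S₂ i ∪ {nu i, de i, nu i / de i})) :=
    fun i => (Finset.subset_biUnion_of_mem
      (fun i => S₁ i ∪ (S₂ i ∪ {nu i, de i, nu i / de i})) (Finset.mem_univ i)).trans
      (Finset.subset_insert _ _)
  have hnum := fun i => h₁ i σ (hσ.mono (Finset.subset_union_left.trans (sub i))) x' hx'
  have hden := fun i => h₂ i σ (hσ.mono ((Finset.subset_union_left.trans
    Finset.subset_union_right).trans (sub i))) x' hx'
  have hmem : ∀ i, ∀ a ∈ ({nu i, de i, nu i / de i} : Finset ℝ), a ∈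
      insert 0 (Finset.univ.biUnion fun i => S₁ i ∪ (S₂ i ∪ {nu i, de i, nu i / de i})) :=
    fun i a ha => sub i (Finset.mem_union_right _ (Finset.mem_union_right _ ha))
  have hdef : g.DefinedAt x' := fun i h0 => by
    rw [hden] at h0
    refine hx i (hσ.strictMono.injOn (Finset.mem_coe.mpr (hmem i _ (by simp [de])))
      (Finset.mem_coe.mpr (Finset.mem_insert_self 0 _)) ?_)
    rw [h0, hσ.map_zero]
  refine ⟨hdef, fun i => ?_⟩
  rw [RationalData.apply_apply, RationalData.apply_apply]
  split_ifs with h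
  · rw [div_eq_iff (hdef _), hnum, hden]
    exact (hσ.map_mul (hmem ⟨i, h⟩ _ (by simp [nu, de])) (hmem ⟨i, h⟩ _ (by simp [de]))
      (hmem ⟨i, h⟩ _ (by simp [nu])) (div_mul_cancel₀ _ (hx _))).symm
  · exact hx' i

theorem Machine.Step.exists_transfer {F : Subring ℝ} {K : Machine} (hK : ∀ v, (K.node v).Over F)
    {c d : Fin K.size × Tape} (hcd : K.Step c d) :
    ∃ S : Finset ℝ, ∀ σ, IsSpecMap F S σ → ∀ x' : Tape, (∀ i, x' i = σ (c.2 i)) →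
      ∃ y' : Tape, (∀ i, y' i = σ (d.2 i)) ∧ K.Step (c.1, x') (d.1, y') := by
  classical
  cases hcd with
  | @compute v w g x hv hx =>
    have hover := hK v
    rw [hv] at hover
    obtain ⟨S, hS⟩ := RationalData.Over.exists_transfer hover x hx
    exact ⟨S, fun σ hσ x' hx' => ⟨g.apply x', (hS σ hσ x' hx').2,
      Machine.Step.compute hv (hS σ hσ x' hx').1⟩⟩
  | @branch_zero v w₀ w₁ h x hv hx =>
    have hover := hK v
    rw [hv] at hover
    obtain ⟨S, hS⟩ := PolyOver.exists_transfer hover x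
    -- With `0` and the tested value in the set, monotonicity of `σ` preserves the sign and so the
    -- branch.
    refine ⟨insert 0 (insert (MvPolynomial.eval (fun i => x i) h) S), fun σ hσ x' hx' =>
      ⟨x', hx', Machine.Step.branch_zero hv ?_⟩⟩
    rw [hS σ (hσ.mono ((Finset.subset_insert _ _).trans (Finset.subset_insert _ _))) x' hx',
      ← hσ.map_zero]
    exact hσ.strictMono (by simp) (by simp) hx
  | @branch_one v w₀ w₁ h x hv hx =>
    have hover := hK v
    rw [hv] at hover
    obtain ⟨S, hS⟩ := PolyOver.exists_transfer hover x
    refine ⟨insert 0 (insert (MvPolynomial.eval (fun i => x i) h) S), fun σ hσ x' hx' =>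
      ⟨x', hx', Machine.Step.branch_one hv ?_⟩⟩
    rw [hS σ (hσ.mono ((Finset.subset_insert _ _).trans (Finset.subset_insert _ _))) x' hx',
      ← hσ.map_zero]
    exact hσ.strictMono.monotoneOn (by simp) (by simp) hx
  | @shiftLeft v w x hv =>
    exact ⟨∅, fun σ _ x' hx' => ⟨shiftBy 1 x', fun i => by
      simp only [shiftBy_apply, hx'], Machine.Step.shiftLeft hv⟩⟩
  | @shiftRight v w x hv =>
    exact ⟨∅, fun σ _ x' hx' => ⟨shiftBy (-1) x', fun i => by
      simp only [shiftBy_apply, hx'], Machine.Step.shiftRight hv⟩⟩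

theorem Machine.exists_transfer_steps {F : Subring ℝ} {K : Machine}
    (hK : ∀ v, (K.node v).Over F) {c d : Fin K.size × Tape}
    (hcd : Relation.ReflTransGen K.Step c d) :
    ∃ S : Finset ℝ, ∀ σ, IsSpecMap F S σ → ∀ x' : Tape, (∀ i, x' i = σ (c.2 i)) →
      ∃ y' : Tape, (∀ i, y' i = σ (d.2 i)) ∧
        Relation.ReflTransGen K.Step (c.1, x') (d.1, y') := by
  classical
  induction hcd with
  | refl => exact ⟨∅, fun σ _ x' hx' => ⟨x', hx', .refl⟩⟩
  | tail _ hstep ih =>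
    obtain ⟨S, hS⟩ := ih
    obtain ⟨T, hT⟩ := hstep.exists_transfer hK
    refine ⟨S ∪ T, fun σ hσ x' hx' => ?_⟩
    obtain ⟨y', hy', h1⟩ := hS σ (hσ.mono Finset.subset_union_left) x' hx'
    obtain ⟨z', hz', h2⟩ := hT σ (hσ.mono Finset.subset_union_right) y' hy'
    exact ⟨z', hz', h1.tail h2⟩

/-- A tape has finite support. Hence the infimum in `readOff` is attained and is not the default
value for the empty set. -/
theorem exists_ne_one (x : Tape) : {n : ℕ | x (-(n : ℤ)) ≠ 1}.Nonempty := by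
  by_contra h
  rw [Set.not_nonempty_iff_eq_empty, Set.eq_empty_iff_forall_notMem] at h
  have hinf : (Set.range fun n : ℕ => -(n : ℤ)) ⊆ x.support := by
    rintro _ ⟨n, rfl⟩
    have := h n
    simp only [Set.mem_ofPred_eq, not_not] at this
    simp [this]
  refine (Set.infinite_range_of_injective ?_) (x.support.finite_toSet.subset hinf)
  intro a b hab
  simpa using hab

theorem readOff_exists_transfer (F : Subring ℝ) (x : Tape) :
    ∃ S : Finset ℝ, ∀ σ, IsSpecMap F S σ → ∀ x' : Tape, (∀ i, x' i = σ (x i)) →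
      readOff x' = (readOff x).map σ := by
  classical
  set N := sInf {n : ℕ | x (-(n : ℤ)) ≠ 1} with hN
  -- Ones go to ones, and injectivity on these two reals keeps the first entry different from `1`
  -- different from it.
  refine ⟨{x (-(N : ℤ)), 1}, fun σ hσ x' hx' => ?_⟩
  have hN' : sInf {n : ℕ | x' (-(n : ℤ)) ≠ 1} = N := by
    refine le_antisymm (Nat.sInf_le ?_) (le_csInf (exists_ne_one x') fun n hn => ?_)
    · simp only [Set.mem_ofPred_eq, hx']
      intro h
      rw [← hσ.map_one] at h
      exact Nat.sInf_mem (exists_ne_one x) (hσ.strictMono.injOn (by simp [hN]) (by simp) h)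
    · refine Nat.sInf_le fun h => hn ?_
      rw [hx', h, hσ.map_one]
  simp only [readOff, hN', ← hN, List.map_map]
  refine List.map_congr_left fun i _ => ?_
  simp [hx']

theorem Machine.Computes.exists_transfer {F : Subring ℝ} {K : Machine}
    (hK : ∀ v, (K.node v).Over F) {z y : List ℝ} (h : K.Computes z y) :
    ∃ S : Finset ℝ, ∀ σ, IsSpecMap F S σ → K.Computes (z.map σ) (y.map σ) := by
  classical
  obtain ⟨v, x, g, hsteps, hv, rfl⟩ := h
  have h0 := hK K.start
  rw [K.node_start] at h0
  have h1 := hK v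
  rw [hv] at h1
  obtain ⟨S₀, hS₀⟩ := RationalData.Over.exists_transfer h0 (embed z)
    (LinearData.toRational_definedAt _ _)
  obtain ⟨S₁, hS₁⟩ := Machine.exists_transfer_steps hK hsteps
  obtain ⟨S₂, hS₂⟩ := RationalData.Over.exists_transfer h1 x (LinearData.toRational_definedAt _ _)
  obtain ⟨S₃, hS₃⟩ := readOff_exists_transfer F (g.apply x)
  simp only [LinearData.toRational_apply] at hS₀ hS₂
  refine ⟨S₀ ∪ (S₁ ∪ (S₂ ∪ S₃)), fun σ hσ => ?_⟩
  have s1 := hσ.mono Finset.subset_union_right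
  have s2 := s1.mono Finset.subset_union_right
  have hemb : ∀ i, embed (z.map σ) i = σ (embed z i) := by
    intro i
    rw [embed_apply, embed_apply, List.length_map]
    split_ifs
    · have := List.getD_map (l := z) (n := (i - 1).toNat) (d := 0) σ
      rwa [hσ.map_zero] at this
    · rw [hσ.map_one]
    · rw [hσ.map_zero]
  obtain ⟨y', hy', hsteps'⟩ := hS₁ σ (s1.mono Finset.subset_union_left) _
    (hS₀ σ (hσ.mono Finset.subset_union_left) _ hemb).2
  exact ⟨v, y', g, hsteps', hv, (hS₃ σ (s2.mono Finset.subset_union_right) _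
    (hS₂ σ (s2.mono Finset.subset_union_left) _ hy').2).symm⟩

/-! ### Determinism of machines. -/

theorem Machine.Step.right_unique {K : Machine} : Relator.RightUnique K.Step := by
  intro c d e h1 h2
  cases h1 <;> cases h2 <;> simp_all <;> linarith

theorem Machine.not_step_output {K : Machine} {v : Fin K.size} {x : Tape} {g : LinearData}
    (hv : K.node v = Node.output g) (d : Fin K.size × Tape) : ¬ K.Step (v, x) d := by
  intro h
  cases h <;> simp_all

/-- Of two runs from one configuration of a deterministic system, one continues the other, and
nothing continues past an output node. -/
theorem Machine.Computes.unique {K : Machine} {z y y' : List ℝ} (h : K.Computes z y)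
    (h' : K.Computes z y') : y = y' := by
  obtain ⟨v, x, g, hs, hv, rfl⟩ := h
  obtain ⟨v', x', g', hs', hv', rfl⟩ := h'
  have : (v, x) = (v', x') := by
    rcases Relation.ReflTransGen.total_of_right_unique Machine.Step.right_unique hs hs' with h | h
    · rcases Relation.ReflTransGen.cases_head h with h | ⟨d, h, -⟩
      · exact h
      · exact absurd h (Machine.not_step_output hv d)
    · rcases Relation.ReflTransGen.cases_head h with h | ⟨d, h, -⟩
      · exact h.symm
      · exact absurd h (Machine.not_step_output hv' d)
  obtain ⟨rfl, rfl⟩ := Prod.mk.inj this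
  rw [hv] at hv'
  obtain rfl : g = g' := by injection hv'
  rfl

end BSS


/-! ### Unique readability of the codes of atomic sentences -/

namespace Diagram

variable {L : Language} [Encodable (Σ n, L.Functions n)] [Encodable (Σ n, L.Relations n)]
variable {M N X : Type*}

/-- The symbols of a term in prefix notation: numbers of function symbols and elements. -/
def termTokens : L.Term M → List (ℕ ⊕ M)
  | .var a => [Sum.inr a]
  | @Language.Term.func _ _ n f ts =>
      Sum.inl (Encodable.encode (⟨n, f⟩ : Σ n, L.Functions n)) ::
        (List.ofFn fun i => termTokens (ts i)).flatten

/-- The word that codes one symbol of a term. -/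
def tokenCode (num : ℕ → X) (el : M → List X) : ℕ ⊕ M → List X
  | .inl k => [num (k + 1)]
  | .inr a => num 0 :: num (el a).length :: el a

/-- The first letter of the code of an atomic sentence, as a number. -/
def Atom.head : Atom L M → ℕ
  | .eq _ _ => 0
  | @Atom.rel _ _ n R _ => Encodable.encode (⟨n, R⟩ : Σ n, L.Relations n) + 1

/-- The symbols of the terms in an atomic sentence. -/
def Atom.tokens : Atom L M → List (ℕ ⊕ M)
  | .eq s t => termTokens s ++ termTokens t
  | .rel _ ts => (List.ofFn fun i => termTokens (ts i)).flatten

/-- Replacement of the elements that occur in an atomic sentence. -/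
def Atom.relabel (f : M → N) : Atom L M → Atom L N
  | .eq s t => .eq (s.relabel f) (t.relabel f)
  | .rel R ts => .rel R fun i => (ts i).relabel f

theorem flatMap_flatten_ofFn {A B : Type*} (c : A → List B) {n : ℕ} (g : Fin n → List A) :
    (List.ofFn g).flatten.flatMap c = (List.ofFn fun i => (g i).flatMap c).flatten := by
  induction n with
  | zero => simp
  | succ n ih => simp [List.ofFn_succ, ih]

theorem map_flatten_ofFn {A B : Type*} (c : A → B) {n : ℕ} (g : Fin n → List A) :
    (List.ofFn g).flatten.map c = (List.ofFn fun i => (g i).map c).flatten := by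
  induction n with
  | zero => simp
  | succ n ih => simp [List.ofFn_succ, ih]

theorem mem_flatten_ofFn {A : Type*} {n : ℕ} (g : Fin n → List A) (i : Fin n) {a : A}
    (ha : a ∈ g i) : a ∈ (List.ofFn g).flatten :=
  List.mem_flatten.mpr ⟨g i, by simp, ha⟩

/-- Coding splits into two stages, terms to symbols and symbols to letters. Unique readability is
proved for each stage, and a change of elements or of letters affects only one of them. -/
theorem termCode_eq (num : ℕ → X) (el : M → List X) (t : L.Term M) :
    termCode num el t = (termTokens t).flatMap (tokenCode num el) := by
  induction t with
  | var a => simp [termCode, termTokens, tokenCode]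
  | func f ts ih =>
    rw [termCode, termTokens, List.flatMap_cons, flatMap_flatten_ofFn]
    simp only [tokenCode, ih, List.singleton_append]

theorem Atom.code_eq (num : ℕ → X) (el : M → List X) (A : Atom L M) :
    A.code num el = num A.head :: A.tokens.flatMap (tokenCode num el) := by
  cases A with
  | eq s t => simp [Atom.code, Atom.head, Atom.tokens, termCode_eq]
  | rel R ts => simp only [Atom.code, Atom.head, Atom.tokens, termCode_eq, flatMap_flatten_ofFn]

theorem termTokens_relabel (f : M → N) (t : L.Term M) :
    termTokens (t.relabel f) = (termTokens t).map (Sum.map id f) := by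
  induction t with
  | var a => simp [Language.Term.relabel, termTokens]
  | func g ts ih =>
    rw [Language.Term.relabel, termTokens, termTokens, List.map_cons, map_flatten_ofFn]
    simp only [ih, Sum.map_inl, id]

theorem Atom.head_relabel (f : M → N) (A : Atom L M) : (A.relabel f).head = A.head := by
  cases A <;> rfl

theorem Atom.tokens_relabel (f : M → N) (A : Atom L M) :
    (A.relabel f).tokens = A.tokens.map (Sum.map id f) := by
  cases A with
  | eq s t => simp [Atom.relabel, Atom.tokens, termTokens_relabel]
  | rel R ts => simp only [Atom.relabel, Atom.tokens, termTokens_relabel, map_flatten_ofFn]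

theorem exists_relabel_term (f : M → N) (t : L.Term N)
    (h : ∀ a, Sum.inr a ∈ termTokens t → a ∈ Set.range f) : ∃ t' : L.Term M, t'.relabel f = t := by
  induction t with
  | var a =>
    obtain ⟨b, rfl⟩ := h a (by simp [termTokens])
    exact ⟨.var b, rfl⟩
  | func g ts ih =>
    choose ts' hts' using fun i => ih i fun a ha => h a (by
      rw [termTokens]
      exact List.mem_cons_of_mem _ (mem_flatten_ofFn (fun i => termTokens (ts i)) i ha))
    exact ⟨.func g ts', by simp only [Language.Term.relabel, hts']⟩

theorem Atom.exists_relabel (f : M → N) (A : Atom L N)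
    (h : ∀ a, Sum.inr a ∈ A.tokens → a ∈ Set.range f) : ∃ A' : Atom L M, A'.relabel f = A := by
  cases A with
  | eq s t =>
    obtain ⟨s', hs⟩ := exists_relabel_term f s fun a ha => h a (by simp [Atom.tokens, ha])
    obtain ⟨t', ht⟩ := exists_relabel_term f t fun a ha => h a (by simp [Atom.tokens, ha])
    exact ⟨.eq s' t', by simp [Atom.relabel, hs, ht]⟩
  | rel R ts =>
    choose ts' hts' using fun i => exists_relabel_term f (ts i) fun a ha => h a
      (mem_flatten_ofFn (fun i => termTokens (ts i)) i ha)
    exact ⟨.rel R ts', by simp only [Atom.relabel, hts']⟩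

/-- The first letter tells elements (zero) from function symbols (positive), and the recorded length
marks where an element ends. -/
theorem tokenCode_append_inj {num : ℕ → X} {el : M → List X} (hnum : Function.Injective num)
    (hel : Function.Injective el) {a b : ℕ ⊕ M} {l l' : List X}
    (h : tokenCode num el a ++ l = tokenCode num el b ++ l') : a = b ∧ l = l' := by
  rcases a with a | a <;> rcases b with b | b <;>
    simp only [tokenCode, List.cons_append, List.cons.injEq, hnum.eq_iff, List.nil_append] at h
  · exact ⟨by rw [Nat.succ_injective h.1], h.2⟩
  · exact absurd h.1 (Nat.succ_ne_zero _)
  · exact absurd h.1 (Nat.succ_ne_zero _).symm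
  · obtain ⟨h1, h2⟩ := List.append_inj h.2.2 h.2.1
    exact ⟨by rw [hel h1], h2⟩

theorem flatMap_tokenCode_injective {num : ℕ → X} {el : M → List X}
    (hnum : Function.Injective num) (hel : Function.Injective el) :
    Function.Injective fun l : List (ℕ ⊕ M) => l.flatMap (tokenCode num el) := by
  have hne : ∀ a, tokenCode num el a ≠ [] := by rintro (a | a) <;> simp [tokenCode]
  intro l
  induction l with
  | nil =>
    rintro (_ | ⟨b, l'⟩) h
    · rfl
    · simp [hne] at h
  | cons a l ih =>
    rintro (_ | ⟨b, l'⟩) h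
    · simp [hne] at h
    · simp only [List.flatMap_cons] at h
      obtain ⟨rfl, h2⟩ := tokenCode_append_inj hnum hel h
      rw [ih h2]

/-- Prefix-freeness is assumed only for the members of `ts`, so that the hypothesis can be the
induction hypothesis for the arguments of a term. -/
theorem flatten_ofFn_append_inj {A B : Type*} (c : A → List B) :
    ∀ {n : ℕ} (ts ts' : Fin n → A)
      (_ : ∀ i s l l', c (ts i) ++ l = c s ++ l' → ts i = s ∧ l = l') (l l' : List B),
      (List.ofFn fun i => c (ts i)).flatten ++ l = (List.ofFn fun i => c (ts' i)).flatten ++ l' →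
        ts = ts' ∧ l = l'
  | 0, ts, ts', _, l, l', h => ⟨Subsingleton.elim _ _, by simpa using h⟩
  | n + 1, ts, ts', hc, l, l', h => by
    simp only [List.ofFn_succ, List.flatten_cons, List.append_assoc] at h
    obtain ⟨h0, h⟩ := hc 0 _ _ _ h
    obtain ⟨h1, h2⟩ := flatten_ofFn_append_inj c (fun i => ts i.succ) (fun i => ts' i.succ)
      (fun i => hc i.succ) l l' h
    exact ⟨funext fun i => Fin.cases h0 (fun i => congrFun h1 i) i, h2⟩

/-- Prefix notation needs no brackets: a function symbol determines its arity, hence how many terms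
follow. -/
theorem termTokens_append_inj (s t : L.Term M) (l l' : List (ℕ ⊕ M))
    (h : termTokens s ++ l = termTokens t ++ l') : s = t ∧ l = l' := by
  induction s generalizing t l l' with
  | var a =>
    cases t with
    | var b => simpa [termTokens] using h
    | func g ts' => simp [termTokens] at h
  | @func n f ts ih =>
    cases t with
    | var b => simp [termTokens] at h
    | @func m g ts' =>
      simp only [termTokens, List.cons_append, List.cons.injEq, Sum.inl.injEq,
        Encodable.encode_inj] at h
      obtain ⟨h1, h2⟩ := h
      obtain ⟨rfl, h1⟩ := Sigma.mk.inj h1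
      obtain rfl := eq_of_heq h1
      obtain ⟨rfl, h3⟩ := flatten_ofFn_append_inj termTokens ts ts' ih l l' h2
      exact ⟨rfl, h3⟩

theorem Atom.ext_tokens {A B : Atom L M} (h1 : A.head = B.head) (h2 : A.tokens = B.tokens) :
    A = B := by
  cases A with
  | eq s t =>
    cases B with
    | eq s' t' =>
      obtain ⟨rfl, h3⟩ := termTokens_append_inj s s' _ _ h2
      obtain ⟨rfl, -⟩ := termTokens_append_inj t t' [] [] (by simpa using h3)
      rfl
    | rel R ts => simp [Atom.head] at h1
  | @rel n R ts =>
    cases B with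
    | eq s' t' => simp [Atom.head] at h1
    | @rel m R' ts' =>
      simp only [Atom.head, Nat.add_right_cancel_iff, Encodable.encode_inj] at h1
      obtain ⟨rfl, h1⟩ := Sigma.mk.inj h1
      obtain rfl := eq_of_heq h1
      obtain ⟨rfl, -⟩ := flatten_ofFn_append_inj termTokens ts ts'
        (fun i => termTokens_append_inj (ts i)) [] [] (by simpa [Atom.tokens] using h2)
      rfl

theorem Atom.code_injective {num : ℕ → X} {el : M → List X} (hnum : Function.Injective num)
    (hel : Function.Injective el) : Function.Injective (Atom.code (L := L) num el) := by
  intro A B h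
  rw [Atom.code_eq, Atom.code_eq, List.cons.injEq] at h
  exact Atom.ext_tokens (hnum h.1) (flatMap_tokenCode_injective hnum hel h.2)

/-! ### Truth and the universe, read off the diagram. -/

theorem mem_atomicDiagram_one {num : ℕ → X} {el : M → List X} (hnum : Function.Injective num)
    (hel : Function.Injective el) [L.Structure M] (A : Atom L M) :
    num 1 :: A.code num el ∈ atomicDiagram L num el ↔ A.Holds := by
  refine ⟨?_, fun h => ⟨A, Or.inl ⟨h, rfl⟩⟩⟩
  rintro ⟨B, ⟨hB, h⟩ | ⟨hB, h⟩⟩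
  · rw [List.cons.injEq] at h
    rwa [Atom.code_injective hnum hel h.2]
  · rw [List.cons.injEq] at h
    exact absurd (hnum h.1) one_ne_zero

theorem mem_atomicDiagram_zero {num : ℕ → X} {el : M → List X} (hnum : Function.Injective num)
    (hel : Function.Injective el) [L.Structure M] (A : Atom L M) :
    num 0 :: A.code num el ∈ atomicDiagram L num el ↔ ¬ A.Holds := by
  refine ⟨?_, fun h => ⟨A, Or.inr ⟨h, rfl⟩⟩⟩
  rintro ⟨B, ⟨hB, h⟩ | ⟨hB, h⟩⟩
  · rw [List.cons.injEq] at h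
    exact absurd (hnum h.1) zero_ne_one
  · rw [List.cons.injEq] at h
    rwa [Atom.code_injective hnum hel h.2]

/-- The word has the form of the true equation `a = a` for the element `a` coded by `w`. With its
converse below, this makes the universe decidable from the diagram. -/
theorem mem_range_of_mem_atomicDiagram {num : ℕ → X} {el : M → List X}
    (hnum : Function.Injective num) [L.Structure M] {w : List X}
    (hw : num 1 :: num 0 :: num 0 :: num w.length :: w ++ num 0 :: num w.length :: w ∈
      atomicDiagram L num el) : w ∈ Set.range el := by
  obtain ⟨B, ⟨-, h⟩ | ⟨-, h⟩⟩ := hw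
  · rw [Atom.code_eq] at h
    simp only [List.cons_append, List.cons.injEq, hnum.eq_iff, true_and] at h
    cases B with
    | rel R ts => simp [Atom.head] at h
    | eq s t =>
      cases s with
      -- A term that begins with a function symbol has a positive first letter, whereas here it is
      -- zero.
      | func f ts =>
        have := h.2
        simp only [Atom.tokens, termTokens, List.cons_append, List.flatMap_cons, tokenCode,
          List.nil_append, List.cons.injEq, hnum.eq_iff] at this
        exact absurd this.1 (Nat.succ_ne_zero _).symm
      | var a =>
        have := h.2
        simp only [Atom.tokens, termTokens, List.cons_append, List.flatMap_cons, tokenCode,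
          List.nil_append, List.cons.injEq, hnum.eq_iff] at this
        exact ⟨a, (List.append_inj this.2.2 this.2.1).1.symm⟩
  · simp [hnum.eq_iff] at h

theorem mem_atomicDiagram_of_mem_range {num : ℕ → X} {el : M → List X} [L.Structure M]
    {w : List X} (hw : w ∈ Set.range el) :
    num 1 :: num 0 :: num 0 :: num w.length :: w ++ num 0 :: num w.length :: w ∈
      atomicDiagram L num el := by
  obtain ⟨a, rfl⟩ := hw
  refine ⟨.eq (.var a) (.var a), Or.inl ⟨rfl, ?_⟩⟩
  simp [Atom.code, termCode]

theorem Atom.code_relabel_map {N' Y : Type*} {num : ℕ → X} {num' : ℕ → Y} {el : N → List X}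
    {el' : N' → List Y} {f : M → N} {f' : M → N'} {σ : X → Y} (hσ : ∀ n, σ (num n) = num' n)
    (hf : ∀ a, el' (f' a) = (el (f a)).map σ) (A : Atom L M) :
    (A.relabel f').code num' el' = ((A.relabel f).code num el).map σ := by
  rw [Atom.code_eq, Atom.code_eq, List.map_cons, hσ, Atom.head_relabel, Atom.head_relabel,
    Atom.tokens_relabel, Atom.tokens_relabel, List.map_flatMap, List.flatMap_map, List.flatMap_map]
  congr 2
  funext a
  rcases a with a | a
  · simp [tokenCode, hσ]
  · simp [tokenCode, hσ, hf]

end Diagram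

/-! ### The substructure of the elements with entries in a subring -/

namespace BSS

open RealSpec Diagram

variable {L : Language} [Encodable (Σ n, L.Functions n)] [Encodable (Σ n, L.Relations n)]
variable {U : Set (List ℝ)} [L.Structure U] {K : Machine} {F : Subring ℝ}

theorem Machine.Decides.mem_iff {A : Set (List ℝ)} (hK : K.Decides A) (z : List ℝ) :
    z ∈ A ↔ K.Computes z [1] := by
  refine ⟨(hK z).1, fun h => ?_⟩
  by_contra hz
  have := h.unique ((hK z).2 hz)
  simp at this

theorem Machine.Decides.notMem_iff {A : Set (List ℝ)} (hK : K.Decides A) (z : List ℝ) :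
    z ∉ A ↔ K.Computes z [0] := by
  refine ⟨(hK z).2, fun h hz => ?_⟩
  have := h.unique ((hK z).1 hz)
  simp at this

theorem Machine.Decides.exists_transfer {A : Set (List ℝ)} (hK : K.Decides A)
    (hF : ∀ v, (K.node v).Over F) {z : List ℝ} (hz : z ∈ A) :
    ∃ S : Finset ℝ, ∀ σ, IsSpecMap F S σ → z.map σ ∈ A := by
  obtain ⟨S, hS⟩ := ((hK z).1 hz).exists_transfer hF
  refine ⟨S, fun σ hσ => (hK.mem_iff _).mpr ?_⟩
  have := hS σ hσ
  rwa [List.map_singleton, hσ.map_one] at this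

theorem Machine.Defines.mem_of_mem_diagram {w : List ℝ}
    (hw : (Nat.cast 1 : ℝ) :: Nat.cast 0 :: Nat.cast 0 :: Nat.cast w.length :: w ++
        Nat.cast 0 :: Nat.cast w.length :: w ∈
      atomicDiagram L (Nat.cast : ℕ → ℝ) (fun a : U => (a : List ℝ))) : w ∈ U := by
  obtain ⟨a, rfl⟩ := mem_range_of_mem_atomicDiagram Nat.cast_injective hw
  exact a.2

theorem Machine.Defines.mem_diagram_of_mem {w : List ℝ} (hw : w ∈ U) :
    (Nat.cast 1 : ℝ) :: Nat.cast 0 :: Nat.cast 0 :: Nat.cast w.length :: w ++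
        Nat.cast 0 :: Nat.cast w.length :: w ∈
      atomicDiagram L (Nat.cast : ℕ → ℝ) (fun a : U => (a : List ℝ)) :=
  mem_atomicDiagram_of_mem_range ⟨⟨w, hw⟩, rfl⟩

theorem Machine.Defines.exists_transfer_mem (hK : K.Defines L U) (hF : ∀ v, (K.node v).Over F)
    (u : U) : ∃ S : Finset ℝ, ∀ σ, IsSpecMap F S σ → (u : List ℝ).map σ ∈ U := by
  obtain ⟨S, hS⟩ := Machine.Decides.exists_transfer hK hF
    (Machine.Defines.mem_diagram_of_mem (L := L) u.2)
  refine ⟨S, fun σ hσ => Machine.Defines.mem_of_mem_diagram (L := L) ?_⟩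
  have h : ∀ n : ℕ, σ n = n := fun n => hσ.fix _ (natCast_mem F n)
  simpa only [List.map_cons, List.map_append, h, List.length_map] using hS σ hσ

/-- Truth and falsity of an atomic sentence are both memberships in the diagram, under the markers
`1` and `0`. Transferring whichever of them holds gives an equivalence. -/
theorem Machine.Defines.exists_transfer_holds (hK : K.Defines L U)
    (hF : ∀ v, (K.node v).Over F) {α : Type*} (A : Atom L α) (v : α → U) :
    ∃ S : Finset ℝ, ∀ σ, IsSpecMap F S σ → ∀ v' : α → U,
      (∀ a, (v' a : List ℝ) = (v a : List ℝ).map σ) →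
        ((A.relabel v').Holds ↔ (A.relabel v).Holds) := by
  have hel : Function.Injective fun a : U => (a : List ℝ) := Subtype.val_injective
  by_cases h : (A.relabel v).Holds
  · obtain ⟨S, hS⟩ := Machine.Decides.exists_transfer hK hF
      ((mem_atomicDiagram_one Nat.cast_injective hel _).mpr h)
    refine ⟨S, fun σ hσ v' hv' => iff_of_true ?_ h⟩
    have hn : ∀ n : ℕ, σ n = n := fun n => hσ.fix _ (natCast_mem F n)
    have := hS σ hσ
    rwa [List.map_cons, hn, ← Atom.code_relabel_map hn (el' := fun a : U => (a : List ℝ)) hv',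
      mem_atomicDiagram_one Nat.cast_injective hel] at this
  · obtain ⟨S, hS⟩ := Machine.Decides.exists_transfer hK hF
      ((mem_atomicDiagram_zero Nat.cast_injective hel _).mpr h)
    refine ⟨S, fun σ hσ v' hv' => iff_of_false ?_ h⟩
    have hn : ∀ n : ℕ, σ n = n := fun n => hσ.fix _ (natCast_mem F n)
    have := hS σ hσ
    rwa [List.map_cons, hn, ← Atom.code_relabel_map hn (el' := fun a : U => (a : List ℝ)) hv',
      mem_atomicDiagram_zero Nat.cast_injective hel] at this

/-- The elements of the structure all of whose entries lie in `F`. -/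
def Machine.Defines.restrict (hK : K.Defines L U) (hF : ∀ v, (K.node v).Over F)
    (hrc : RootClosed F) : L.Substructure U where
  carrier := {u | ∀ x ∈ (u : List ℝ), x ∈ F}
  fun_mem := by
    classical
    intro n f xs hxs
    set y := Language.Structure.funMap f xs with hy
    -- The sentence `f xs = y` is transferred with `y` as a variable of its own. The map fixes the
    -- entries of `xs` and sends those of `y` into `F`, so the transferred sentence says that `y`
    -- equals its own image.
    obtain ⟨S, hS⟩ := hK.exists_transfer_holds hF
      (.eq (.func f fun i => .var (some i)) (.var none) : Atom L (Option (Fin n)))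
      (fun o => o.elim y xs)
    obtain ⟨T, hT⟩ := hK.exists_transfer_mem hF y
    obtain ⟨σ, hσ⟩ := exists_isSpecMap hrc (S ∪ (T ∪ (y : List ℝ).toFinset))
    have hσ' := hσ.mono Finset.subset_union_right
    have h1 := hT σ (hσ'.mono Finset.subset_union_left)
    have h2 := hS σ (hσ.mono Finset.subset_union_left) (fun o => o.elim ⟨_, h1⟩ xs) (by
      rintro (_ | i)
      · rfl
      · refine (List.map_id _).symm.trans (List.map_congr_left fun x hx => ?_)
        exact (hσ.fix x (hxs i x hx)).symm)
    have h3 : y = ⟨_, h1⟩ := h2.mpr rfl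
    intro x hx
    rw [h3] at hx
    obtain ⟨a, ha, rfl⟩ := List.mem_map.mp hx
    exact hσ'.mem a (Finset.mem_union_right _ (List.mem_toFinset.mpr ha))

theorem Machine.Defines.mem_restrict (hK : K.Defines L U) (hF : ∀ v, (K.node v).Over F)
    (hrc : RootClosed F) (u : U) : u ∈ hK.restrict hF hrc ↔ ∀ x ∈ (u : List ℝ), x ∈ F := Iff.rfl

/-- An equivalence is required, not just preservation of truth, because the induction passes through
implications. -/
theorem Machine.Defines.exists_transfer_isQF (hK : K.Defines L U)
    (hF : ∀ v, (K.node v).Over F) {α : Type*} {k : ℕ} {φ : L.BoundedFormula α k} (hφ : φ.IsQF)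
    (v : α → U) (xs : Fin k → U) :
    ∃ S : Finset ℝ, ∀ σ, IsSpecMap F S σ → ∀ (v' : α → U) (xs' : Fin k → U),
      (∀ a, (v' a : List ℝ) = (v a : List ℝ).map σ) →
      (∀ a, (xs' a : List ℝ) = (xs a : List ℝ).map σ) →
        (φ.Realize v' xs' ↔ φ.Realize v xs) := by
  classical
  have atom : ∀ A : Atom L (α ⊕ Fin k), ∃ S : Finset ℝ, ∀ σ, IsSpecMap F S σ →
      ∀ (v' : α → U) (xs' : Fin k → U),
      (∀ a, (v' a : List ℝ) = (v a : List ℝ).map σ) →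
      (∀ a, (xs' a : List ℝ) = (xs a : List ℝ).map σ) →
        ((A.relabel (Sum.elim v' xs')).Holds ↔ (A.relabel (Sum.elim v xs)).Holds) := by
    intro A
    obtain ⟨S, hS⟩ := hK.exists_transfer_holds hF A (Sum.elim v xs)
    exact ⟨S, fun σ hσ v' xs' h1 h2 => hS σ hσ _ (by rintro (a | a) <;> simp [h1, h2])⟩
  induction hφ with
  | falsum => exact ⟨∅, fun σ _ v' xs' _ _ => Iff.rfl⟩
  | of_isAtomic h =>
    cases h with
    | equal t₁ t₂ =>
      obtain ⟨S, hS⟩ := atom (.eq t₁ t₂)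
      refine ⟨S, fun σ hσ v' xs' h1 h2 => ?_⟩
      simpa [Atom.relabel, Atom.Holds] using hS σ hσ v' xs' h1 h2
    | rel R ts =>
      obtain ⟨S, hS⟩ := atom (.rel R ts)
      refine ⟨S, fun σ hσ v' xs' h1 h2 => ?_⟩
      simpa [Atom.relabel, Atom.Holds, Language.BoundedFormula.realize_rel] using
        hS σ hσ v' xs' h1 h2
  | imp _ _ ih1 ih2 =>
    obtain ⟨S, hS⟩ := ih1
    obtain ⟨T, hT⟩ := ih2
    refine ⟨S ∪ T, fun σ hσ v' xs' h1 h2 => ?_⟩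
    rw [Language.BoundedFormula.realize_imp, Language.BoundedFormula.realize_imp,
      hS σ (hσ.mono Finset.subset_union_left) v' xs' h1 h2,
      hT σ (hσ.mono Finset.subset_union_right) v' xs' h1 h2]

/-- A witness `y` is replaced by its image under `σ`. The finite set contains the entries of `y`, so
that the image has entries in `F`, and what is needed for the image to lie in `U`. -/
theorem Machine.Defines.exists_transfer_isExistential (hK : K.Defines L U)
    (hF : ∀ v, (K.node v).Over F) (hrc : RootClosed F) {α : Type*} {k : ℕ}
    {φ : L.BoundedFormula α k} (hφ : φ.IsExistential) (v : α → U) (xs : Fin k → U)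
    (h : φ.Realize v xs) :
    ∃ S : Finset ℝ, ∀ σ, IsSpecMap F S σ →
      ∀ (v' : α → hK.restrict hF hrc) (xs' : Fin k → hK.restrict hF hrc),
      (∀ a, ((v' a : U) : List ℝ) = (v a : List ℝ).map σ) →
      (∀ a, ((xs' a : U) : List ℝ) = (xs a : List ℝ).map σ) → φ.Realize v' xs' := by
  classical
  induction hφ with
  | of_isQF hQ =>
    obtain ⟨S, hS⟩ := hK.exists_transfer_isQF hF hQ v xs
    refine ⟨S, fun σ hσ v' xs' h1 h2 => ?_⟩
    have := (hS σ hσ (fun a => v' a) (fun a => xs' a) h1 h2).mpr h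
    exact (hQ.realize_embedding (hK.restrict hF hrc).subtype).mp this
  | @ex n ψ _ ih =>
    rw [Language.BoundedFormula.realize_ex] at h
    obtain ⟨y, hy⟩ := h
    obtain ⟨S, hS⟩ := ih (Fin.snoc xs y) hy
    obtain ⟨T, hT⟩ := hK.exists_transfer_mem hF y
    refine ⟨S ∪ (T ∪ (y : List ℝ).toFinset), fun σ hσ v' xs' h1 h2 => ?_⟩
    have hσ' := hσ.mono Finset.subset_union_right
    have hmem := hT σ (hσ'.mono Finset.subset_union_left)
    rw [Language.BoundedFormula.realize_ex]
    refine ⟨⟨⟨_, hmem⟩, fun x hx => ?_⟩, hS σ (hσ.mono Finset.subset_union_left) v' _ h1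
      fun a => ?_⟩
    · obtain ⟨a, ha, rfl⟩ := List.mem_map.mp hx
      exact hσ'.mem a (Finset.mem_union_right _ (List.mem_toFinset.mpr ha))
    · refine Fin.lastCases ?_ (fun a => ?_) a
      · simp
      · simpa using h2 a

theorem Machine.Defines.restrict_leOne (hK : K.Defines L U) (hF : ∀ v, (K.node v).Over F)
    (hrc : RootClosed F) : (hK.restrict hF hrc).LeOne := by
  intro n φ hφ a h
  obtain ⟨S, hS⟩ := hK.exists_transfer_isExistential hF hrc hφ (fun i => (a i : U)) default h
  obtain ⟨σ, hσ⟩ := exists_isSpecMap hrc S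
  refine hS σ hσ a default (fun i => ?_) (fun i => i.elim0)
  -- Parameters from the substructure have entries in `F`, so `σ` does not move them.
  refine (List.map_id _).symm.trans (List.map_congr_left fun x hx => ?_)
  exact (hσ.fix x ((a i).2 x hx)).symm

end BSS

/-! ### Computability of list operations and predicates -/

section Computability

variable {α β γ σ : Type*} [Primcodable α] [Primcodable β] [Primcodable γ] [Primcodable σ]

/-- The fold is a recursion on the number of entries consumed, each fetched by its index. -/
theorem Computable.list_foldl {f : α → List β} {g : α → σ} {h : α → σ × β → σ}
    (hf : Computable f) (hg : Computable g) (hh : Computable₂ h) :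
    Computable fun a => (f a).foldl (fun s b => h a (s, b)) (g a) := by
  have step : Computable₂ fun (a : α) (p : ℕ × σ) =>
      (Option.casesOn ((f a)[p.1]?) p.2 fun b => h a (p.2, b) : σ) := by
    refine Computable.option_casesOn
      (Computable.list_getElem?.comp (hf.comp .fst) (Computable.fst.comp .snd))
      (Computable.snd.comp .snd) ?_
    exact hh.comp (Computable.fst.comp .fst)
      (.pair (Computable.snd.comp (Computable.snd.comp .fst)) .snd)
  refine (Computable.nat_rec (Computable.list_length.comp hf) hg step).of_eq fun a => ?_
  have : ∀ n ≤ (f a).length, (Nat.rec (g a) (fun n s =>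
      (Option.casesOn ((f a)[n]?) s fun b => h a (s, b) : σ)) n : σ) =
      ((f a).take n).foldl (fun s b => h a (s, b)) (g a) := by
    intro n hn
    induction n with
    | zero => simp
    | succ n ih =>
      have hlt : n < (f a).length := hn
      simp only [ih hlt.le]
      rw [List.take_succ_eq_append_getElem hlt, List.foldl_append, List.getElem?_eq_getElem hlt]
      rfl
  have h2 := this _ le_rfl
  rw [List.take_length] at h2
  exact h2

theorem Computable.list_foldr {f : α → List β} {g : α → σ} {h : α → β × σ → σ}
    (hf : Computable f) (hg : Computable g) (hh : Computable₂ h) :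
    Computable fun a => (f a).foldr (fun b s => h a (b, s)) (g a) :=
  (Computable.list_foldl (Computable.list_reverse.comp hf) hg
    (h := fun a p => h a (p.2, p.1))
    (hh.comp .fst (.pair (Computable.snd.comp .snd) (Computable.fst.comp .snd)))).of_eq
    fun a => by simp

theorem Computable.list_map {f : α → List β} {g : α → β → σ}
    (hf : Computable f) (hg : Computable₂ g) : Computable fun a => (f a).map (g a) :=
  (Computable.list_foldr hf (.const []) (h := fun a p => g a p.1 :: p.2)
    (Computable.list_cons.comp (hg.comp .fst (Computable.fst.comp .snd))
      (Computable.snd.comp .snd))).of_eq fun a => by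
    induction f a <;> simp_all

theorem Computable.list_flatMap {f : α → List β} {g : α → β → List σ}
    (hf : Computable f) (hg : Computable₂ g) : Computable fun a => (f a).flatMap (g a) :=
  (Primrec.list_flatten.to_comp.comp (Computable.list_map hf hg)).of_eq fun a => by
    rw [List.flatMap_def]

/-- For finitely many functions no uniformity is needed: a finite table of programs is itself a
program. -/
theorem Computable.finite_cases {ι : Type*} [Primcodable ι] [Finite ι] [Inhabited σ]
    {f : ι → α → σ} (hf : ∀ i, Computable (f i)) : Computable₂ f := by
  classical
  have key : ∀ l : List ι, ∃ g : ι × α → σ, Computable g ∧ ∀ i ∈ l, ∀ a, g (i, a) = f i a := by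
    intro l
    induction l with
    | nil => exact ⟨fun _ => default, .const _, by simp⟩
    | cons i l ih =>
      obtain ⟨g, hg, h⟩ := ih
      refine ⟨fun p => bif decide (p.1 = i) then f i p.2 else g p,
        Computable.cond ?_ ((hf i).comp .snd) hg, ?_⟩
      · exact (Primrec.eq (α := ι)).decide.to_comp.comp .fst (.const i)
      · intro j hj a
        by_cases hji : j = i
        · subst hji; simp
        · simp [hji, h j ((List.mem_cons.mp hj).resolve_left hji)]
  obtain ⟨l, hl⟩ : ∃ l : List ι, ∀ i, i ∈ l := by
    have := Fintype.ofFinite ι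
    exact ⟨Finset.univ.toList, by simp⟩
  obtain ⟨g, hg, h⟩ := key l
  exact hg.of_eq fun ⟨i, a⟩ => h i (hl i) a

namespace ComputablePred

theorem comp {p : β → Prop} (hp : ComputablePred p) {f : α → β} (hf : Computable f) :
    ComputablePred fun a => p (f a) := by
  classical
  exact Computable.computablePred (hp.decide.comp hf)

theorem and {p q : α → Prop} (hp : ComputablePred p) (hq : ComputablePred q) :
    ComputablePred fun a => p a ∧ q a := by
  classical
  exact Computable.computablePred ((Primrec.and.to_comp.comp hp.decide hq.decide).of_eq
    fun a => by simp)

theorem or {p q : α → Prop} (hp : ComputablePred p) (hq : ComputablePred q) :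
    ComputablePred fun a => p a ∨ q a := by
  classical
  exact Computable.computablePred ((Primrec.or.to_comp.comp hp.decide hq.decide).of_eq
    fun a => by simp)

theorem eq [DecidableEq β] {f g : α → β} (hf : Computable f) (hg : Computable g) :
    ComputablePred fun a => f a = g a :=
  ComputablePred.comp (p := fun x : β × β => x.1 = x.2)
    (PrimrecPred.computablePred Primrec.eq) (hf.pair hg)

theorem ite' {p : α → Prop} [DecidablePred p] (hp : ComputablePred p) {f g : α → σ}
    (hf : Computable f) (hg : Computable g) : Computable fun a => if p a then f a else g a :=
  (Computable.cond hp.decide hf hg).of_eq fun a => by by_cases h : p a <;> simp [h]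

theorem forall_mem {f : α → List β} {p : α → β → Prop} (hf : Computable f)
    (hp : ComputablePred fun x : α × β => p x.1 x.2) :
    ComputablePred fun a => ∀ b ∈ f a, p a b := by
  classical
  refine Computable.computablePred ((Computable.list_foldr hf (.const true)
    (h := fun a x => decide (p a x.1) && x.2) ?_).of_eq fun a => ?_)
  · exact Primrec.and.to_comp.comp (hp.decide.comp (.pair .fst (Computable.fst.comp .snd)))
      (Computable.snd.comp .snd)
  · induction f a with
    | nil => simp
    | cons b l ih => simp [ih]

/-- Unbounded search through the codes of `β`. Together with Post's theorem in `of_re_re` this is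
the only source of the nontrivial decidability results below. -/
theorem exists_re {p : α → β → Prop} (hp : ComputablePred fun x : α × β => p x.1 x.2) :
    REPred fun a => ∃ b, p a b := by
  classical
  have hf : Computable₂ fun (a : α) (n : ℕ) =>
      ((Encodable.decode n : Option β).bind fun b => if p a b then some b else none) := by
    refine Computable.option_bind (Computable.decode.comp .snd) ?_
    exact hp.ite' (f := fun x : α × β => some x.2) (g := fun _ => none)
      (Computable.option_some.comp .snd) (.const _) |>.comp
      (.pair (Computable.fst.comp .fst) .snd)
  refine (Partrec.rfindOpt hf).dom_re.of_eq fun a => ?_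
  rw [Nat.rfindOpt_dom]
  constructor
  · rintro ⟨n, b, hb⟩
    obtain ⟨c, -, hc⟩ := Option.mem_bind_iff.mp hb
    split_ifs at hc with h
    · exact ⟨c, h⟩
    · simp at hc
  · rintro ⟨b, hb⟩
    exact ⟨Encodable.encode b, b, by simp [hb]⟩

theorem of_re_re {p q : α → Prop} (hp : REPred p) (hq : REPred q) (h : ∀ a, ¬ p a ↔ q a) :
    ComputablePred p :=
  computable_iff_re_compl_re'.mpr ⟨hp, hq.of_eq fun a => (h a).symm⟩

end ComputablePred

end Computability

/-! ### Codes of polynomials -/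

/-- A polynomial with natural number coefficients is coded as a list of monomials, a monomial as
the list of its factors. -/
abbrev PolyCode (V : Type*) := List (List V)

namespace PolyCode

variable {V : Type*} {R : Type*} [CommSemiring R]

/-- The value of a coded polynomial at a point. -/
def eval (s : V → R) (f : PolyCode V) : R := (f.map fun m => (m.map s).prod).sum

@[simp] theorem eval_nil (s : V → R) : eval s ([] : List (List V)) = 0 := rfl

@[simp] theorem eval_cons (s : V → R) (m : List V) (f : List (List V)) :
    eval s (m :: f) = (m.map s).prod + eval s f := by simp [eval]

@[simp] theorem eval_append (s : V → R) (f g : List (List V)) :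
    eval s (f ++ g) = eval s f + eval s g := by simp [eval]

/-- The product of coded polynomials. -/
def mul (f g : PolyCode V) : PolyCode V := f.flatMap fun m => g.map fun m' => m ++ m'

theorem eval_map_append (s : V → R) (m : List V) (g : List (List V)) :
    eval s (g.map fun m' => m ++ m') = (m.map s).prod * eval s g := by
  induction g with
  | nil => simp
  | cons a g ih => simp [ih, mul_add]

@[simp] theorem eval_mul (s : V → R) (f g : PolyCode V) :
    eval s (mul f g) = eval s f * eval s g := by
  induction f with
  | nil => simp [mul]
  | cons m f ih =>
    rw [mul, List.flatMap_cons, eval_append, eval_map_append, ← mul, ih, eval_cons, add_mul]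

@[simp] theorem eval_replicate_nil (s : V → R) (n : ℕ) :
    eval s (List.replicate n ([] : List V)) = n := by
  induction n with
  | zero => simp
  | succ n ih => simp [List.replicate_succ, ih, add_comm]

theorem map_eval {R' : Type*} [CommSemiring R'] (φ : R →+* R') (s : V → R) (f : PolyCode V) :
    φ (eval s f) = eval (fun v => φ (s v)) f := by
  induction f with
  | nil => simp
  | cons m f ih => simp [ih, map_list_prod, Function.comp_def]

/-- Coefficients are natural numbers, so bounds on nonnegative variables turn directly into bounds
on values. For this reason integer polynomials are handled as differences and the generators are
kept nonnegative. -/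
theorem eval_mono {s s' : V → ℝ} (h0 : ∀ v, 0 ≤ s v) (h : ∀ v, s v ≤ s' v) (f : PolyCode V) :
    eval s f ≤ eval s' f := by
  have hm : ∀ m : List V, 0 ≤ (m.map s).prod ∧ (m.map s).prod ≤ (m.map s').prod := by
    intro m
    induction m with
    | nil => simp
    | cons v m ih =>
      simp only [List.map_cons, List.prod_cons]
      exact ⟨mul_nonneg (h0 v) ih.1, mul_le_mul (h v) ih.2 ih.1 ((h0 v).trans (h v))⟩
  induction f with
  | nil => simp
  | cons m f ih => simpa using add_le_add (hm m).2 ih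

theorem tendsto_eval {s : V → ℝ} {u : ℕ → V → ℝ}
    (h : ∀ v, Filter.Tendsto (fun k => u k v) Filter.atTop (nhds (s v))) (f : PolyCode V) :
    Filter.Tendsto (fun k => eval (u k) f) Filter.atTop (nhds (eval s f)) := by
  have hm : ∀ m : List V,
      Filter.Tendsto (fun k => (m.map (u k)).prod) Filter.atTop (nhds (m.map s).prod) := by
    intro m
    induction m with
    | nil => simp
    | cons v m ih => simpa using (h v).mul ih
  induction f with
  | nil => simp
  | cons m f ih => simpa using (hm m).add ih

/-- The value of a coded polynomial at a point with rational coordinates `u v / q`, multiplied by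
`q ^ D`. -/
def scaledEval (u : V → ℕ) (q D : ℕ) (f : PolyCode V) : ℕ :=
  (f.map fun m => (m.map u).prod * q ^ (D - m.length)).sum

theorem scaledEval_eq (u : V → ℕ) {q D : ℕ} (hq : q ≠ 0) (f : PolyCode V)
    (hD : ∀ m ∈ f, m.length ≤ D) :
    (scaledEval u q D f : ℝ) = q ^ D * eval (fun v => (u v : ℝ) / q) f := by
  have hq' : (q : ℝ) ≠ 0 := Nat.cast_ne_zero.mpr hq
  have hm : ∀ m : List V, (m.map fun v => (u v : ℝ) / q).prod * (q : ℝ) ^ m.length =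
      ((m.map u).prod : ℕ) := by
    intro m
    induction m with
    | nil => simp
    | cons v m ih =>
      simp only [List.map_cons, List.prod_cons, List.length_cons, Nat.cast_mul, ← ih]
      field_simp
      ring
  induction f with
  | nil => simp [scaledEval]
  | cons m f ih =>
    have h1 := ih fun m' hm' => hD m' (List.mem_cons_of_mem _ hm')
    have h2 : (q : ℝ) ^ D = q ^ m.length * q ^ (D - m.length) := by
      rw [← pow_add, Nat.add_sub_cancel' (hD m List.mem_cons_self)]
    simp only [scaledEval, List.map_cons, List.sum_cons, eval_cons, mul_add] at h1 ⊢
    rw [Nat.cast_add, Nat.cast_mul, Nat.cast_pow, h1, h2, ← hm]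
    ring

section

variable [Primcodable V]

theorem computable_mul : Computable₂ (mul : PolyCode V → PolyCode V → PolyCode V) := by
  refine Primrec.to_comp (f := fun p : PolyCode V × PolyCode V => mul p.1 p.2) ?_
  refine Primrec.list_flatMap Primrec.fst ?_
  exact Primrec.list_map (Primrec.snd.comp Primrec.fst)
    (Primrec.list_append.comp (Primrec.snd.comp Primrec.fst) Primrec.snd)

theorem computable_listSum : Computable (List.sum : List ℕ → ℕ) :=
  (Computable.list_foldr .id (.const 0) (h := fun _ p => p.1 + p.2)
    (Primrec.nat_add.to_comp.comp (Computable.fst.comp .snd) (Computable.snd.comp .snd))).of_eq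
    fun l => by induction l <;> simp_all

theorem computable_listProd : Computable (List.prod : List ℕ → ℕ) :=
  (Computable.list_foldr .id (.const 1) (h := fun _ p => p.1 * p.2)
    (Primrec.nat_mul.to_comp.comp (Computable.fst.comp .snd) (Computable.snd.comp .snd))).of_eq
    fun l => by induction l <;> simp_all

theorem computable_pow : Computable₂ (fun a b : ℕ => a ^ b) := by
  refine (Computable.nat_rec (f := fun p : ℕ × ℕ => p.2) (g := fun _ => 1)
    (h := fun p x => x.2 * p.1) .snd (.const 1) ?_).of_eq fun p => ?_
  · exact Primrec.nat_mul.to_comp.comp (Computable.snd.comp .snd) (Computable.fst.comp .fst)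
  · induction p.2 with
    | zero => simp
    | succ n ih => simp [pow_succ, ih]

theorem computable_scaledEval {α : Type*} [Primcodable α] {u : α → V → ℕ} {q D : α → ℕ}
    {f : α → PolyCode V} (hu : Computable₂ u) (hq : Computable q) (hD : Computable D)
    (hf : Computable f) : Computable fun a => scaledEval (u a) (q a) (D a) (f a) := by
  refine computable_listSum.comp (Computable.list_map hf ?_)
  refine Primrec.nat_mul.to_comp.comp (computable_listProd.comp (Computable.list_map .snd ?_)) ?_
  · exact hu.comp (Computable.fst.comp .fst) .snd
  · exact computable_pow.comp (hq.comp .fst) (Primrec.nat_sub.to_comp.comp (hD.comp .fst)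
      (Computable.list_length.comp .snd))

end

end PolyCode

/-! ### Uniformly computable families of nonnegative reals -/

/-- The natural number `l v k` is a good approximation of `2 ^ k * s v`. -/
structure IsApprox {V : Type*} [Primcodable V] (s : V → ℝ) (l : V → ℕ → ℕ) : Prop where
  computable : Computable₂ l
  le : ∀ v k, (l v k : ℝ) / 2 ^ k ≤ s v
  ge : ∀ v k, s v ≤ ((l v k + 2 : ℕ) : ℝ) / 2 ^ k

namespace IsApprox

open PolyCode Filter Topology

variable {V : Type*} [Primcodable V] {s : V → ℝ} {l : V → ℕ → ℕ}

/-- A bound for the degrees of two polynomials. -/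
def degBound (f g : PolyCode V) : ℕ := (f.flatten ++ g.flatten).length

theorem length_le_degBound {f g : PolyCode V} {m : List V} (h : m ∈ f ∨ m ∈ g) :
    m.length ≤ degBound f g := by
  rw [degBound, List.length_append]
  rcases h with h | h
  · exact ((List.sublist_flatten_of_mem h).length_le).trans (Nat.le_add_right _ _)
  · exact ((List.sublist_flatten_of_mem h).length_le).trans (Nat.le_add_left _ _)

/-- The approximations with precision `k` show that the value of `f` is less than that of `g`. -/
def LtAt (l : V → ℕ → ℕ) (f g : PolyCode V) (k : ℕ) : Prop :=
  scaledEval (fun v => l v k + 2) (2 ^ k) (degBound f g) f <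
    scaledEval (fun v => l v k) (2 ^ k) (degBound f g) g

theorem tendsto_lower (h : IsApprox s l) (v : V) :
    Tendsto (fun k => (l v k : ℝ) / ((2 ^ k : ℕ) : ℝ)) atTop (𝓝 (s v)) ∧
      Tendsto (fun k => ((l v k + 2 : ℕ) : ℝ) / ((2 ^ k : ℕ) : ℝ)) atTop (𝓝 (s v)) := by
  have h2 : Tendsto (fun k : ℕ => 2 * (1 / 2 : ℝ) ^ k) atTop (𝓝 0) := by
    simpa using (tendsto_pow_atTop_nhds_zero_of_lt_one (by norm_num : (0 : ℝ) ≤ 1 / 2)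
      (by norm_num)).const_mul 2
  have e : ∀ k : ℕ, ((l v k + 2 : ℕ) : ℝ) / ((2 ^ k : ℕ) : ℝ) =
      (l v k : ℝ) / ((2 ^ k : ℕ) : ℝ) + 2 * (1 / 2 : ℝ) ^ k := by
    intro k
    push_cast
    rw [one_div, inv_pow]
    ring
  constructor
  · refine tendsto_of_tendsto_of_tendsto_of_le_of_le (g := fun k => s v - 2 * (1 / 2 : ℝ) ^ k)
      (h := fun _ => s v) (by simpa using tendsto_const_nhds.sub h2) tendsto_const_nhds
      (fun k => ?_) fun k => ?_
    · have := h.ge v k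
      have e' := e k
      push_cast at this e' ⊢
      linarith
    · have := h.le v k
      push_cast
      exact this
  · refine tendsto_of_tendsto_of_tendsto_of_le_of_le (g := fun _ => s v)
      (h := fun k => s v + 2 * (1 / 2 : ℝ) ^ k) tendsto_const_nhds
      (by simpa using tendsto_const_nhds.add h2) (fun k => ?_) fun k => ?_
    · have := h.ge v k
      push_cast at this ⊢
      exact this
    · have := h.le v k
      have e' := e k
      push_cast at this e' ⊢
      linarith

/-- Soundness is monotonicity: the test compares an upper bound for `f` with a lower bound for `g`.
Completeness is continuity, since both bounds converge to the true values. -/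
theorem exists_ltAt_iff (h : IsApprox s l) (f g : PolyCode V) :
    (∃ k, LtAt l f g k) ↔ eval s f < eval s g := by
  have hk : ∀ k, LtAt l f g k ↔
      eval (fun v => ((l v k + 2 : ℕ) : ℝ) / ((2 ^ k : ℕ) : ℝ)) f <
        eval (fun v => (l v k : ℝ) / ((2 ^ k : ℕ) : ℝ)) g := by
    intro k
    have hq : (2 ^ k : ℕ) ≠ 0 := by positivity
    rw [LtAt, ← Nat.cast_lt (α := ℝ), scaledEval_eq _ hq f fun m hm => length_le_degBound (.inl hm),
      scaledEval_eq _ hq g fun m hm => length_le_degBound (.inr hm)]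
    exact mul_lt_mul_iff_right₀ (by positivity)
  constructor
  · rintro ⟨k, hlt⟩
    rw [hk] at hlt
    have h0 : ∀ v, 0 ≤ s v := fun v => le_trans (by positivity) (h.le v 0)
    refine lt_of_le_of_lt (eval_mono h0 (fun v => ?_) f) (lt_of_lt_of_le hlt
      (eval_mono (fun v => by positivity) (fun v => ?_) g))
    · have := h.ge v k
      push_cast at this ⊢
      exact this
    · have := h.le v k
      push_cast at this ⊢
      exact this
  · intro hlt
    have h1 := tendsto_eval (fun v => (h.tendsto_lower v).2) f
    have h2 := tendsto_eval (fun v => (h.tendsto_lower v).1) g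
    obtain ⟨k, hk'⟩ := (h1.eventually_lt h2 hlt).exists
    exact ⟨k, (hk k).mpr hk'⟩

theorem computable_ltAt (h : IsApprox s l) :
    ComputablePred fun p : (PolyCode V × PolyCode V) × ℕ => LtAt l p.1.1 p.1.2 p.2 := by
  have hD : Computable fun p : (PolyCode V × PolyCode V) × ℕ => degBound p.1.1 p.1.2 :=
    Computable.list_length.comp (Computable.list_append.comp
      (Primrec.list_flatten.to_comp.comp (Computable.fst.comp .fst))
      (Primrec.list_flatten.to_comp.comp (Computable.snd.comp .fst)))
  have hq : Computable fun p : (PolyCode V × PolyCode V) × ℕ => 2 ^ p.2 :=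
    computable_pow.comp (.const 2) .snd
  have hl : Computable₂ fun (p : (PolyCode V × PolyCode V) × ℕ) v => l v p.2 :=
    h.computable.comp .snd (Computable.snd.comp .fst)
  have hl' : Computable₂ fun (p : (PolyCode V × PolyCode V) × ℕ) v => l v p.2 + 2 :=
    Computable.comp (f := fun n => n + 2) (Primrec.nat_add.to_comp.comp .id (.const 2)) hl
  refine ComputablePred.comp (p := fun x : ℕ × ℕ => x.1 < x.2)
    (PrimrecPred.computablePred Primrec.nat_lt) (.pair
      (computable_scaledEval hl' hq hD
        (Computable.fst.comp .fst))
      (computable_scaledEval hl hq hD (Computable.snd.comp .fst)))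

/-- If equality is decidable then so is the order. -/
theorem computable_lt (h : IsApprox s l)
    (heq : ComputablePred fun p : PolyCode V × PolyCode V => eval s p.1 = eval s p.2) :
    ComputablePred fun p : PolyCode V × PolyCode V => eval s p.1 < eval s p.2 := by
  refine ComputablePred.of_re_re
    (ComputablePred.exists_re h.computable_ltAt |>.of_eq fun p => h.exists_ltAt_iff _ _)
    (q := fun p => ∃ k, eval s p.1 = eval s p.2 ∨ LtAt l p.2 p.1 k)
    (ComputablePred.exists_re ?_) fun p => ?_
  · exact (heq.comp .fst).or (h.computable_ltAt.comp
      (.pair (.pair (Computable.snd.comp .fst) (Computable.fst.comp .fst)) .snd))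
  · rw [exists_or, h.exists_ltAt_iff, exists_const, not_lt, le_iff_lt_or_eq, or_comm, eq_comm]

/-- If equality is recursively enumerable then it is decidable. -/
theorem computable_eq (h : IsApprox s l)
    (heq : REPred fun p : PolyCode V × PolyCode V => eval s p.1 = eval s p.2) :
    ComputablePred fun p : PolyCode V × PolyCode V => eval s p.1 = eval s p.2 := by
  refine ComputablePred.of_re_re heq (q := fun p => ∃ k, LtAt l p.1 p.2 k ∨ LtAt l p.2 p.1 k)
    (ComputablePred.exists_re ?_) fun p => ?_
  · exact h.computable_ltAt.or (h.computable_ltAt.comp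
      (.pair (.pair (Computable.snd.comp .fst) (Computable.fst.comp .fst)) .snd))
  · rw [exists_or, h.exists_ltAt_iff, h.exists_ltAt_iff, ← ne_eq, ne_iff_lt_or_gt]

end IsApprox

/-! ### Formal equality of coded polynomials -/

namespace PolyCode

variable {V : Type*}

/-- The polynomial with integer coefficients that is coded by `f`. -/
noncomputable def toMv (f : PolyCode V) : MvPolynomial V ℤ := eval MvPolynomial.X f

theorem aeval_toMv {R : Type*} [CommRing R] (s : V → R) (f : PolyCode V) :
    MvPolynomial.aeval s (toMv f) = eval s f := by
  have := map_eval (MvPolynomial.aeval (R := ℤ) s).toRingHom MvPolynomial.X f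
  simpa [toMv] using this

theorem coeff_toMv [DecidableEq V] (f : PolyCode V) (d : V →₀ ℕ) :
    (toMv f).coeff d = f.countP fun m : List V => Multiset.toFinsupp (m : Multiset V) = d := by
  have hm : ∀ m : List V, (m.map (MvPolynomial.X (R := ℤ))).prod =
      MvPolynomial.monomial (Multiset.toFinsupp (m : Multiset V)) 1 := by
    intro m
    induction m with
    | nil => simp
    | cons v m ih =>
      rw [List.map_cons, List.prod_cons, ih, ← Multiset.cons_coe, ← Multiset.singleton_add,
        map_add, Multiset.toFinsupp_singleton, MvPolynomial.X, MvPolynomial.monomial_mul, one_mul]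
  induction f with
  | nil => simp [toMv]
  | cons m f ih =>
    rw [toMv, eval_cons, ← toMv, MvPolynomial.coeff_add, ih, hm, MvPolynomial.coeff_monomial,
      List.countP_cons]
    by_cases h : Multiset.toFinsupp (m : Multiset V) = d <;> simp [h, add_comm]

/-- The coefficient at an exponent counts the listed monomials with that exponent, up to reordering
of factors. Only exponents that occur matter, so formal equality is a finite check. -/
theorem toMv_eq_iff [DecidableEq V] (f g : PolyCode V) :
    toMv f = toMv g ↔ ∀ m ∈ f ++ g, f.countP (fun m' => m'.Perm m) = g.countP fun m' => m'.Perm m := by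
  have hp : ∀ m m' : List V, m'.Perm m ↔
      Multiset.toFinsupp (m' : Multiset V) = Multiset.toFinsupp (m : Multiset V) := by
    intro m m'
    rw [EmbeddingLike.apply_eq_iff_eq, Multiset.coe_eq_coe]
  constructor
  · intro h m _
    have := congrArg (fun p => p.coeff (Multiset.toFinsupp (m : Multiset V))) h
    simp only [coeff_toMv, Nat.cast_inj] at this
    simpa only [hp] using this
  · intro h
    ext d
    rw [coeff_toMv, coeff_toMv, Nat.cast_inj]
    by_cases hd : ∃ m ∈ f ++ g, Multiset.toFinsupp (m : Multiset V) = d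
    · obtain ⟨m, hm, rfl⟩ := hd
      simpa only [hp] using h m hm
    · push Not at hd
      rw [List.countP_eq_zero.mpr, List.countP_eq_zero.mpr]
      · exact fun m hm => by simpa using hd m (List.mem_append_right _ hm)
      · exact fun m hm => by simpa using hd m (List.mem_append_left _ hm)

theorem computable_countP {α β : Type*} [Primcodable α] [Primcodable β] {f : α → List β}
    {p : α → β → Prop} [∀ a, DecidablePred (p a)] (hf : Computable f)
    (hp : ComputablePred fun x : α × β => p x.1 x.2) :
    Computable fun a => (f a).countP fun b => p a b := by
  classical
  refine (Computable.list_foldr hf (.const 0)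
    (h := fun a x => if p a x.1 then x.2 + 1 else x.2) ?_).of_eq fun a => ?_
  · exact ComputablePred.ite' (hp.comp (.pair .fst (Computable.fst.comp .snd)))
      (Computable.succ.comp (Computable.snd.comp .snd)) (Computable.snd.comp .snd)
  · induction f a with
    | nil => simp
    | cons b l ih =>
      rw [List.foldr_cons, ih, List.countP_cons]
      by_cases h : p a b <;> simp [h]

theorem computable_perm [Primcodable V] [DecidableEq V] :
    ComputablePred fun p : List V × List V => p.1.Perm p.2 := by
  have hc : ∀ {f : (List V × List V) × V → List V}, Computable f →
      Computable fun x : (List V × List V) × V => (f x).countP fun b => b = x.2 := by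
    intro f hf
    exact computable_countP (p := fun (x : (List V × List V) × V) b => b = x.2) hf
      (ComputablePred.eq .snd (Computable.snd.comp .fst))
  refine (ComputablePred.forall_mem (f := fun p : List V × List V => p.1 ++ p.2)
    (p := fun p a => p.1.countP (fun b => b = a) = p.2.countP fun b => b = a)
    (Computable.list_append.comp .fst .snd)
    (ComputablePred.eq (hc (Computable.fst.comp .fst)) (hc (Computable.snd.comp .fst)))).of_eq
    fun p => ?_
  rw [List.perm_iff_count]
  simp only [List.count, beq_eq_decide]
  refine ⟨fun h a => ?_, fun h a _ => h a⟩
  by_cases ha : a ∈ p.1 ++ p.2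
  · exact h a ha
  · rw [List.mem_append, not_or] at ha
    rw [List.countP_eq_zero.mpr, List.countP_eq_zero.mpr]
    · rintro b hb h
      exact ha.2 (by rwa [← of_decide_eq_true h])
    · rintro b hb h
      exact ha.1 (by rwa [← of_decide_eq_true h])

theorem computable_toMv_eq [Primcodable V] :
    ComputablePred fun p : PolyCode V × PolyCode V => toMv p.1 = toMv p.2 := by
  classical
  have hc : ∀ {f : (PolyCode V × PolyCode V) × List V → PolyCode V}, Computable f →
      Computable fun x : (PolyCode V × PolyCode V) × List V =>
        (f x).countP fun b => b.Perm x.2 := by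
    intro f hf
    exact computable_countP (p := fun (x : (PolyCode V × PolyCode V) × List V) b => b.Perm x.2) hf
      (computable_perm.comp (.pair .snd (Computable.snd.comp .fst)))
  refine (ComputablePred.forall_mem (f := fun p : PolyCode V × PolyCode V => p.1 ++ p.2)
    (p := fun p m => p.1.countP (fun b => b.Perm m) = p.2.countP fun b => b.Perm m)
    (Computable.list_append.comp .fst .snd)
    (ComputablePred.eq (hc (Computable.fst.comp .fst)) (hc (Computable.snd.comp .fst)))).of_eq
    fun p => (toMv_eq_iff p.1 p.2).symm

end PolyCode

/-! ### Differences of coded polynomials -/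

/-- A polynomial with integer coefficients is coded as a difference. -/
abbrev DiffCode (V : Type*) := PolyCode V × PolyCode V

namespace DiffCode

open PolyCode

variable {V : Type*} {R : Type*} [CommRing R]

/-- The value of a coded difference of polynomials at a point. -/
def val (s : V → R) (c : DiffCode V) : R := eval s c.1 - eval s c.2

/-- The code of a natural number. -/
def ofNat (n : ℕ) : DiffCode V := (List.replicate n [], [])

/-- The code of a variable. -/
def var (v : V) : DiffCode V := ([ [v] ], [])

/-- The sum of coded differences. -/
def add (c d : DiffCode V) : DiffCode V := (c.1 ++ d.1, c.2 ++ d.2)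

/-- The product of coded differences. -/
def mul (c d : DiffCode V) : DiffCode V :=
  (PolyCode.mul c.1 d.1 ++ PolyCode.mul c.2 d.2, PolyCode.mul c.1 d.2 ++ PolyCode.mul c.2 d.1)

/-- The powers of a coded difference. -/
def pow (c : DiffCode V) (n : ℕ) : DiffCode V := Nat.rec (ofNat 1) (fun _ d => mul d c) n

@[simp] theorem val_ofNat (s : V → R) (n : ℕ) : val s (ofNat n) = n := by
  simp [val, ofNat]

@[simp] theorem val_var (s : V → R) (v : V) : val s (var v) = s v := by simp [val, var]

@[simp] theorem val_add (s : V → R) (c d : DiffCode V) : val s (add c d) = val s c + val s d := by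
  simp only [val, add, eval_append]; ring

@[simp] theorem val_mul (s : V → R) (c d : DiffCode V) : val s (mul c d) = val s c * val s d := by
  simp only [val, mul, eval_append, eval_mul]; ring

@[simp] theorem val_swap (s : V → R) (c : DiffCode V) : val s c.swap = - val s c := by
  simp [val]

@[simp] theorem val_pow (s : V → R) (c : DiffCode V) (n : ℕ) : val s (pow c n) = val s c ^ n := by
  induction n with
  | zero => simp [pow]
  | succ n ih =>
    have : pow c (n + 1) = mul (pow c n) c := rfl
    rw [this, val_mul, ih, pow_succ]

/-- The polynomial that is coded by `c`. -/
noncomputable def toMv (c : DiffCode V) : MvPolynomial V ℤ := val MvPolynomial.X c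

theorem aeval_toMv (s : V → R) (c : DiffCode V) : MvPolynomial.aeval s (toMv c) = val s c := by
  rw [toMv, val, map_sub]
  exact congrArg₂ _ (PolyCode.aeval_toMv s c.1) (PolyCode.aeval_toMv s c.2)

theorem toMv_surjective : Function.Surjective (toMv (V := V)) := by
  intro p
  induction p using MvPolynomial.induction_on with
  | C a =>
    obtain ⟨n, rfl | rfl⟩ := a.eq_nat_or_neg
    · exact ⟨ofNat n, by simp [toMv]⟩
    · exact ⟨(ofNat n).swap, by simp [toMv]⟩
  | add p q hp hq =>
    obtain ⟨c, rfl⟩ := hp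
    obtain ⟨d, rfl⟩ := hq
    exact ⟨add c d, by simp [toMv]⟩
  | mul_X p v hp =>
    obtain ⟨c, rfl⟩ := hp
    exact ⟨mul c (var v), by simp [toMv]⟩

theorem toMv_eq_iff (c d : DiffCode V) :
    toMv c = toMv d ↔ PolyCode.toMv (c.1 ++ d.2) = PolyCode.toMv (d.1 ++ c.2) := by
  rw [PolyCode.toMv, PolyCode.toMv, eval_append, eval_append, toMv, toMv, val, val,
    sub_eq_sub_iff_add_eq_add]

section

variable [Primcodable V]

theorem computable_add : Computable₂ (add : DiffCode V → DiffCode V → DiffCode V) :=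
  .pair (Computable.list_append.comp (Computable.fst.comp .fst) (Computable.fst.comp .snd))
    (Computable.list_append.comp (Computable.snd.comp .fst) (Computable.snd.comp .snd))

theorem computable_mul : Computable₂ (mul : DiffCode V → DiffCode V → DiffCode V) := by
  have h : ∀ {f g : DiffCode V × DiffCode V → PolyCode V}, Computable f → Computable g →
      Computable fun x => PolyCode.mul (f x) (g x) :=
    fun hf hg => PolyCode.computable_mul.comp hf hg
  exact .pair
    (Computable.list_append.comp (h (Computable.fst.comp .fst) (Computable.fst.comp .snd))
      (h (Computable.snd.comp .fst) (Computable.snd.comp .snd)))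
    (Computable.list_append.comp (h (Computable.fst.comp .fst) (Computable.snd.comp .snd))
      (h (Computable.snd.comp .fst) (Computable.fst.comp .snd)))

theorem computable_pow : Computable₂ (pow : DiffCode V → ℕ → DiffCode V) :=
  Computable.nat_rec (f := fun p : DiffCode V × ℕ => p.2) (g := fun _ => ofNat 1)
    (h := fun p x => mul x.2 p.1) .snd (.const _)
    (computable_mul.comp (Computable.snd.comp .snd) (Computable.fst.comp .fst))

theorem computable_toMv_eq : ComputablePred fun p : DiffCode V × DiffCode V => toMv p.1 = toMv p.2 :=
  (PolyCode.computable_toMv_eq.comp (f := fun p : DiffCode V × DiffCode V =>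
    (p.1.1 ++ p.2.2, p.2.1 ++ p.1.2)) (.pair
    (Computable.list_append.comp (Computable.fst.comp .fst) (Computable.snd.comp .snd))
    (Computable.list_append.comp (Computable.fst.comp .snd) (Computable.snd.comp .fst)))).of_eq
    fun p => (toMv_eq_iff p.1 p.2).symm

end

/-- The combination of the relations `P v` with coded coefficients. -/
def combination (P : V → DiffCode V) (l : List (DiffCode V × V)) : DiffCode V :=
  l.foldr (fun x acc => add (mul x.1 (P x.2)) acc) (ofNat 0)

/-- This makes membership in the ideal of the known relations searchable by enumerating lists of
coefficients. -/
theorem exists_combination (P : V → DiffCode V) {p : MvPolynomial V ℤ}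
    (hp : p ∈ Ideal.span (Set.range fun v => toMv (P v))) : ∃ l, toMv (combination P l) = p := by
  have hadd : ∀ l l', toMv (combination P (l ++ l')) =
      toMv (combination P l) + toMv (combination P l') := by
    intro l l'
    induction l with
    | nil => simp [combination, toMv]
    | cons x l ih =>
      simp only [combination, List.cons_append, List.foldr_cons, toMv, val_add] at ih ⊢
      rw [ih, add_assoc]
  have hmul : ∀ l c, toMv (combination P (l.map fun x => (mul c x.1, x.2))) =
      toMv c * toMv (combination P l) := by
    intro l c
    induction l with
    | nil => simp [combination, toMv]
    | cons x l ih =>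
      simp only [combination, List.map_cons, List.foldr_cons, toMv, val_add, val_mul] at ih ⊢
      rw [ih]
      ring
  induction hp using Submodule.span_induction with
  | mem x hx =>
    obtain ⟨v, rfl⟩ := hx
    exact ⟨[(ofNat 1, v)], by simp [combination, toMv]⟩
  | zero => exact ⟨[], by simp [combination, toMv]⟩
  | add x y _ _ hx hy =>
    obtain ⟨l, rfl⟩ := hx
    obtain ⟨l', rfl⟩ := hy
    exact ⟨l ++ l', hadd l l'⟩
  | smul a x _ hx =>
    obtain ⟨l, rfl⟩ := hx
    obtain ⟨c, rfl⟩ := toMv_surjective a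
    exact ⟨_, hmul l c⟩

theorem val_combination (P : V → DiffCode V) (s : V → R) (hP : ∀ v, val s (P v) = 0)
    (l : List (DiffCode V × V)) : val s (combination P l) = 0 := by
  induction l with
  | nil => simp [combination]
  | cons x l ih => simpa [combination, hP] using ih

theorem computable_combination [Primcodable V] {P : V → DiffCode V} (hP : Computable P) :
    Computable (combination P) :=
  Computable.list_foldr (f := fun l : List (DiffCode V × V) => l) (g := fun _ => ofNat 0)
    (h := fun _ x => add (mul x.1.1 (P x.1.2)) x.2) .id (.const _)
    (computable_add.comp (computable_mul.comp (Computable.fst.comp (Computable.fst.comp .snd))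
      (hP.comp (Computable.snd.comp (Computable.fst.comp .snd)))) (Computable.snd.comp .snd))

/-- A certificate for the vanishing of `c` at the point `s`: a polynomial `x.1` that does not
vanish there, as approximations with precision `x.2.2.2` show, and an equation
`x.1 * c ^ m = ∑ hᵢ * P vᵢ`. -/
def IsCertificate (P : V → DiffCode V) (l : V → ℕ → ℕ) (c : DiffCode V)
    (x : DiffCode V × ℕ × List (DiffCode V × V) × ℕ) : Prop :=
  (IsApprox.LtAt l x.1.1 x.1.2 x.2.2.2 ∨ IsApprox.LtAt l x.1.2 x.1.1 x.2.2.2) ∧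
    toMv (mul x.1 (pow c x.2.1)) = toMv (combination P x.2.2.1)

variable [Primcodable V] {s : V → ℝ} {l : V → ℕ → ℕ} {P : V → DiffCode V}

theorem computable_isCertificate_aux {α : Type*} [Primcodable α] (h : IsApprox s l)
    (hP : Computable P) {c g : α → DiffCode V} {m n : α → ℕ} {k : α → List (DiffCode V × V)}
    (hc : Computable c) (hg : Computable g) (hm : Computable m) (hn : Computable n)
    (hk : Computable k) : ComputablePred fun a => IsCertificate P l (c a) (g a, m a, k a, n a) := by
  have a1 : ComputablePred fun a => IsApprox.LtAt l (g a).1 (g a).2 (n a) :=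
    h.computable_ltAt.comp (f := fun a => (g a, n a)) (hg.pair hn)
  have a2 : ComputablePred fun a => IsApprox.LtAt l (g a).2 (g a).1 (n a) :=
    h.computable_ltAt.comp (f := fun a => (((g a).2, (g a).1), n a))
      (((Computable.snd.comp hg).pair (Computable.fst.comp hg)).pair hn)
  have b1 : Computable fun a => mul (g a) (pow (c a) (m a)) :=
    computable_mul.comp hg (computable_pow.comp hc hm)
  have b2 : Computable fun a => combination P (k a) := (computable_combination hP).comp hk
  have a3 : ComputablePred fun a => toMv (mul (g a) (pow (c a) (m a))) = toMv (combination P (k a)) :=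
    computable_toMv_eq.comp (f := fun a => (mul (g a) (pow (c a) (m a)), combination P (k a)))
      (b1.pair b2)
  exact (a1.or a2).and a3

theorem computable_isCertificate (h : IsApprox s l) (hP : Computable P) :
    ComputablePred fun p : DiffCode V × (DiffCode V × ℕ × List (DiffCode V × V) × ℕ) =>
      IsCertificate P l p.1 p.2 := by
  have h2 : Computable fun p : DiffCode V × (DiffCode V × ℕ × List (DiffCode V × V) × ℕ) => p.2 :=
    Computable.snd
  have h3 := Computable.snd.comp h2
  have h4 := Computable.snd.comp h3
  exact computable_isCertificate_aux h hP Computable.fst (Computable.fst.comp h2)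
    (Computable.fst.comp h3) (Computable.snd.comp h4) (Computable.fst.comp h4)

/-- Soundness: evaluating the equation at `s` gives `g(s) c(s)^m = 0` with `g(s) ≠ 0`. Completeness
is the hypothesis `hmin`, with `g` separated from zero at a sufficient precision. -/
theorem exists_isCertificate_iff (h : IsApprox s l) (hP : ∀ v, val s (P v) = 0)
    (hmin : ∀ f : MvPolynomial V ℤ, MvPolynomial.aeval s f = 0 → ∃ (g : MvPolynomial V ℤ) (m : ℕ),
      MvPolynomial.aeval s g ≠ 0 ∧ g * f ^ m ∈ Ideal.span (Set.range fun v => toMv (P v)))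
    (c : DiffCode V) : (∃ x, IsCertificate P l c x) ↔ val s c = 0 := by
  constructor
  · rintro ⟨⟨g, m, k, n⟩, h1, h2⟩
    have hg : val s g ≠ 0 := by
      rw [val, sub_ne_zero]
      rcases h1 with h1 | h1
      · exact ((h.exists_ltAt_iff _ _).mp ⟨n, h1⟩).ne
      · exact ((h.exists_ltAt_iff _ _).mp ⟨n, h1⟩).ne'
    have h3 := congrArg (MvPolynomial.aeval s) h2
    rw [aeval_toMv, aeval_toMv, val_mul, val_pow, val_combination P s hP] at h3
    exact eq_zero_of_pow_eq_zero ((mul_eq_zero.mp h3).resolve_left hg)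
  · intro hc
    obtain ⟨g, m, hg, hmem⟩ := hmin (toMv c) (by rw [aeval_toMv, hc])
    obtain ⟨g, rfl⟩ := toMv_surjective g
    obtain ⟨k, hk⟩ := exists_combination P hmem
    have hn : ∃ n, IsApprox.LtAt l g.1 g.2 n ∨ IsApprox.LtAt l g.2 g.1 n := by
      rw [exists_or, h.exists_ltAt_iff, h.exists_ltAt_iff, ← ne_iff_lt_or_gt, ← sub_ne_zero]
      rwa [aeval_toMv] at hg
    obtain ⟨n, hn⟩ := hn
    refine ⟨(g, m, k, n), hn, ?_⟩
    rw [hk]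
    simp [toMv]

/-- Equality and order are decidable in the ring generated by a uniformly computable family of
nonnegative reals, if enough algebraic relations between these reals can be enumerated. -/
theorem computable_eq_and_lt (h : IsApprox s l) (hPc : Computable P) (hP : ∀ v, val s (P v) = 0)
    (hmin : ∀ f : MvPolynomial V ℤ, MvPolynomial.aeval s f = 0 → ∃ (g : MvPolynomial V ℤ) (m : ℕ),
      MvPolynomial.aeval s g ≠ 0 ∧ g * f ^ m ∈ Ideal.span (Set.range fun v => toMv (P v))) :
    (ComputablePred fun p : DiffCode V × DiffCode V => val s p.1 = val s p.2) ∧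
      ComputablePred fun p : DiffCode V × DiffCode V => val s p.1 < val s p.2 := by
  -- The pair `p` is itself the code of a difference, which vanishes exactly when the two values
  -- agree.
  have hre : REPred fun p : PolyCode V × PolyCode V => eval s p.1 = eval s p.2 :=
    (ComputablePred.exists_re (computable_isCertificate h hPc)).of_eq fun p =>
      (exists_isCertificate_iff h hP hmin p).trans sub_eq_zero
  have hf : Computable fun p : DiffCode V × DiffCode V => (p.1.1 ++ p.2.2, p.2.1 ++ p.1.2) := .pair
    (Computable.list_append.comp (Computable.fst.comp .fst) (Computable.snd.comp .snd))
    (Computable.list_append.comp (Computable.fst.comp .snd) (Computable.snd.comp .fst))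
  have heq := h.computable_eq hre
  refine ⟨(heq.comp hf).of_eq fun p => ?_, ((h.computable_lt heq).comp hf).of_eq fun p => ?_⟩
  · rw [eval_append, eval_append, val, val, sub_eq_sub_iff_add_eq_add]
  · rw [eval_append, eval_append, val, val]
    constructor <;> intro h <;> linarith

end DiffCode

/-! ### Minimality of the ideal of algebraic relations -/

/-- Otherwise the multiplicative set of all `g * f ^ m` with `g(s) ≠ 0` misses `I`, so some prime `q
⊇ I` misses it too. Then `q` consists of relations of `s` but omits `f`. Modulo `q` every variable
is algebraic over `ℤ[T]`, hence so is `f`, and the nonzero class of `f` divides a nonzero `r` from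
`ℤ[T]`. Evaluation at `s` gives `r(s) = 0`, against independence. -/
theorem exists_mul_pow_mem_of_algebraic {V T : Type*} {s : V → ℝ} {I : Ideal (MvPolynomial V ℤ)}
    {ι : T → V} (hT : AlgebraicIndependent ℤ (s ∘ ι))
    (halg : ∀ v, ∃ p : Polynomial (MvPolynomial T ℤ), p ≠ 0 ∧
      p.eval₂ (MvPolynomial.rename (R := ℤ) ι).toRingHom (MvPolynomial.X v) ∈ I)
    (f : MvPolynomial V ℤ) (hf : MvPolynomial.aeval s f = 0) :
    ∃ (g : MvPolynomial V ℤ) (m : ℕ), MvPolynomial.aeval s g ≠ 0 ∧ g * f ^ m ∈ I := by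
  by_contra hcon
  push Not at hcon
  let S : Submonoid (MvPolynomial V ℤ) :=
    { carrier := {x | ∃ (g : MvPolynomial V ℤ) (m : ℕ), MvPolynomial.aeval s g ≠ 0 ∧ x = g * f ^ m}
      one_mem' := ⟨1, 0, by simp, by simp⟩
      mul_mem' := by
        rintro _ _ ⟨g, m, hg, rfl⟩ ⟨g', m', hg', rfl⟩
        exact ⟨g * g', m + m', by rw [map_mul]; exact mul_ne_zero hg hg', by ring⟩ }
  have hdisj : Disjoint (I : Set (MvPolynomial V ℤ)) S := by
    rw [Set.disjoint_left]
    rintro _ hx ⟨g, m, hg, rfl⟩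
    exact hcon g m hg hx
  obtain ⟨q, hq, hIq, hqS⟩ := Ideal.exists_le_prime_disjoint I S hdisj
  rw [Set.disjoint_left] at hqS
  have hqs : ∀ x ∈ q, MvPolynomial.aeval s x = 0 := by
    intro x hx
    by_contra h
    exact hqS hx ⟨x, 0, h, by simp⟩
  have hfq : f ∉ q := fun h => hqS h ⟨1, 1, by simp, by simp⟩
  let φ : MvPolynomial T ℤ →+* MvPolynomial V ℤ ⧸ q :=
    (Ideal.Quotient.mk q).comp (MvPolynomial.rename (R := ℤ) ι).toRingHom
  have hzero : ∀ r : MvPolynomial T ℤ, MvPolynomial.aeval s (MvPolynomial.rename ι r) = 0 → r = 0 := by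
    intro r hr
    rw [MvPolynomial.aeval_rename] at hr
    exact (injective_iff_map_eq_zero _).mp hT r hr
  let _ := φ.toAlgebra
  have halgebraic : ∀ x : MvPolynomial V ℤ,
      IsAlgebraic (MvPolynomial T ℤ) (Ideal.Quotient.mk q x) := by
    intro x
    induction x using MvPolynomial.induction_on with
    | C a =>
      have : Ideal.Quotient.mk q (MvPolynomial.C a) =
          algebraMap (MvPolynomial T ℤ) (MvPolynomial V ℤ ⧸ q) (MvPolynomial.C a) := by
        change _ = Ideal.Quotient.mk q (MvPolynomial.rename ι (MvPolynomial.C a))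
        rw [MvPolynomial.rename_C]
      rw [this]
      exact isAlgebraic_algebraMap _
    | add x y hx hy => rw [map_add]; exact hx.add hy
    | mul_X x v hx =>
      rw [map_mul]
      refine hx.mul ?_
      obtain ⟨p, hp0, hp⟩ := halg v
      refine ⟨p, hp0, ?_⟩
      rw [Polynomial.aeval_def]
      have := Polynomial.hom_eval₂ p (MvPolynomial.rename (R := ℤ) ι).toRingHom (Ideal.Quotient.mk q)
        (MvPolynomial.X v)
      exact this.symm.trans (Ideal.Quotient.eq_zero_iff_mem.mpr (hIq hp))
  have hf0 : Ideal.Quotient.mk q f ≠ 0 := fun h => hfq (Ideal.Quotient.eq_zero_iff_mem.mp h)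
  -- In a domain a nonzero algebraic element divides a nonzero element of the base ring: the
  -- constant term of a relation, once powers of the variable are cancelled.
  obtain ⟨r, hr0, y, hy⟩ := (halgebraic f).exists_nonzero_dvd (mem_nonZeroDivisors_of_ne_zero hf0)
  obtain ⟨y, rfl⟩ := Ideal.Quotient.mk_surjective y
  refine hr0 (hzero r ?_)
  have : MvPolynomial.rename ι r - f * y ∈ q := by
    rw [← Ideal.Quotient.eq_zero_iff_mem, map_sub, map_mul, sub_eq_zero]
    exact hy
  have := hqs _ this
  rwa [map_sub, map_mul, hf, zero_mul, sub_zero] at this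

/-! ### Real roots of coded polynomials by bisection -/

/-- A polynomial in one variable whose coefficients are coded polynomials in `d` variables. -/
abbrev UniCode (d : ℕ) := List (ℕ × List (Fin d))

namespace UniCode

variable {d : ℕ} {R : Type*} [CommSemiring R]

/-- The value of the coded polynomial. -/
def eval (t : Fin d → R) (y : R) (P : UniCode d) : R :=
  (P.map fun x => y ^ x.1 * (x.2.map t).prod).sum

@[simp] theorem eval_nil (t : Fin d → R) (y : R) : eval t y ([] : UniCode d) = 0 := rfl

@[simp] theorem eval_cons (t : Fin d → R) (y : R) (x : ℕ × List (Fin d)) (P : UniCode d) :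
    eval t y (x :: P : UniCode d) = y ^ x.1 * (x.2.map t).prod + eval t y P := by simp [eval]

@[simp] theorem eval_append (t : Fin d → R) (y : R) (P Q : UniCode d) :
    eval t y (P ++ Q : UniCode d) = eval t y P + eval t y Q := by simp [eval]

theorem map_eval {R' : Type*} [CommSemiring R'] (φ : R →+* R') (t : Fin d → R) (y : R)
    (P : UniCode d) : φ (eval t y P) = eval (fun v => φ (t v)) (φ y) P := by
  induction P with
  | nil => simp
  | cons m f ih => simp [ih, map_list_prod, Function.comp_def]

theorem continuous_eval (t : Fin d → ℝ) (P : UniCode d) : Continuous fun y => eval t y P := by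
  induction P with
  | nil => simpa using continuous_const
  | cons x P ih =>
    simp only [eval_cons]
    fun_prop

/-- The value at `y / q`, multiplied by `q ^ D`. -/
def scaled (y q D : ℕ) (P : UniCode d) : PolyCode (Fin d) :=
  P.flatMap fun x => List.replicate (y ^ x.1 * q ^ (D - x.1)) x.2

theorem eval_replicate (t : Fin d → R) (n : ℕ) (m : List (Fin d)) :
    PolyCode.eval t (List.replicate n m) = n * (m.map t).prod := by
  induction n with
  | zero => simp
  | succ n ih => rw [List.replicate_succ, PolyCode.eval_cons, ih]; push_cast; ring

theorem eval_scaled (t : Fin d → ℝ) (y : ℕ) {q : ℕ} (hq : q ≠ 0) {D : ℕ} (P : UniCode d)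
    (hD : ∀ x ∈ P, x.1 ≤ D) :
    PolyCode.eval t (scaled y q D P) = q ^ D * eval t ((y : ℝ) / q) P := by
  have hq' : (q : ℝ) ≠ 0 := Nat.cast_ne_zero.mpr hq
  induction P with
  | nil => simp [scaled]
  | cons x P ih =>
    have h1 := ih fun m' hm' => hD m' (List.mem_cons_of_mem _ hm')
    have h2 : (q : ℝ) ^ D = q ^ x.1 * q ^ (D - x.1) := by
      rw [← pow_add, Nat.add_sub_cancel' (hD x List.mem_cons_self)]
    rw [scaled] at h1 ⊢
    rw [List.flatMap_cons, PolyCode.eval_append, h1, eval_replicate, eval_cons, mul_add, h2]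
    push_cast
    rw [div_pow]
    field_simp

/-- A bound for the degrees of two polynomials. -/
def degBound (P Q : UniCode d) : ℕ := ((P ++ Q).map Prod.fst).sum

theorem le_degBound {P Q : UniCode d} {x : ℕ × List (Fin d)} (h : x ∈ P ∨ x ∈ Q) :
    x.1 ≤ degBound P Q :=
  List.single_le_sum (by simp) _ (List.mem_map_of_mem (List.mem_append.mpr h))

theorem computable_scaled {α : Type*} [Primcodable α] {y q D : α → ℕ} {P : α → UniCode d}
    (hy : Computable y) (hq : Computable q) (hD : Computable D) (hP : Computable P) :
    Computable fun a => scaled (y a) (q a) (D a) (P a) := by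
  have hrep : Computable₂ fun (n : ℕ) (m : List (Fin d)) => List.replicate n m := by
    refine (Computable.list_map (f := fun p : ℕ × List (Fin d) => List.range p.1)
      (g := fun p _ => p.2) (Primrec.list_range.to_comp.comp .fst)
      (Computable.snd.comp .fst)).of_eq fun p => ?_
    simp [List.map_const']
  refine Computable.list_flatMap hP ?_
  have hx : Computable fun x : α × (ℕ × List (Fin d)) => x.2.1 := Computable.fst.comp .snd
  have h1 : Computable fun x : α × (ℕ × List (Fin d)) => y x.1 ^ x.2.1 :=
    PolyCode.computable_pow.comp (hy.comp .fst) hx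
  have h2 : Computable fun x : α × (ℕ × List (Fin d)) => q x.1 ^ (D x.1 - x.2.1) :=
    PolyCode.computable_pow.comp (hq.comp .fst) (Primrec.nat_sub.to_comp.comp (hD.comp .fst) hx)
  exact hrep.comp (Primrec.nat_mul.to_comp.comp h1 h2) (Computable.snd.comp .snd)

/-- The coded polynomial as a polynomial. -/
noncomputable def toPoly (P : UniCode d) : Polynomial (MvPolynomial (Fin d) ℤ) :=
  eval (fun i => Polynomial.C (MvPolynomial.X i)) Polynomial.X P

theorem eval₂_toPoly {R : Type*} [CommRing R] (φ : MvPolynomial (Fin d) ℤ →+* R) (y : R)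
    (P : UniCode d) :
    (toPoly P).eval₂ φ y = eval (fun i => φ (MvPolynomial.X i)) y P := by
  have := map_eval (Polynomial.eval₂RingHom φ y) (fun i => Polynomial.C (MvPolynomial.X i))
    Polynomial.X P
  simpa [toPoly] using this

theorem exists_toPoly (p : Polynomial (MvPolynomial (Fin d) ℤ)) :
    ∃ P Q : UniCode d, toPoly P - toPoly Q = p := by
  have key : ∀ (n : ℕ) (f : PolyCode (Fin d)),
      toPoly (f.map fun m => (n, m)) = Polynomial.C (PolyCode.toMv f) * Polynomial.X ^ n := by
    intro n f
    induction f with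
    | nil => simp [toPoly, PolyCode.toMv]
    | cons m f ih =>
      rw [toPoly] at ih ⊢
      rw [List.map_cons, eval_cons, ih, PolyCode.toMv, PolyCode.toMv, PolyCode.eval_cons, map_add,
        map_list_prod, List.map_map]
      simp only [Function.comp_def]
      ring
  induction p using Polynomial.induction_on' with
  | add p q hp hq =>
    obtain ⟨P, Q, rfl⟩ := hp
    obtain ⟨P', Q', rfl⟩ := hq
    exact ⟨P ++ P', Q ++ Q', by simp only [toPoly, eval_append]; ring⟩
  | monomial n a =>
    obtain ⟨c, rfl⟩ := DiffCode.toMv_surjective a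
    refine ⟨c.1.map fun m => (n, m), c.2.map fun m => (n, m), ?_⟩
    rw [key, key, ← sub_mul, ← map_sub, ← Polynomial.C_mul_X_pow_eq_monomial]
    rfl

end UniCode

/-- The code of a real root: a polynomial with parameters in `d` variables, given as a difference,
and the numerator and the exponent of the denominator of the left end point of a dyadic interval. -/
abbrev RootCode (d : ℕ) := (UniCode d × UniCode d) × ℕ × ℕ

namespace RootCode

variable {d : ℕ} (t : Fin d → ℝ) (x : RootCode d)

/-- The polynomial is negative at `y / 2 ^ k`. -/
def NegAt (y k : ℕ) : Prop :=
  UniCode.eval t ((y : ℝ) / 2 ^ k) x.1.1 < UniCode.eval t ((y : ℝ) / 2 ^ k) x.1.2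

/-- The polynomial changes its sign from the left to the right end point of the interval. -/
def Valid : Prop := NegAt t x x.2.1 x.2.2 ∧ ¬ NegAt t x (x.2.1 + 1) x.2.2

open Classical in
/-- The numerators of the left end points that are found by bisection. -/
noncomputable def bisect (n : ℕ) : ℕ :=
  Nat.rec x.2.1 (fun n l => if NegAt t x (2 * l + 1) (x.2.2 + (n + 1)) then 2 * l + 1 else 2 * l) n

open Classical in
/-- The root that is found by bisection. -/
noncomputable def root : ℝ :=
  if Valid t x then ⨆ n, (bisect t x n : ℝ) / 2 ^ (x.2.2 + n) else 0

open Classical in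
/-- The numerators of dyadic approximations to the root. -/
noncomputable def lower (k : ℕ) : ℕ := if Valid t x then bisect t x k / 2 ^ x.2.2 else 0

variable {t x}

theorem negAt_double (y k : ℕ) : NegAt t x (2 * y) (k + 1) ↔ NegAt t x y k := by
  have : ((2 * y : ℕ) : ℝ) / 2 ^ (k + 1) = (y : ℝ) / 2 ^ k := by
    rw [pow_succ]; push_cast; field_simp
  rw [NegAt, NegAt, this]

open Classical in
theorem bisect_succ (n : ℕ) : bisect t x (n + 1) =
    if NegAt t x (2 * bisect t x n + 1) (x.2.2 + (n + 1)) then 2 * bisect t x n + 1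
      else 2 * bisect t x n := rfl

/-- The invariant of bisection: negative at the left end, not negative at the right end. The right
end may itself be a zero. -/
theorem bisect_spec (h : Valid t x) (n : ℕ) :
    NegAt t x (bisect t x n) (x.2.2 + n) ∧ ¬ NegAt t x (bisect t x n + 1) (x.2.2 + n) := by
  induction n with
  | zero => exact h
  | succ n ih =>
    rw [bisect_succ]
    split_ifs with hn
    · refine ⟨hn, ?_⟩
      rw [show 2 * bisect t x n + 1 + 1 = 2 * (bisect t x n + 1) by ring, ← add_assoc,
        negAt_double]
      exact ih.2
    · refine ⟨?_, hn⟩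
      rw [← add_assoc, negAt_double]
      exact ih.1

theorem bisect_bounds (n : ℕ) : (bisect t x n : ℝ) / 2 ^ (x.2.2 + n) ≤
      (bisect t x (n + 1) : ℝ) / 2 ^ (x.2.2 + (n + 1)) ∧
    ((bisect t x (n + 1) : ℝ) + 1) / 2 ^ (x.2.2 + (n + 1)) ≤
      ((bisect t x n : ℝ) + 1) / 2 ^ (x.2.2 + n) := by
  have h2 : (0 : ℝ) < 2 ^ (x.2.2 + n) := by positivity
  have h3 : (2 : ℝ) ^ (x.2.2 + (n + 1)) = 2 ^ (x.2.2 + n) * 2 := by rw [← add_assoc, pow_succ]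
  rw [h3, div_le_div_iff₀ h2 (by positivity), div_le_div_iff₀ (by positivity) h2, bisect_succ]
  split_ifs <;> push_cast <;> constructor <;> nlinarith

theorem root_mem (h : Valid t x) (n : ℕ) : (bisect t x n : ℝ) / 2 ^ (x.2.2 + n) ≤ root t x ∧
    root t x ≤ ((bisect t x n : ℝ) + 1) / 2 ^ (x.2.2 + n) := by
  have hmono : Monotone fun n => (bisect t x n : ℝ) / 2 ^ (x.2.2 + n) :=
    monotone_nat_of_le_succ fun n => bisect_bounds n |>.1
  have hanti : Antitone fun n => ((bisect t x n : ℝ) + 1) / 2 ^ (x.2.2 + n) :=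
    antitone_nat_of_succ_le fun n => bisect_bounds n |>.2
  have := hmono.ciSup_mem_iInter_Icc_of_antitone hanti fun n => by
    change (bisect t x n : ℝ) / 2 ^ (x.2.2 + n) ≤ ((bisect t x n : ℝ) + 1) / 2 ^ (x.2.2 + n)
    gcongr
    linarith
  rw [Set.mem_iInter] at this
  rw [root, if_pos h]
  exact this n

/-- Both end points converge to the root. The left ends give one inequality in the limit and the
right ends the other. -/
theorem eval_root (h : Valid t x) :
    UniCode.eval t (root t x) x.1.1 = UniCode.eval t (root t x) x.1.2 := by
  have hz : Filter.Tendsto (fun n : ℕ => 1 / (2 : ℝ) ^ (x.2.2 + n)) Filter.atTop (nhds 0) := by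
    have := (tendsto_pow_atTop_nhds_zero_of_lt_one (by norm_num : (0 : ℝ) ≤ 1 / 2)
      (by norm_num)).const_mul ((1 : ℝ) / 2 ^ x.2.2)
    rw [mul_zero] at this
    refine this.congr fun n => ?_
    rw [pow_add, one_div_pow]
    field_simp
  have h1 : Filter.Tendsto (fun n => (bisect t x n : ℝ) / 2 ^ (x.2.2 + n)) Filter.atTop
      (nhds (root t x)) := by
    refine tendsto_of_tendsto_of_tendsto_of_le_of_le
      (by simpa only [sub_zero] using (tendsto_const_nhds (x := root t x)).sub hz) tendsto_const_nhds
      (fun n => ?_) fun n => (root_mem h n).1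
    have := (root_mem h n).2
    rw [add_div] at this
    exact sub_le_iff_le_add.mpr this
  have h2 : Filter.Tendsto (fun n => ((bisect t x n + 1 : ℕ) : ℝ) / 2 ^ (x.2.2 + n)) Filter.atTop
      (nhds (root t x)) := by
    have := h1.add hz
    rw [add_zero] at this
    refine this.congr fun n => ?_
    push_cast
    rw [add_div]
  have c1 := (UniCode.continuous_eval t x.1.1).tendsto (root t x)
  have c2 := (UniCode.continuous_eval t x.1.2).tendsto (root t x)
  exact le_antisymm
    (le_of_tendsto_of_tendsto' (c1.comp h1) (c2.comp h1) fun n => (bisect_spec h n).1.le)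
    (le_of_tendsto_of_tendsto' (c2.comp h2) (c1.comp h2) fun n => not_lt.mp (bisect_spec h n).2)

/-- Independence of `t` makes equality of values the same as formal equality, hence decidable, and
then the order on values is decidable as well. A power of the denominator clears the dyadic
argument. -/
theorem computable_negAt {τ : Fin d → ℕ → ℕ} (hτ : IsApprox t τ)
    (hind : AlgebraicIndependent ℤ t) :
    ComputablePred fun p : RootCode d × ℕ × ℕ => NegAt t p.1 p.2.1 p.2.2 := by
  have heq : ComputablePred fun p : PolyCode (Fin d) × PolyCode (Fin d) =>
      PolyCode.eval t p.1 = PolyCode.eval t p.2 :=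
    PolyCode.computable_toMv_eq.of_eq fun p => by
      rw [← PolyCode.aeval_toMv, ← PolyCode.aeval_toMv]
      exact (Function.Injective.eq_iff hind).symm
  have hP : Computable fun p : RootCode d × ℕ × ℕ => p.1.1.1 :=
    Computable.fst.comp (Computable.fst.comp .fst)
  have hQ : Computable fun p : RootCode d × ℕ × ℕ => p.1.1.2 :=
    Computable.snd.comp (Computable.fst.comp .fst)
  have hy : Computable fun p : RootCode d × ℕ × ℕ => p.2.1 := Computable.fst.comp .snd
  have hq : Computable fun p : RootCode d × ℕ × ℕ => 2 ^ p.2.2 :=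
    PolyCode.computable_pow.comp (.const 2) (Computable.snd.comp .snd)
  have hD : Computable fun p : RootCode d × ℕ × ℕ => UniCode.degBound p.1.1.1 p.1.1.2 :=
    PolyCode.computable_listSum.comp (Computable.list_map (Computable.list_append.comp hP hQ)
      (Computable.fst.comp .snd))
  refine ((hτ.computable_lt heq).comp
    (f := fun p : RootCode d × ℕ × ℕ =>
      (UniCode.scaled p.2.1 (2 ^ p.2.2) (UniCode.degBound p.1.1.1 p.1.1.2) p.1.1.1,
       UniCode.scaled p.2.1 (2 ^ p.2.2) (UniCode.degBound p.1.1.1 p.1.1.2) p.1.1.2))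
    ((UniCode.computable_scaled hy hq hD hP).pair (UniCode.computable_scaled hy hq hD hQ))).of_eq
    fun p => ?_
  have h0 : (2 ^ p.2.2 : ℕ) ≠ 0 := by positivity
  simp only
  rw [UniCode.eval_scaled t _ h0 _ fun x hx => UniCode.le_degBound (.inl hx),
    UniCode.eval_scaled t _ h0 _ fun x hx => UniCode.le_degBound (.inr hx), NegAt]
  push_cast
  exact mul_lt_mul_iff_right₀ (by positivity)

theorem computable_valid {τ : Fin d → ℕ → ℕ} (hτ : IsApprox t τ)
    (hind : AlgebraicIndependent ℤ t) : ComputablePred fun x : RootCode d => Valid t x := by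
  have ha : Computable fun x : RootCode d => x.2.1 := Computable.fst.comp .snd
  have hk : Computable fun x : RootCode d => x.2.2 := Computable.snd.comp .snd
  have h := computable_negAt hτ hind
  exact ComputablePred.and (h.comp (f := fun x : RootCode d => (x, x.2.1, x.2.2))
    (.pair .id (ha.pair hk))) (h.comp (f := fun x : RootCode d => (x, x.2.1 + 1, x.2.2))
    (.pair .id (Computable.pair (Computable.succ.comp ha) hk))).not

theorem computable_lower {τ : Fin d → ℕ → ℕ} (hτ : IsApprox t τ)
    (hind : AlgebraicIndependent ℤ t) : Computable₂ (lower t) := by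
  classical
  have hb : Computable₂ (bisect t) := by
    refine Computable.nat_rec (f := fun p : RootCode d × ℕ => p.2) (g := fun p => p.1.2.1)
      (h := fun p y => if NegAt t p.1 (2 * y.2 + 1) (p.1.2.2 + (y.1 + 1)) then 2 * y.2 + 1
        else 2 * y.2) .snd (Computable.fst.comp (Computable.snd.comp .fst)) ?_
    have h0 : Computable fun p : (RootCode d × ℕ) × ℕ × ℕ => 2 * p.2.2 :=
      Primrec.nat_double.to_comp.comp (Computable.snd.comp .snd)
    have h1 : Computable fun p : (RootCode d × ℕ) × ℕ × ℕ => 2 * p.2.2 + 1 :=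
      Computable.succ.comp h0
    have h2 : Computable fun p : (RootCode d × ℕ) × ℕ × ℕ => p.1.1.2.2 + (p.2.1 + 1) :=
      Primrec.nat_add.to_comp.comp (Computable.snd.comp (Computable.snd.comp (Computable.fst.comp
        .fst))) (Computable.succ.comp (Computable.fst.comp .snd))
    exact ((computable_negAt hτ hind).comp
      (f := fun p : (RootCode d × ℕ) × ℕ × ℕ => (p.1.1, 2 * p.2.2 + 1, p.1.1.2.2 + (p.2.1 + 1)))
      ((Computable.fst.comp .fst).pair (h1.pair h2))).ite' h1 h0
  exact ((computable_valid hτ hind).comp (f := fun p : RootCode d × ℕ => p.1) .fst).ite'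
    (Primrec.nat_div.to_comp.comp hb (PolyCode.computable_pow.comp (.const 2)
      (Computable.snd.comp (Computable.snd.comp .fst)))) (.const 0)

theorem isApprox_root {τ : Fin d → ℕ → ℕ} (hτ : IsApprox t τ)
    (hind : AlgebraicIndependent ℤ t) : IsApprox (root t) (lower t) where
  computable := computable_lower hτ hind
  le x k := by
    rw [lower]
    split_ifs with h
    · refine le_trans ?_ (root_mem h k).1
      rw [pow_add, div_mul_eq_div_div]
      gcongr
      exact_mod_cast Nat.cast_div_le (α := ℝ) (m := bisect t x k) (n := 2 ^ x.2.2)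
    · simp [root, h]
  ge x k := by
    rw [lower]
    split_ifs with h
    -- The width of the bisection interval and the rounding in the division each cost at most one
    -- unit, whence the `2` in `IsApprox`.
    · refine (root_mem h k).2.trans ?_
      rw [pow_add, div_mul_eq_div_div]
      gcongr
      rw [div_le_iff₀ (by positivity)]
      have := Nat.lt_div_mul_add (a := bisect t x k) (b := 2 ^ x.2.2) (by positivity)
      have h2 : bisect t x k + 1 ≤ (bisect t x k / 2 ^ x.2.2 + 2) * 2 ^ x.2.2 := by
        rw [add_mul]
        have hp : 0 < 2 ^ x.2.2 := by positivity
        linarith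
      exact_mod_cast h2
    · simp only [root, h, if_false]
      positivity

end RootCode

/-! ### The field of real numbers algebraic over finitely many computable reals -/

namespace RootCode

variable {d : ℕ} (t : Fin d → ℝ)

/-- The independent reals `t` together with all the roots that are found by bisection. -/
noncomputable def gen : Fin d ⊕ RootCode d → ℝ := Sum.elim t (root t)

theorem exists_isApprox_gen {τ : Fin d → ℕ → ℕ} (hτ : IsApprox t τ)
    (hind : AlgebraicIndependent ℤ t) : ∃ l, IsApprox (gen t) l := by
  have h := isApprox_root hτ hind
  refine ⟨fun v k => Sum.casesOn v (fun i => τ i k) (fun x => lower t x k), ?_, ?_, ?_⟩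
  · refine Computable.sumCasesOn (f := fun p : (Fin d ⊕ RootCode d) × ℕ => p.1)
      (g := fun p i => τ i p.2) (h := fun p x => lower t x p.2) .fst ?_ ?_
    · exact hτ.computable.comp .snd (Computable.snd.comp .fst)
    · exact h.computable.comp .snd (Computable.snd.comp .fst)
  · rintro (i | x) k
    · exact hτ.le i k
    · exact h.le x k
  · rintro (i | x) k
    · exact hτ.ge i k
    · exact h.ge x k

/-- The polynomial `P` at the variable `x`. -/
def atVar (x : RootCode d) (P : UniCode d) : PolyCode (Fin d ⊕ RootCode d) :=
  P.map fun y => List.replicate y.1 (Sum.inr x) ++ y.2.map Sum.inl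

theorem eval_atVar {R : Type*} [CommSemiring R] (s : Fin d ⊕ RootCode d → R) (x : RootCode d)
    (P : UniCode d) :
    PolyCode.eval s (atVar x P) = UniCode.eval (fun i => s (Sum.inl i)) (s (Sum.inr x)) P := by
  induction P with
  | nil => simp [atVar]
  | cons y P ih =>
    rw [atVar] at ih ⊢
    rw [List.map_cons, PolyCode.eval_cons, ih, UniCode.eval_cons]
    simp [Function.comp_def]

theorem computable_atVar {α : Type*} [Primcodable α] {x : α → RootCode d} {P : α → UniCode d}
    (hx : Computable x) (hP : Computable P) : Computable fun a => atVar (x a) (P a) := by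
  refine Computable.list_map hP ?_
  refine Computable.list_append.comp ?_ ?_
  · refine (Computable.list_map (f := fun p : α × (ℕ × List (Fin d)) => List.range p.2.1)
      (g := fun p _ => (Sum.inr (x p.1) : Fin d ⊕ RootCode d))
      (Primrec.list_range.to_comp.comp (Computable.fst.comp .snd))
      (Computable.sumInr.comp (hx.comp (Computable.fst.comp .fst)))).of_eq fun p => ?_
    simp [List.map_const']
  · exact Computable.list_map (Computable.snd.comp .snd) (Computable.sumInl.comp .snd)

open Classical in
/-- An algebraic relation over the independent reals `t` for each of the generators. -/
noncomputable def relation (v : Fin d ⊕ RootCode d) : DiffCode (Fin d ⊕ RootCode d) :=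
  Sum.casesOn v (fun _ => ([], []))
    (fun x => if Valid t x then (atVar x x.1.1, atVar x x.1.2) else ([ [Sum.inr x] ], []))

theorem computable_relation {τ : Fin d → ℕ → ℕ} (hτ : IsApprox t τ)
    (hind : AlgebraicIndependent ℤ t) : Computable (relation t) := by
  classical
  refine Computable.sumCasesOn (f := fun v : Fin d ⊕ RootCode d => v) (g := fun _ _ => ([], []))
    (h := fun _ x => if Valid t x then (atVar x x.1.1, atVar x x.1.2) else ([ [Sum.inr x] ], []))
    .id (.const _) ?_
  have hx : Computable fun p : (Fin d ⊕ RootCode d) × RootCode d => p.2 := .snd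
  have h1 := computable_atVar hx (Computable.fst.comp (Computable.fst.comp hx))
  have h2 := computable_atVar hx (Computable.snd.comp (Computable.fst.comp hx))
  have h3 : Computable fun p : (Fin d ⊕ RootCode d) × RootCode d =>
      ([ [Sum.inr p.2] ] : PolyCode (Fin d ⊕ RootCode d)) :=
    Computable.list_cons.comp (Computable.list_cons.comp (Computable.sumInr.comp hx) (.const []))
      (.const [])
  exact ((computable_valid hτ hind).comp hx).ite' (h1.pair h2) (h3.pair (.const []))

theorem val_relation (v : Fin d ⊕ RootCode d) : DiffCode.val (gen t) (relation t v) = 0 := by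
  rcases v with i | x
  · simp [relation, DiffCode.val]
  · simp only [relation]
    split_ifs with h
    · simp only [DiffCode.val, eval_atVar, gen, Sum.elim_inl, Sum.elim_inr]
      exact sub_eq_zero.mpr (eval_root h)
    · simp [DiffCode.val, gen, root, h]

variable {t}

/-- The polynomial of a valid code does not vanish identically. -/
theorem Valid.map_ne_zero {x : RootCode d} (h : Valid t x) :
    (UniCode.toPoly x.1.1 - UniCode.toPoly x.1.2).map
      (MvPolynomial.aeval (R := ℤ) t).toRingHom ≠ 0 := by
  intro h0
  have h1 := congrArg (Polynomial.eval ((x.2.1 : ℝ) / 2 ^ x.2.2)) h0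
  rw [Polynomial.eval_map, Polynomial.eval₂_sub, UniCode.eval₂_toPoly, UniCode.eval₂_toPoly,
    Polynomial.eval_zero, sub_eq_zero] at h1
  simp only [AlgHom.toRingHom_eq_coe, RingHom.coe_coe, MvPolynomial.aeval_X] at h1
  exact h.1.ne h1

/-- The generators `t` are the independent variables. A valid code is algebraic over them by its own
polynomial, and an invalid one has the relation that its value is zero. -/
theorem exists_relation_mul_pow (hind : AlgebraicIndependent ℤ t)
    (f : MvPolynomial (Fin d ⊕ RootCode d) ℤ) (hf : MvPolynomial.aeval (gen t) f = 0) :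
    ∃ (g : MvPolynomial (Fin d ⊕ RootCode d) ℤ) (m : ℕ), MvPolynomial.aeval (gen t) g ≠ 0 ∧
      g * f ^ m ∈ Ideal.span (Set.range fun v => DiffCode.toMv (relation t v)) := by
  refine exists_mul_pow_mem_of_algebraic (ι := Sum.inl) (by exact hind) (fun v => ?_) f hf
  rcases v with i | x
  -- At the variable itself this polynomial evaluates to the zero element of the ideal, so the empty
  -- relation suffices for `t`.
  · refine ⟨Polynomial.X - Polynomial.C (MvPolynomial.X i), Polynomial.X_sub_C_ne_zero _, ?_⟩
    rw [Polynomial.eval₂_sub, Polynomial.eval₂_X, Polynomial.eval₂_C]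
    simp
  · have hmem : DiffCode.toMv (relation t (Sum.inr x)) ∈
        Ideal.span (Set.range fun v => DiffCode.toMv (relation t v)) :=
      Ideal.subset_span ⟨_, rfl⟩
    by_cases h : Valid t x
    · refine ⟨UniCode.toPoly x.1.1 - UniCode.toPoly x.1.2, fun h0 => h.map_ne_zero ?_, ?_⟩
      · rw [h0, Polynomial.map_zero]
      · convert hmem using 1
        rw [Polynomial.eval₂_sub, UniCode.eval₂_toPoly, UniCode.eval₂_toPoly]
        simp only [relation, h, if_true, DiffCode.toMv, DiffCode.val, eval_atVar]
        simp
    · refine ⟨Polynomial.X, Polynomial.X_ne_zero, ?_⟩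
      convert hmem using 1
      simp [relation, h, DiffCode.toMv, DiffCode.val]

variable (t)

/-- The subring of `ℝ` generated by `t`. -/
noncomputable abbrev baseRing : Subalgebra ℤ ℝ := (MvPolynomial.aeval (R := ℤ) t).range

/-- The reals that are algebraic over `t`. -/
noncomputable def field : Subring ℝ := (Subalgebra.algebraicClosure (baseRing t) ℝ).toSubring

variable {t}

theorem mem_field {x : ℝ} : x ∈ field t ↔ IsAlgebraic (baseRing t) x := Iff.rfl

theorem mem_field_iff {x : ℝ} : x ∈ field t ↔ ∃ p : Polynomial (MvPolynomial (Fin d) ℤ),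
    p.map (MvPolynomial.aeval (R := ℤ) t).toRingHom ≠ 0 ∧
      (p.map (MvPolynomial.aeval (R := ℤ) t).toRingHom).eval x = 0 := by
  let φ : MvPolynomial (Fin d) ℤ →+* baseRing t := (MvPolynomial.aeval (R := ℤ) t).rangeRestrict
  have hφ : (algebraMap (baseRing t) ℝ).comp φ = (MvPolynomial.aeval (R := ℤ) t).toRingHom := rfl
  have hsurj : Function.Surjective φ := (MvPolynomial.aeval (R := ℤ) t).rangeRestrict_surjective
  have hinj : Function.Injective (algebraMap (baseRing t) ℝ) := Subtype.val_injective
  rw [mem_field]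
  constructor
  · rintro ⟨p, hp0, hp⟩
    obtain ⟨p, rfl⟩ := Polynomial.map_surjective φ hsurj p
    refine ⟨p, ?_, ?_⟩
    · rw [← hφ, ← Polynomial.map_map]
      exact (Polynomial.map_ne_zero_iff hinj).mpr hp0
    · rw [← hφ, ← Polynomial.map_map, Polynomial.eval_map]
      exact hp
  · rintro ⟨p, hp0, hp⟩
    rw [← hφ, ← Polynomial.map_map] at hp0 hp
    refine ⟨p.map φ, (Polynomial.map_ne_zero_iff hinj).mp hp0, ?_⟩
    rw [Polynomial.eval_map] at hp
    exact hp

/-- Transitivity of algebraicity. -/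
theorem rootClosed_field : RealSpec.RootClosed (field t) := by
  intro p x hp0 hp
  have h : IsAlgebraic (Subalgebra.algebraicClosure (baseRing t) ℝ) x := ⟨p, hp0, hp⟩
  exact h.restrictScalars (baseRing t)

theorem gen_mem_field (v : Fin d ⊕ RootCode d) : gen t v ∈ field t := by
  rw [mem_field_iff]
  rcases v with i | x
  · refine ⟨Polynomial.X - Polynomial.C (MvPolynomial.X i), ?_, ?_⟩
    · rw [Polynomial.map_sub, Polynomial.map_X, Polynomial.map_C]
      exact Polynomial.X_sub_C_ne_zero _
    · simp [gen]
  · by_cases h : Valid t x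
    · refine ⟨_, h.map_ne_zero, ?_⟩
      rw [Polynomial.eval_map, Polynomial.eval₂_sub, UniCode.eval₂_toPoly, UniCode.eval₂_toPoly,
        sub_eq_zero]
      simpa [gen] using eval_root h
    · exact ⟨Polynomial.X, by simp, by simp [gen, root, h]⟩

theorem val_mem_field (c : DiffCode (Fin d ⊕ RootCode d)) : DiffCode.val (gen t) c ∈ field t := by
  have h : ∀ f : PolyCode (Fin d ⊕ RootCode d), PolyCode.eval (gen t) f ∈ field t := by
    intro f
    refine Subring.list_sum_mem _ fun x hx => ?_
    obtain ⟨m, -, rfl⟩ := List.mem_map.mp hx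
    refine Subring.list_prod_mem _ fun y hy => ?_
    obtain ⟨v, -, rfl⟩ := List.mem_map.mp hy
    exact gen_mem_field v
  exact Subring.sub_mem _ (h _) (h _)

/-- A minimal relation has a simple root at `x`, so on a short enough dyadic interval around `x` it
changes sign and has no other zero. Bisection there can only find `x`. Positivity allows the left
end point to have a natural numerator. -/
theorem exists_root_eq {x : ℝ} (hx : x ∈ field t) (hpos : 0 < x) :
    ∃ c : RootCode d, root t c = x := by
  obtain ⟨p, hpx, -, hder, -⟩ := RealSpec.exists_minimal_relation _ x (mem_field_iff.mp hx)
  obtain ⟨δ, hδ, hsign⟩ := RealSpec.exists_sign_near_simple_root _ x hpx hder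
  set p' := p.map (MvPolynomial.aeval (R := ℤ) t).toRingHom with hp'
  obtain ⟨k, hk⟩ := exists_pow_lt_of_lt_one hδ (by norm_num : (1 / 2 : ℝ) < 1)
  rw [one_div_pow] at hk
  have h2k : (0 : ℝ) < 2 ^ k := by positivity
  -- The ceiling puts `x` strictly to the right of `a / 2 ^ k`, where the sign must be strict, and
  -- allows `x` to be the right end point.
  obtain ⟨a, ha⟩ : ∃ a, ⌈2 ^ k * x⌉₊ = a + 1 :=
    Nat.exists_eq_succ_of_ne_zero (Nat.ceil_pos.mpr (by positivity)).ne'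
  have ha1 : (a : ℝ) / 2 ^ k < x := by
    rw [div_lt_iff₀ h2k, mul_comm]
    exact Nat.lt_ceil.mp (by omega)
  have ha2 : x ≤ ((a : ℝ) + 1) / 2 ^ k := by
    rw [le_div_iff₀ h2k, mul_comm]
    exact_mod_cast Nat.ceil_le.mp ha.le
  have hwidth : ((a : ℝ) + 1) / 2 ^ k = (a : ℝ) / 2 ^ k + 1 / 2 ^ k := add_div _ _ _
  have hclose : ∀ y, (a : ℝ) / 2 ^ k ≤ y → y ≤ ((a : ℝ) + 1) / 2 ^ k → |y - x| ≤ δ := by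
    intro y h1 h2
    rw [abs_le]
    constructor <;> linarith
  have hleft := hsign _ ha1.ne (hclose _ le_rfl (by rw [hwidth]; linarith [one_div_pos.mpr h2k]))
  have hleft' : p'.derivative.eval x * p'.eval ((a : ℝ) / 2 ^ k) < 0 := by
    by_contra hcon
    push Not at hcon
    nlinarith [mul_nonneg hcon (sub_nonneg.mpr ha1.le)]
  have hright' : 0 ≤ p'.derivative.eval x * p'.eval (((a : ℝ) + 1) / 2 ^ k) := by
    rcases ha2.eq_or_lt with h | h
    · rw [← h, hpx, mul_zero]
    · have := hsign _ h.ne' (hclose _ (by rw [hwidth]; linarith [one_div_pos.mpr h2k]) le_rfl)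
      by_contra hcon
      push Not at hcon
      nlinarith [mul_pos (neg_pos.mpr hcon) (sub_pos.mpr h)]
  obtain ⟨P, Q, hPQ⟩ := UniCode.exists_toPoly p
  have heval : ∀ y, p'.eval y = UniCode.eval t y P - UniCode.eval t y Q := by
    intro y
    rw [hp', ← hPQ, Polynomial.eval_map, Polynomial.eval₂_sub, UniCode.eval₂_toPoly,
      UniCode.eval₂_toPoly]
    simp
  have conclude : ∀ c : RootCode d, c.2 = (a, k) → Valid t c →
      (∀ y, UniCode.eval t y c.1.1 = UniCode.eval t y c.1.2 → p'.eval y = 0) → root t c = x := by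
    intro c hc hv hroot
    by_contra hne
    have hm := root_mem hv 0
    have hb : bisect t c 0 = c.2.1 := rfl
    rw [hb, hc] at hm
    have := hsign _ hne (hclose _ (by simpa using hm.1) (by simpa using hm.2))
    rw [hroot _ (eval_root hv)] at this
    simp at this
  have hcast : ((a + 1 : ℕ) : ℝ) = (a : ℝ) + 1 := by push_cast; rfl
  rw [heval] at hleft' hright'
  -- The sign of the derivative decides the order of the two polynomials: the coded difference has
  -- to be negative on the left.
  rcases lt_or_gt_of_ne hder with hlt | hgt
  · refine ⟨((Q, P), a, k), conclude _ rfl ⟨?_, ?_⟩ fun y hy => ?_⟩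
    · exact sub_pos.mp (pos_of_mul_neg_right hleft' hlt.le)
    · rw [NegAt, hcast, not_lt]
      exact sub_nonpos.mp (nonpos_of_mul_nonneg_right hright' hlt)
    · simp only at hy; rw [heval]; linarith
  · refine ⟨((P, Q), a, k), conclude _ rfl ⟨?_, ?_⟩ fun y hy => ?_⟩
    · exact sub_neg.mp (neg_of_mul_neg_right hleft' hgt.le)
    · rw [NegAt, hcast, not_lt]
      exact sub_nonneg.mp (nonneg_of_mul_nonneg_right hright' hgt)
    · simp only at hy; rw [heval]; linarith

theorem exists_val_eq {x : ℝ} (hx : x ∈ field t) :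
    ∃ c : DiffCode (Fin d ⊕ RootCode d), DiffCode.val (gen t) c = x := by
  have pos : ∀ y ∈ field t, 0 < y → ∃ c, DiffCode.val (gen t) c = y := by
    intro y hy h
    obtain ⟨c, rfl⟩ := exists_root_eq hy h
    exact ⟨DiffCode.var (Sum.inr c), by simp [gen]⟩
  rcases lt_trichotomy x 0 with h | h | h
  · obtain ⟨c, hc⟩ := pos (-x) (Subring.neg_mem _ hx) (by linarith)
    exact ⟨c.swap, by simp [hc]⟩
  · exact ⟨([], []), by simp [DiffCode.val, h]⟩
  · exact pos x hx h

end RootCode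

/-! ### Computable parameters and a transcendence basis among them. -/

open BSS in
theorem BSS.IsComputableReal.exists_approx {x : ℝ} (hx : IsComputableReal x) (h0 : 0 ≤ x) :
    ∃ l : ℕ → ℕ, Computable l ∧ ∀ k, (l k : ℝ) / 2 ^ k ≤ x ∧ x ≤ ((l k + 2 : ℕ) : ℝ) / 2 ^ k := by
  obtain ⟨p, q, hp, hq, h⟩ := hx
  -- An error of one unit either way places `2 ^ k * x` between `p - q - 1` and `p - q + 1`.
  -- Truncation of the subtraction at zero is harmless because `x` is nonnegative.
  refine ⟨fun k => p k - q k - 1, Primrec.nat_sub.to_comp.comp (Primrec.nat_sub.to_comp.comp hp hq)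
    (.const 1), fun k => ?_⟩
  have h2 : (0 : ℝ) < 2 ^ k := by positivity
  have h3 := abs_le.mp (h k)
  simp only
  rw [div_le_iff₀ h2, le_div_iff₀ h2]
  have h4 : x * 2 ^ k ≤ (p k : ℝ) - q k + 1 := by
    have := h3.2
    rw [sub_le_iff_le_add, ← add_div, le_div_iff₀ h2] at this
    linarith
  have h5 : (p k : ℝ) - q k - 1 ≤ x * 2 ^ k := by
    have : ((p k : ℝ) - q k - 1) / 2 ^ k ≤ x := by rw [sub_div]; linarith [h3.1]
    rwa [div_le_iff₀ h2] at this
  have h6 : 0 ≤ x * 2 ^ k := by positivity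
  constructor
  · by_cases hc : q k + 1 ≤ p k
    · rw [Nat.sub_sub, Nat.cast_sub hc]
      push_cast
      linarith
    · rw [show p k - q k - 1 = 0 by omega]
      simpa using h6
  · have : (p k : ℝ) - q k + 1 ≤ ((p k - q k - 1 + 2 : ℕ) : ℝ) := by
      have : p k + 1 ≤ p k - q k - 1 + 2 + q k := by omega
      have : ((p k + 1 : ℕ) : ℝ) ≤ ((p k - q k - 1 + 2 + q k : ℕ) : ℝ) := by exact_mod_cast this
      push_cast at this ⊢
      linarith
    linarith

theorem BSS.IsComputableReal.add_nat {x : ℝ} (hx : IsComputableReal x) (N : ℕ) :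
    IsComputableReal (x + N) := by
  obtain ⟨p, q, hp, hq, h⟩ := hx
  refine ⟨fun n => p n + N * 2 ^ n, q, Primrec.nat_add.to_comp.comp hp
    (Primrec.nat_mul.to_comp.comp (.const N) (PolyCode.computable_pow.comp (.const 2) .id)), hq,
    fun n => ?_⟩
  convert h n using 2
  push_cast
  field_simp
  ring

/-- An independent subset of largest cardinality: an element of `S` transcendental over it could be
added. -/
theorem exists_maximal_algebraicIndependent_fin (S : Finset ℝ) :
    ∃ (d : ℕ) (t : Fin d → ℝ), AlgebraicIndependent ℤ t ∧ (∀ i, t i ∈ S) ∧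
      ∀ x ∈ S, x ∈ RootCode.field t := by
  classical
  have hne : (S.powerset.filter fun T : Finset ℝ => AlgebraicIndepOn ℤ id (T : Set ℝ)).Nonempty := by
    refine ⟨∅, Finset.mem_filter.mpr ⟨Finset.empty_mem_powerset _, ?_⟩⟩
    rw [Finset.coe_empty]
    exact (algebraicIndependent_empty_iff ..).mpr (algebraMap ℤ ℝ).injective_int
  obtain ⟨T, hT, hmax⟩ := Finset.exists_max_image _ Finset.card hne
  obtain ⟨hTS, hind⟩ := Finset.mem_filter.mp hT
  rw [Finset.mem_powerset] at hTS
  let t : Fin T.card → ℝ := fun i => (T.equivFin.symm i : ℝ)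
  have hrange : Set.range t = T := by
    ext y
    constructor
    · rintro ⟨i, rfl⟩
      exact (T.equivFin.symm i).2
    · intro hy
      exact ⟨T.equivFin ⟨y, hy⟩, by simp [t]⟩
  refine ⟨T.card, t, ?_, fun i => hTS (T.equivFin.symm i).2, fun x hx => ?_⟩
  · exact AlgebraicIndependent.comp hind _ T.equivFin.symm.injective
  · by_cases hxT : x ∈ T
    · have : x ∈ Set.range t := by rw [hrange]; exact hxT
      obtain ⟨i, rfl⟩ := this
      exact RootCode.gen_mem_field (Sum.inl i)
    · rw [RootCode.mem_field]
      by_contra htr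
      have hadj : Algebra.adjoin ℤ (id '' (T : Set ℝ)) = RootCode.baseRing t := by
        rw [Set.image_id, ← hrange, Algebra.adjoin_range_eq_range_aeval]
      have hins : AlgebraicIndepOn ℤ id (insert x (T : Set ℝ)) := by
        rw [AlgebraicIndepOn.insert_iff (by exact_mod_cast hxT), hadj]
        exact ⟨hind, htr⟩
      have := hmax (insert x T) (Finset.mem_filter.mpr ⟨Finset.mem_powerset.mpr
        (Finset.insert_subset hx hTS), by rwa [Finset.coe_insert]⟩)
      rw [Finset.card_insert_of_notMem hxT] at this
      omega

/-- Every finite set of computable reals is contained in a subring of `ℝ` that is closed under real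
roots and has a presentation with decidable equality and order. -/
theorem exists_computable_rootClosed (S : Finset ℝ) (hS : ∀ x ∈ S, BSS.IsComputableReal x) :
    ∃ (F : Subring ℝ) (V : Type) (_ : Primcodable V) (s : V → ℝ), RealSpec.RootClosed F ∧
      (∀ x ∈ S, x ∈ F) ∧ (∀ x, x ∈ F ↔ ∃ c : DiffCode V, DiffCode.val s c = x) ∧
      (ComputablePred fun p : DiffCode V × DiffCode V => DiffCode.val s p.1 = DiffCode.val s p.2) ∧
      ComputablePred fun p : DiffCode V × DiffCode V => DiffCode.val s p.1 < DiffCode.val s p.2 := by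
  classical
  obtain ⟨d, t, hind, htS, hfield⟩ :=
    -- Shifting by natural numbers makes the parameters nonnegative, as the approximations require,
    -- and does not change which subrings contain them.
    exists_maximal_algebraicIndependent_fin (S.image fun x => x + ⌈|x|⌉₊)
  have happ : ∀ i, ∃ l : ℕ → ℕ, Computable l ∧
      ∀ k, (l k : ℝ) / 2 ^ k ≤ t i ∧ t i ≤ ((l k + 2 : ℕ) : ℝ) / 2 ^ k := by
    intro i
    obtain ⟨x, hx, hxi⟩ := Finset.mem_image.mp (htS i)
    rw [← hxi]
    refine ((hS x hx).add_nat _).exists_approx ?_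
    have := Nat.le_ceil |x|
    linarith [neg_abs_le x]
  choose τ hτc hτ using happ
  have hτ' : IsApprox t τ :=
    ⟨Computable.finite_cases hτc, fun i k => (hτ i k).1, fun i k => (hτ i k).2⟩
  obtain ⟨l, hl⟩ := RootCode.exists_isApprox_gen t hτ' hind
  have hcomp := DiffCode.computable_eq_and_lt hl (RootCode.computable_relation t hτ' hind)
    (RootCode.val_relation t) (RootCode.exists_relation_mul_pow hind)
  refine ⟨RootCode.field t, _, _, RootCode.gen t, RootCode.rootClosed_field, fun x hx => ?_,
    fun x => ⟨RootCode.exists_val_eq, ?_⟩, hcomp.1, hcomp.2⟩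
  · have := hfield _ (Finset.mem_image_of_mem _ hx)
    simpa using Subring.sub_mem _ this (natCast_mem _ ⌈|x|⌉₊)
  · rintro ⟨c, rfl⟩
    exact RootCode.val_mem_field c

/-! ### Simulation of machines on coded tapes -/

section Finite

variable {α : Type*} [Primcodable α]

theorem ComputablePred.forall_finite {ι : Type*} [Finite ι] {p : ι → α → Prop}
    (hp : ∀ i, ComputablePred (p i)) : ComputablePred fun a => ∀ i, p i a := by
  have key : ∀ l : List ι, ComputablePred fun a => ∀ i ∈ l, p i a := by
    intro l
    induction l with
    | nil => exact ⟨fun _ => .isTrue (by simp), (Computable.const true).of_eq fun a => by simp⟩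
    | cons i l ih => exact ((hp i).and ih).of_eq (by simp)
  obtain ⟨l, hl⟩ : ∃ l : List ι, ∀ i, i ∈ l := by
    have := Fintype.ofFinite ι
    exact ⟨Finset.univ.toList, by simp⟩
  exact (key l).of_eq fun a => ⟨fun h i => h i (hl i), fun h i _ => h i⟩

end Finite

/-- A tape is coded by the lists of the entries on the coordinates `0, -1, …` and `1, 2, …`. -/
abbrev TapeCode (β : Type*) := List β × List β

namespace TapeCode

variable {β : Type*} (z : β)

/-- The entry on the coordinate `i`. -/
def look (i : ℤ) (c : TapeCode β) : β :=
  if 1 ≤ i then c.2.getD (i - 1).toNat z else c.1.getD (-i).toNat z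

/-- Replacement of an entry of a list, which is prolonged by the default value `z`. -/
def updList : ℕ → β → List β → List β
  | 0, a, l => a :: l.tail
  | n + 1, a, l => l.headD z :: updList n a l.tail

/-- Replacement of the entry on the coordinate `i`. -/
def upd (i : ℤ) (a : β) (c : TapeCode β) : TapeCode β :=
  if 1 ≤ i then (c.1, updList z (i - 1).toNat a c.2) else (updList z (-i).toNat a c.1, c.2)

/-- The tape shifted by `1`. -/
def shiftL (c : TapeCode β) : TapeCode β := (c.2.headD z :: c.1, c.2.tail)

/-- The tape shifted by `-1`. -/
def shiftR (c : TapeCode β) : TapeCode β := (c.1.tail, c.1.headD z :: c.2)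

theorem getD_updList (n m : ℕ) (a : β) (l : List β) :
    (updList z n a l).getD m z = if m = n then a else l.getD m z := by
  induction n generalizing m l with
  | zero => cases m <;> cases l <;> simp [updList]
  | succ n ih =>
    cases m with
    | zero => cases l <;> simp [updList]
    | succ m =>
      rw [updList, List.getD_cons_succ, ih]
      cases l <;> simp

theorem look_upd (i j : ℤ) (a : β) (c : TapeCode β) :
    look z j (upd z i a c) = if j = i then a else look z j c := by
  simp only [look, upd]
  by_cases hi : 1 ≤ i <;> by_cases hj : 1 ≤ j <;> simp only [hi, hj, if_true, if_false]
  · rw [getD_updList]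
    exact if_congr ⟨fun h => by omega, fun h => by omega⟩ rfl rfl
  · rw [if_neg (by omega)]
  · rw [if_neg (by omega)]
  · rw [getD_updList]
    exact if_congr ⟨fun h => by omega, fun h => by omega⟩ rfl rfl

theorem look_shiftL (i : ℤ) (c : TapeCode β) : look z i (shiftL z c) = look z (i + 1) c := by
  obtain ⟨l, r⟩ := c
  simp only [look, shiftL]
  by_cases h1 : 1 ≤ i
  · rw [if_pos h1, if_pos (by omega), show (i + 1 - 1).toNat = (i - 1).toNat + 1 by omega]
    cases r <;> simp
  · rw [if_neg h1]
    by_cases h2 : i = 0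
    · subst h2
      cases r <;> simp
    · rw [if_neg (by omega), show (-i).toNat = (-(i + 1)).toNat + 1 by omega]
      simp

theorem look_shiftR (i : ℤ) (c : TapeCode β) : look z i (shiftR z c) = look z (i + -1) c := by
  obtain ⟨l, r⟩ := c
  simp only [look, shiftR]
  by_cases h1 : 1 ≤ i
  · rw [if_pos h1]
    by_cases h2 : i = 1
    · subst h2
      cases l <;> simp
    · rw [if_pos (by omega), show (i - 1).toNat = (i + -1 - 1).toNat + 1 by omega]
      simp
  · rw [if_neg h1, if_neg (by omega), show (-(i + -1)).toNat = (-i).toNat + 1 by omega]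
    cases l <;> simp

variable [Primcodable β]

theorem computable_getD (n : ℕ) : Computable fun l : List β => l.getD n z := by
  have h : Computable fun l : List β => l[n]? := Computable.list_getElem?.comp .id (.const n)
  exact (Computable.option_getD h (.const z)).of_eq fun l => by simp

theorem computable_look (i : ℤ) : Computable (look z i) := by
  unfold look
  split_ifs
  · exact (computable_getD z _).comp .snd
  · exact (computable_getD z _).comp .fst

theorem computable_headD : Computable fun l : List β => l.headD z :=
  (computable_getD z 0).of_eq fun l => by cases l <;> simp

theorem computable_updList (n : ℕ) : Computable fun p : β × List β => updList z n p.1 p.2 := by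
  induction n with
  | zero => exact Computable.list_cons.comp .fst (Primrec.list_tail.to_comp.comp .snd)
  | succ n ih =>
    exact Computable.list_cons.comp ((computable_headD z).comp .snd)
      (ih.comp (.pair .fst (Primrec.list_tail.to_comp.comp .snd)))

theorem computable_upd (i : ℤ) : Computable fun p : β × TapeCode β => upd z i p.1 p.2 := by
  unfold upd
  split_ifs
  · exact .pair (Computable.fst.comp .snd)
      ((computable_updList z _).comp (.pair .fst (Computable.snd.comp .snd)))
  · exact .pair ((computable_updList z _).comp (.pair .fst (Computable.fst.comp .snd)))
      (Computable.snd.comp .snd)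

theorem computable_shiftL : Computable (shiftL z) :=
  .pair (Computable.list_cons.comp ((computable_headD z).comp .snd) .fst)
    (Primrec.list_tail.to_comp.comp .snd)

theorem computable_shiftR : Computable (shiftR z) :=
  .pair (Primrec.list_tail.to_comp.comp .fst)
    (Computable.list_cons.comp ((computable_headD z).comp .fst) .snd)

/-- The new entries of a window are read from a list given beforehand, so they are all written at
once and none depends on an entry already overwritten. -/
theorem exists_updater {W : Finset ℤ} (e : W → ℕ) (l : List W) :
    ∃ u : TapeCode β × List β → TapeCode β, Computable u ∧ ∀ p,
      (∀ i ∈ l, look z i (u p) = p.2.getD (e i) z) ∧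
      ∀ j, (∀ i ∈ l, (i : ℤ) ≠ j) → look z j (u p) = look z j p.1 := by
  induction l with
  | nil => exact ⟨fun p => p.1, .fst, fun p => ⟨by simp, fun j _ => rfl⟩⟩
  | cons i l ih =>
    obtain ⟨u, hu, h⟩ := ih
    refine ⟨fun p => upd z i (p.2.getD (e i) z) (u p), ?_, fun p => ⟨?_, fun j hj => ?_⟩⟩
    · have h1 : Computable fun p : TapeCode β × List β => p.2.getD (e i) z :=
        (computable_getD z (e i)).comp .snd
      have h2 := (computable_upd z i).comp (h1.pair hu)
      exact h2
    · intro j hj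
      rw [look_upd]
      split_ifs with hij
      · rw [Subtype.ext hij]
      · exact (h p).1 j ((List.mem_cons.mp hj).resolve_left fun h => hij (by rw [h]))
    · rw [look_upd, if_neg fun h => hj i List.mem_cons_self h.symm]
      exact (h p).2 j fun i hi => hj i (List.mem_cons_of_mem _ hi)

end TapeCode

/-! ### Simulation of maps, steps and runs on codes. -/

namespace BSS

open TapeCode DiffCode

/-- A presentation of the elements of `F` by codes, with decidable equality and order. -/
structure IsPresentation (F : Subring ℝ) {V : Type*} [Primcodable V] (s : V → ℝ) : Prop where
  rootClosed : RealSpec.RootClosed F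
  mem_iff : ∀ x, x ∈ F ↔ ∃ c : DiffCode V, val s c = x
  computable_eq : ComputablePred fun p : DiffCode V × DiffCode V => val s p.1 = val s p.2
  computable_lt : ComputablePred fun p : DiffCode V × DiffCode V => val s p.1 < val s p.2

/-- The code `c` represents the tape `x`. -/
def Represents {V : Type*} (s : V → ℝ) (c : TapeCode (DiffCode V)) (x : Tape) : Prop :=
  ∀ i, x i = val s (look (ofNat 0) i c)

namespace IsPresentation

variable {F : Subring ℝ} {V : Type*} [Primcodable V] {s : V → ℝ}

theorem val_mem (hF : IsPresentation F s) (c : DiffCode V) : val s c ∈ F :=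
  (hF.mem_iff _).mpr ⟨c, rfl⟩

/-- The program is built along the polynomial, with a fixed code for each coefficient; there are
finitely many, so no uniform choice of codes is needed. -/
theorem exists_evaluator (hF : IsPresentation F s) {h : MvPolynomial ℤ ℝ} (hh : PolyOver F h) :
    ∃ e : TapeCode (DiffCode V) → DiffCode V, Computable e ∧ ∀ c x, Represents s c x →
      val s (e c) = MvPolynomial.eval (fun i => x i) h := by
  obtain ⟨p, rfl⟩ := hh
  induction p using MvPolynomial.induction_on with
  | C a =>
    obtain ⟨d, hd⟩ := (hF.mem_iff a).mp a.2
    exact ⟨fun _ => d, .const d, fun c x _ => by simp [hd]⟩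
  | add p q hp hq =>
    obtain ⟨e, he, h1⟩ := hp
    obtain ⟨e', he', h2⟩ := hq
    exact ⟨fun c => add (e c) (e' c), computable_add.comp he he', fun c x hx => by
      rw [val_add, h1 c x hx, h2 c x hx, map_add, map_add]⟩
  | mul_X p i hp =>
    obtain ⟨e, he, h1⟩ := hp
    exact ⟨fun c => mul (e c) (look (ofNat 0) i c), computable_mul.comp he (computable_look _ i),
      fun c x hx => by rw [val_mul, h1 c x hx, ← hx]; simp⟩

/-- Codes allow ring operations but offer no direct division. The quotients are therefore guessed in
`hint` and checked by multiplication, together with the nonvanishing of the denominators. A guess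
becomes an existential quantifier, which semidecidability tolerates. -/
theorem exists_rational (hF : IsPresentation F s) {g : RationalData} (hg : g.Over F) :
    ∃ f : TapeCode (DiffCode V) × List (DiffCode V) → Option (TapeCode (DiffCode V)), Computable f ∧
      ∀ c x, Represents s c x →
        (∀ hint c', f (c, hint) = some c' → g.DefinedAt x ∧ Represents s c' (g.apply x)) ∧
        (g.DefinedAt x → ∃ hint c', f (c, hint) = some c') := by
  classical
  choose en hen hn using fun i => hF.exists_evaluator (hg i).1
  choose ed hed hd using fun i => hF.exists_evaluator (hg i).2
  let e : g.window → ℕ := fun i => g.window.equivFin i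
  obtain ⟨u, hu, hlook⟩ := TapeCode.exists_updater (ofNat 0 : DiffCode V) e Finset.univ.toList
  let ok : TapeCode (DiffCode V) × List (DiffCode V) → Prop := fun p => ∀ i,
    ¬ val s (ed i p.1) = val s (ofNat 0) ∧
      val s (mul (p.2.getD (e i) (ofNat 0)) (ed i p.1)) = val s (en i p.1)
  have hok : ComputablePred ok := by
    refine ComputablePred.forall_finite fun i => ?_
    have h1 : Computable fun p : TapeCode (DiffCode V) × List (DiffCode V) => ed i p.1 := (hed i).comp .fst
    have h2 : Computable fun p : TapeCode (DiffCode V) × List (DiffCode V) => en i p.1 := (hen i).comp .fst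
    have h3 : Computable fun p : TapeCode (DiffCode V) × List (DiffCode V) => p.2.getD (e i) (ofNat 0) :=
      (computable_getD (ofNat 0) (e i)).comp .snd
    have h4 : Computable fun p : TapeCode (DiffCode V) × List (DiffCode V) =>
        mul (p.2.getD (e i) (ofNat 0)) (ed i p.1) := computable_mul.comp h3 h1
    exact ((hF.computable_eq.comp (h1.pair (.const (ofNat 0)))).not).and
      (hF.computable_eq.comp (h4.pair h2))
  have hzero : val s (ofNat 0) = 0 := by simp
  refine ⟨fun p => if ok p then some (u p) else none,
    hok.ite' (Computable.option_some.comp hu) (.const none), fun c x hx => ⟨?_, ?_⟩⟩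
  · intro hint c' hc'
    simp only at hc'
    by_cases h : ok (c, hint)
    · rw [if_pos h, Option.some_inj] at hc'
      have hdef : g.DefinedAt x := fun i => by
        have := (h i).1
        rwa [hzero, hd i c x hx] at this
      refine ⟨hdef, fun j => ?_⟩
      rw [← hc', RationalData.apply_apply]
      split_ifs with hj
      · rw [(hlook (c, hint)).1 ⟨j, hj⟩ (by simp), div_eq_iff (hdef _), ← hd _ c x hx,
          ← hn _ c x hx, ← (h ⟨j, hj⟩).2, val_mul]
      · rw [(hlook (c, hint)).2 j fun i _ hi => hj (by rw [← hi]; exact i.2)]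
        exact hx j
    · rw [if_neg h] at hc'
      cases hc'
  · intro hdef
    -- A correct guess exists because a root-closed subring contains its inverses.
    have hq : ∀ i, ∃ q : DiffCode V, val s q = val s (en i c) / val s (ed i c) := fun i => by
      refine (hF.mem_iff _).mp ?_
      rw [div_eq_mul_inv]
      exact F.mul_mem (hF.val_mem _) (hF.rootClosed.inv_mem (hF.val_mem _))
    choose q hq using hq
    refine ⟨List.ofFn fun k => q (g.window.equivFin.symm k), _, if_pos fun i => ?_⟩
    have hne : val s (ed i c) ≠ 0 := by rw [hd i c x hx]; exact hdef i
    refine ⟨by rwa [hzero], ?_⟩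
    have : (List.ofFn fun k => q (g.window.equivFin.symm k)).getD (e i) (ofNat 0) = q i := by
      rw [List.getD_eq_getElem _ _ (by simp [e]), List.getElem_ofFn]
      simp [e]
    rw [val_mul, this, hq, div_mul_cancel₀ _ hne]

theorem exists_step (hF : IsPresentation F s) {K : Machine} (hK : ∀ v, (K.node v).Over F)
    (v : Fin K.size) :
    ∃ f : TapeCode (DiffCode V) × List (DiffCode V) → Option (Fin K.size × TapeCode (DiffCode V)), Computable f ∧
      ∀ c x, Represents s c x →
        (∀ hint w c', f (c, hint) = some (w, c') →
          ∃ x', Represents s c' x' ∧ K.Step (v, x) (w, x')) ∧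
        (∀ w x', K.Step (v, x) (w, x') →
          ∃ hint c', f (c, hint) = some (w, c') ∧ Represents s c' x') := by
  classical
  have hv := hK v
  rcases hnode : K.node v with ⟨g, w⟩ | ⟨g, w⟩ | ⟨h, w₀, w₁⟩ | w | w | g
  · refine ⟨fun _ => none, .const _, fun c x hx => ⟨by simp, fun w x' hs => ?_⟩⟩
    cases hs with
    | compute hv' => simp [hnode] at hv'
    | branch_zero hv' => simp [hnode] at hv'
    | branch_one hv' => simp [hnode] at hv'
    | shiftLeft hv' => simp [hnode] at hv'
    | shiftRight hv' => simp [hnode] at hv'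
  · rw [hnode] at hv
    obtain ⟨f, hf, h⟩ := hF.exists_rational (g := g) hv
    refine ⟨fun p => (f p).map fun c => (w, c),
      Computable.option_map hf (.pair (.const w) .snd), fun c x hx => ⟨?_, ?_⟩⟩
    · intro hint w' c' hc'
      obtain ⟨c₀, hc₀, heq⟩ := Option.map_eq_some_iff.mp hc'
      obtain ⟨rfl, rfl⟩ := Prod.mk.inj heq
      obtain ⟨h1, h2⟩ := (h c x hx).1 hint c₀ hc₀
      exact ⟨_, h2, .compute hnode h1⟩
    · intro w' x' hs
      cases hs with
      | compute hv' hdef =>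
        rw [hnode] at hv'
        injection hv' with e1 e2
        subst e1 e2
        obtain ⟨hint, c', hc'⟩ := (h c x hx).2 hdef
        exact ⟨hint, c', by simp [hc'], ((h c x hx).1 hint c' hc').2⟩
      | branch_zero hv' => simp [hnode] at hv'
      | branch_one hv' => simp [hnode] at hv'
      | shiftLeft hv' => simp [hnode] at hv'
      | shiftRight hv' => simp [hnode] at hv'
  · rw [hnode] at hv
    obtain ⟨e, he, h1⟩ := hF.exists_evaluator (h := h) hv
    have hzero : val s (ofNat 0) = 0 := by simp
    have hlt : ComputablePred fun p : TapeCode (DiffCode V) × List (DiffCode V) =>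
        val s (e p.1) < val s (ofNat 0) := hF.computable_lt.comp ((he.comp .fst).pair (.const _))
    refine ⟨fun p => if val s (e p.1) < val s (ofNat 0) then some (w₀, p.1) else some (w₁, p.1),
      hlt.ite' (Computable.option_some.comp (.pair (.const w₀) .fst))
        (Computable.option_some.comp (.pair (.const w₁) .fst)), fun c x hx => ⟨?_, ?_⟩⟩
    · intro hint w' c' hc'
      simp only at hc'
      split_ifs at hc' with hneg
      · obtain ⟨rfl, rfl⟩ := Prod.mk.inj (Option.some_inj.mp hc')
        rw [h1 c x hx, hzero] at hneg
        exact ⟨x, hx, .branch_zero hnode hneg⟩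
      · obtain ⟨rfl, rfl⟩ := Prod.mk.inj (Option.some_inj.mp hc')
        rw [h1 c x hx, hzero, not_lt] at hneg
        exact ⟨x, hx, .branch_one hnode hneg⟩
    · intro w' x' hs
      cases hs with
      | compute hv' => simp [hnode] at hv'
      | branch_zero hv' hneg =>
        rw [hnode] at hv'
        injection hv' with e1 e2 e3
        subst e1 e2 e3
        exact ⟨[], c, if_pos (by rwa [h1 c x hx, hzero]), hx⟩
      | branch_one hv' hneg =>
        rw [hnode] at hv'
        injection hv' with e1 e2 e3
        subst e1 e2 e3
        exact ⟨[], c, if_neg (by rwa [h1 c x hx, hzero, not_lt]), hx⟩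
      | shiftLeft hv' => simp [hnode] at hv'
      | shiftRight hv' => simp [hnode] at hv'
  · refine ⟨fun p => some (w, shiftL (ofNat 0) p.1), Computable.option_some.comp
      (.pair (.const w) ((computable_shiftL _).comp .fst)), fun c x hx => ?_⟩
    have hr : Represents s (shiftL (ofNat 0) c) (shiftBy 1 x) := fun i => by
      rw [shiftBy_apply, look_shiftL]; exact hx _
    refine ⟨fun hint w' c' hc' => ?_, fun w' x' hs => ?_⟩
    · obtain ⟨rfl, rfl⟩ := Prod.mk.inj (Option.some_inj.mp hc')
      exact ⟨_, hr, .shiftLeft hnode⟩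
    · cases hs with
      | compute hv' => simp [hnode] at hv'
      | branch_zero hv' => simp [hnode] at hv'
      | branch_one hv' => simp [hnode] at hv'
      | shiftLeft hv' =>
        rw [hnode] at hv'
        injection hv' with e1
        subst e1
        exact ⟨[], _, rfl, hr⟩
      | shiftRight hv' => simp [hnode] at hv'
  · refine ⟨fun p => some (w, shiftR (ofNat 0) p.1), Computable.option_some.comp
      (.pair (.const w) ((computable_shiftR _).comp .fst)), fun c x hx => ?_⟩
    have hr : Represents s (shiftR (ofNat 0) c) (shiftBy (-1) x) := fun i => by
      rw [shiftBy_apply, look_shiftR]; exact hx _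
    refine ⟨fun hint w' c' hc' => ?_, fun w' x' hs => ?_⟩
    · obtain ⟨rfl, rfl⟩ := Prod.mk.inj (Option.some_inj.mp hc')
      exact ⟨_, hr, .shiftRight hnode⟩
    · cases hs with
      | compute hv' => simp [hnode] at hv'
      | branch_zero hv' => simp [hnode] at hv'
      | branch_one hv' => simp [hnode] at hv'
      | shiftLeft hv' => simp [hnode] at hv'
      | shiftRight hv' =>
        rw [hnode] at hv'
        injection hv' with e1
        subst e1
        exact ⟨[], _, rfl, hr⟩
  · refine ⟨fun _ => none, .const _, fun c x hx => ⟨by simp, fun w x' hs => ?_⟩⟩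
    exact absurd hs (Machine.not_step_output hnode _)

/-- One guess is consumed per step, so the list of guesses also fixes the length of the run. A wrong
guess leads to `none` and stays there. -/
theorem exists_run (hF : IsPresentation F s) {K : Machine} (hK : ∀ v, (K.node v).Over F) :
    ∃ f : Option (Fin K.size × TapeCode (DiffCode V)) × List (List (DiffCode V)) →
        Option (Fin K.size × TapeCode (DiffCode V)), Computable f ∧
      (∀ l, f (none, l) = none) ∧
      ∀ v c x, Represents s c x →
        (∀ l w c', f (some (v, c), l) = some (w, c') →
          ∃ x', Represents s c' x' ∧ Relation.ReflTransGen K.Step (v, x) (w, x')) ∧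
        (∀ w x', Relation.ReflTransGen K.Step (v, x) (w, x') →
          ∃ l c', f (some (v, c), l) = some (w, c') ∧ Represents s c' x') := by
  choose f hf h using hF.exists_step hK
  let st : Option (Fin K.size × TapeCode (DiffCode V)) × List (DiffCode V) →
      Option (Fin K.size × TapeCode (DiffCode V)) := fun p => p.1.bind fun q => f q.1 (q.2, p.2)
  have hst : Computable st :=
    Computable.option_bind .fst ((Computable.finite_cases hf).comp
      (Computable.fst.comp .snd) (.pair (Computable.snd.comp .snd) (Computable.snd.comp .fst)))
  have hnone : ∀ l : List (List (DiffCode V)), l.foldl (fun o hint => st (o, hint)) none = none := by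
    intro l
    induction l with
    | nil => rfl
    | cons a l ih => exact ih
  refine ⟨fun p => p.2.foldl (fun o hint => st (o, hint)) p.1,
    Computable.list_foldl .snd .fst (h := fun _ q => st q) (hst.comp .snd), hnone,
    fun v c x hx => ⟨?_, ?_⟩⟩
  · intro l
    induction l generalizing v c x with
    | nil =>
      intro w c' hc'
      obtain ⟨rfl, rfl⟩ := Prod.mk.inj (Option.some_inj.mp hc')
      exact ⟨x, hx, .refl⟩
    | cons a l ih =>
      intro w c' hc'
      have hc'' : l.foldl (fun o hint => st (o, hint)) (f v (c, a)) = some (w, c') := hc'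
      rcases hfa : f v (c, a) with _ | ⟨w₁, c₁⟩
      · rw [hfa, hnone] at hc''
        cases hc''
      · rw [hfa] at hc''
        obtain ⟨x₁, hx₁, hs⟩ := (h v c x hx).1 a w₁ c₁ hfa
        obtain ⟨x', hx', hs'⟩ := ih w₁ c₁ x₁ hx₁ w c' hc''
        exact ⟨x', hx', .head hs hs'⟩
  · intro w x' hs
    have key : ∀ d, Relation.ReflTransGen K.Step (v, x) d → ∃ l c',
        List.foldl (fun o hint => st (o, hint)) (some (v, c)) l = some (d.1, c') ∧
          Represents s c' d.2 := by
      intro d hd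
      induction hd with
      | refl => exact ⟨[], c, rfl, hx⟩
      | tail _ hs ih =>
        obtain ⟨l, c₁, hl, hc₁⟩ := ih
        obtain ⟨hint, c', hc', hx'⟩ := (h _ c₁ _ hc₁).2 _ _ hs
        exact ⟨l ++ [hint], c', by rw [List.foldl_append, hl]; exact hc', hx'⟩
    exact key _ hs

end IsPresentation

end BSS

/-! ### Halting computations on coded inputs are semidecidable -/

section OptionPred

variable {α β : Type*} [Primcodable α] [Primcodable β]

theorem ComputablePred.exists_some {f : α → Option β} {p : α → β → Prop} (hf : Computable f)
    (hp : ComputablePred fun x : α × β => p x.1 x.2) :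
    ComputablePred fun a => ∃ b, f a = some b ∧ p a b := by
  classical
  obtain ⟨_, hp⟩ := hp
  have h1 : Computable fun a => ((f a).map fun b => decide (p a b)).getD false :=
    Computable.option_getD (Computable.option_map hf (hp.of_eq fun x => by congr)) (.const false)
  refine ⟨fun _ => Classical.dec _, h1.of_eq fun a => ?_⟩
  rcases h : f a with _ | b <;> simp [h]

theorem ComputablePred.finite_cases {ι : Type*} [Primcodable ι] [Finite ι] {p : ι → α → Prop}
    (hp : ∀ i, ComputablePred (p i)) : ComputablePred fun x : ι × α => p x.1 x.2 := by
  classical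
  have h : ∀ i, Computable fun a => decide (p i a) := fun i => by
    obtain ⟨_, h⟩ := hp i
    exact h.of_eq fun a => by congr
  exact ⟨fun _ => Classical.dec _, ((Computable.finite_cases h).comp .fst .snd).of_eq
    fun a => by congr⟩

end OptionPred

namespace BSS

open TapeCode DiffCode

/-- A one-letter answer is visible on three coordinates, so acceptance needs only three equality
tests. -/
theorem readOff_eq_singleton (x : Tape) (b : ℝ) :
    readOff x = [b] ↔ x 0 = 1 ∧ x (-1) ≠ 1 ∧ x 1 = b := by
  have hn := exists_ne_one x
  have hmem := Nat.sInf_mem hn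
  have hlt : ∀ m < sInf {n : ℕ | x (-(n : ℤ)) ≠ 1}, x (-(m : ℤ)) = 1 := fun m hm =>
    not_not.mp (Nat.notMem_of_lt_sInf hm)
  unfold readOff
  generalize sInf {n : ℕ | x (-(n : ℤ)) ≠ 1} = n at hmem hlt
  have h0 := hlt 0
  match n with
  | 0 => simp_all
  | 1 => simp_all
  | n + 2 =>
    have h1 := hlt 1 (by omega)
    simp only [List.range_succ_eq_map]
    simp_all

namespace IsPresentation

variable {F : Subring ℝ} {V : Type*} [Primcodable V] {s : V → ℝ}

theorem represents_embed (l : List (DiffCode V)) :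
    Represents s (l.map fun _ => ofNat 1, l) (embed (l.map (val s))) := by
  intro i
  rw [embed_apply, look]
  by_cases h1 : 1 ≤ i
  · rw [if_pos h1, if_pos h1, List.getD_eq_getElem?_getD, List.getD_eq_getElem?_getD,
      List.getElem?_map]
    rcases l[(i - 1).toNat]? with _ | a <;> simp
  · rw [if_neg h1, if_neg h1, List.getD_eq_getElem?_getD, List.getElem?_map, List.length_map]
    by_cases h2 : -(l.length : ℤ) < i
    · rw [if_pos h2, List.getElem?_eq_getElem (by omega)]
      simp
    · rw [if_neg h2, List.getElem?_eq_none (by omega)]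
      simp

theorem exists_accept (hF : IsPresentation F s) {K : Machine} (hK : ∀ v, (K.node v).Over F)
    (b : ℕ) (v : Fin K.size) :
    ∃ q : TapeCode (DiffCode V) × List (DiffCode V) → Prop, ComputablePred q ∧
      ∀ c x, Represents s c x →
        ((∃ hint, q (c, hint)) ↔
          ∃ g, K.node v = Node.output g ∧ [(b : ℝ)] = readOff (g.apply x)) := by
  by_cases hnode : ∃ g, K.node v = Node.output g
  · obtain ⟨g, hg⟩ := hnode
    have hv := hK v
    rw [hg] at hv
    obtain ⟨f, hf, h⟩ := hF.exists_rational (g := g.toRational) hv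
    let r : TapeCode (DiffCode V) → Prop := fun c => val s (look (ofNat 0) 0 c) = val s (ofNat 1) ∧
      ¬ val s (look (ofNat 0) (-1) c) = val s (ofNat 1) ∧
      val s (look (ofNat 0) 1 c) = val s (ofNat b)
    have heq (i : ℤ) (n : ℕ) : ComputablePred fun c : TapeCode (DiffCode V) =>
        val s (look (ofNat 0) i c) = val s (ofNat n) :=
      hF.computable_eq.comp (f := fun c : TapeCode (DiffCode V) => (look (ofNat 0) i c, ofNat n))
        ((computable_look _ i).pair (.const _))
    have hr : ComputablePred r := (heq 0 1).and ((heq (-1) 1).not.and (heq 1 b))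
    have hiff : ∀ c x, Represents s c x → (r c ↔ [(b : ℝ)] = readOff x) := fun c x hx => by
      rw [eq_comm, readOff_eq_singleton, hx, hx, hx]
      simp [r]
    refine ⟨fun p => ∃ c, f p = some c ∧ r c, ComputablePred.exists_some (p := fun _ c => r c) hf
      (hr.comp .snd), fun c x hx => ⟨?_, ?_⟩⟩
    · rintro ⟨hint, c', hc', hr'⟩
      have := ((h c x hx).1 hint c' hc').2
      rw [LinearData.toRational_apply] at this
      exact ⟨g, hg, (hiff _ _ this).mp hr'⟩
    · rintro ⟨g', hg', hb⟩
      rw [hg] at hg'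
      injection hg' with e
      subst e
      obtain ⟨hint, c', hc'⟩ := (h c x hx).2 (LinearData.toRational_definedAt _ _)
      have := ((h c x hx).1 hint c' hc').2
      rw [LinearData.toRational_apply] at this
      exact ⟨hint, c', hc', (hiff _ _ this).mpr hb⟩
  · refine ⟨fun _ => False, ⟨fun _ => .isFalse id, (Computable.const false).of_eq fun a => by simp⟩,
      fun c x _ => ⟨fun ⟨_, h⟩ => h.elim, fun ⟨g, hg, _⟩ => (hnode ⟨g, hg⟩).elim⟩⟩

theorem computes_re (hF : IsPresentation F s) {K : Machine} (hK : ∀ v, (K.node v).Over F)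
    (b : ℕ) : REPred fun l : List (DiffCode V) => K.Computes (l.map (val s)) [(b : ℝ)] := by
  have hs := hK K.start
  rw [K.node_start] at hs
  obtain ⟨f, hf, h⟩ := hF.exists_rational (g := K.startMap.toRational) hs
  obtain ⟨r, hr, -, hrun⟩ := hF.exists_run hK
  choose q hq hacc using hF.exists_accept hK b
  let H := List (DiffCode V)
  -- The three components of `t` are the guesses for the input map, the run and the output map.
  let p : H → H × List H × H → Prop := fun l t =>
    ∃ c, f ((l.map fun _ => ofNat 1, l), t.1) = some c ∧
      ∃ d, r (some (K.startNext, c), t.2.1) = some d ∧ q d.1 (d.2, t.2.2)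
  have hp : ComputablePred fun x : H × (H × List H × H) => p x.1 x.2 := by
    have h1 : Computable fun x : H × (H × List H × H) =>
        (((x.1.map fun _ => ofNat 1, x.1), x.2.1) : TapeCode (DiffCode V) × H) :=
      .pair (.pair (Computable.list_map .fst (Computable.const (ofNat 1))) .fst)
        (Computable.fst.comp .snd)
    have h2 : Computable fun y : (H × (H × List H × H)) × TapeCode (DiffCode V) =>
        ((some (K.startNext, y.2), y.1.2.2.1) : Option (Fin K.size × TapeCode (DiffCode V)) ×
          List H) :=
      .pair (Computable.option_some.comp (.pair (.const _) .snd))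
        (Computable.fst.comp (Computable.snd.comp (Computable.snd.comp .fst)))
    have h3 : Computable fun y : ((H × (H × List H × H)) × TapeCode (DiffCode V)) ×
          (Fin K.size × TapeCode (DiffCode V)) =>
        ((y.2.1, (y.2.2, y.1.1.2.2.2)) : Fin K.size × TapeCode (DiffCode V) × H) :=
      .pair (Computable.fst.comp .snd) (.pair (Computable.snd.comp .snd)
        (Computable.snd.comp (Computable.snd.comp (Computable.snd.comp
          (Computable.fst.comp .fst)))))
    have h4 := (ComputablePred.finite_cases hq).comp h3
    have h5 := ComputablePred.exists_some (hr.comp h2)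
      (p := fun y d => q d.1 (d.2, y.1.2.2.2)) h4
    exact ComputablePred.exists_some (hf.comp h1)
      (p := fun x c => ∃ d, r (some (K.startNext, c), x.2.2.1) = some d ∧
        q d.1 (d.2, x.2.2.2)) h5
  refine (ComputablePred.exists_re hp).of_eq fun l => ?_
  have hl := represents_embed (s := s) l
  constructor
  · rintro ⟨t, c, hc, ⟨v, c'⟩, hd, hq'⟩
    have hc' := ((h _ _ hl).1 _ _ hc).2
    rw [LinearData.toRational_apply] at hc'
    obtain ⟨x, hx, hsteps⟩ := (hrun K.startNext c _ hc').1 _ _ _ hd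
    obtain ⟨g, hg, hb⟩ := (hacc v c' x hx).mp ⟨_, hq'⟩
    exact ⟨v, x, g, hsteps, hg, hb⟩
  · rintro ⟨v, x, g, hsteps, hg, hb⟩
    obtain ⟨t₀, c, hc⟩ := (h _ _ hl).2 (LinearData.toRational_definedAt _ _)
    have hc' := ((h _ _ hl).1 _ _ hc).2
    rw [LinearData.toRational_apply] at hc'
    obtain ⟨t₁, c', hd, hx⟩ := (hrun K.startNext c _ hc').2 _ _ hsteps
    obtain ⟨t₂, hq'⟩ := (hacc v c' x hx).mpr ⟨g, hg, hb⟩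
    exact ⟨(t₀, t₁, t₂), c, hc, (v, c'), hd, hq'⟩

/-- A deciding machine answers `1` or `0` on every input. Both answers are semidecidable on codes,
so Post's theorem applies. -/
theorem decides_computablePred (hF : IsPresentation F s) {K : Machine}
    (hK : ∀ v, (K.node v).Over F) {A : Set (List ℝ)} (hA : K.Decides A) :
    ComputablePred fun l : List (DiffCode V) => l.map (val s) ∈ A := by
  refine ComputablePred.of_re_re ((hF.computes_re hK 1).of_eq fun l => ?_) (hF.computes_re hK 0)
    fun l => ?_
  · rw [hA.mem_iff, Nat.cast_one]
  · rw [hA.notMem_iff, Nat.cast_zero]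

end IsPresentation

end BSS

/-! ### Transfer of atomic diagrams to sets of natural numbers -/

namespace Diagram

section Holds

variable {L : Language} {M N : Type*} [L.Structure M] [L.Structure N]

theorem Atom.holds_relabel (f : M ↪[L] N) (A : Atom L M) : (A.relabel f).Holds ↔ A.Holds := by
  have h : ∀ t : L.Term M, (t.relabel f).realize id = f (t.realize id) := fun t => by
    rw [Language.Term.realize_relabel, ← Language.HomClass.realize_term]
    rfl
  cases A with
  | eq s t => simp only [Atom.relabel, Atom.Holds, h, f.injective.eq_iff]
  | rel R ts =>
    simp only [Atom.relabel, Atom.Holds, h]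
    exact f.map_rel R fun i => (ts i).realize id

end Holds

variable {L : Language} [Encodable (Σ n, L.Functions n)] [Encodable (Σ n, L.Relations n)]
variable {M N X Y : Type*} [L.Structure M] [L.Structure N]

/-- Membership is reduced to the other diagram symbol by symbol. Whether the symbols form a sentence
need not be checked separately, since unique readability on the other side recovers it. -/
theorem mem_atomicDiagram_iff_of_equiv (E : M ≃[L] N) {num : ℕ → X} {el : M → List X}
    (hnum : Function.Injective num) (hel : Function.Injective el) {num' : ℕ → Y}
    {el' : N → List Y} (w : List Y) :
    w ∈ atomicDiagram L num' el' ↔ ∃ (b r : ℕ) (ts : List (ℕ ⊕ N)),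
      w = num' b :: num' r :: ts.flatMap (tokenCode num' el') ∧
      num b :: num r :: (ts.map (Sum.map id E.symm)).flatMap (tokenCode num el) ∈
        atomicDiagram L num el := by
  constructor
  · rintro ⟨B, hB⟩
    have hc : (B.relabel E.symm).code num el =
        num B.head :: (B.tokens.map (Sum.map id E.symm)).flatMap (tokenCode num el) := by
      rw [Atom.code_eq, Atom.head_relabel, Atom.tokens_relabel]
    have hh : (B.relabel E.symm).Holds ↔ B.Holds := Atom.holds_relabel E.symm.toEmbedding B
    rcases hB with ⟨hB, rfl⟩ | ⟨hB, rfl⟩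
    · exact ⟨1, B.head, B.tokens, by rw [Atom.code_eq], B.relabel E.symm,
        Or.inl ⟨hh.mpr hB, by rw [hc]⟩⟩
    · exact ⟨0, B.head, B.tokens, by rw [Atom.code_eq], B.relabel E.symm,
        Or.inr ⟨hh.not.mpr hB, by rw [hc]⟩⟩
  · rintro ⟨b, r, ts, rfl, A, hA⟩
    have hh : (A.relabel E).Holds ↔ A.Holds := Atom.holds_relabel E.toEmbedding A
    have hc : ∀ b', num b :: num r ::
        (ts.map (Sum.map id E.symm)).flatMap (tokenCode num el) = num b' :: A.code num el →
        num' b :: num' r :: ts.flatMap (tokenCode num' el') =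
          num' b' :: (A.relabel E).code num' el' := by
      intro b' h
      rw [Atom.code_eq, List.cons.injEq, List.cons.injEq, hnum.eq_iff, hnum.eq_iff] at h
      obtain ⟨rfl, rfl, h⟩ := h
      have := flatMap_tokenCode_injective hnum hel h
      rw [Atom.code_eq, Atom.head_relabel, Atom.tokens_relabel, ← this, List.map_map,
        Sum.map_comp_map, Function.id_comp]
      have hid : (E : M → N) ∘ E.symm = id := funext E.apply_symm_apply
      rw [hid, Sum.map_id_id, List.map_id]
    rcases hA with ⟨hA, h⟩ | ⟨hA, h⟩
    · exact ⟨A.relabel E, Or.inl ⟨hh.mpr hA, hc _ h⟩⟩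
    · exact ⟨A.relabel E, Or.inr ⟨hh.not.mpr hA, hc _ h⟩⟩

/-- If the letters of the word force every element mentioned to lie in `A`, the sentence is one
about `A`, and truth of atomic sentences is absolute. -/
theorem mem_atomicDiagram_substructure_iff (A : L.Substructure M) {num : ℕ → X}
    {el : M → List X} {w : List X}
    (hw : ∀ a, (∀ x ∈ el a, x ∈ w) → a ∈ A) :
    w ∈ atomicDiagram L num (fun a : A => el a) ↔ w ∈ atomicDiagram L num el := by
  have hc : ∀ B : Atom L A, (B.relabel A.subtype).code num el = B.code num fun a : A => el a := by
    intro B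
    rw [Atom.code_eq, Atom.code_eq, Atom.head_relabel, Atom.tokens_relabel, List.flatMap_map]
    congr 2
    funext a
    rcases a with a | a <;> rfl
  constructor
  · rintro ⟨B, hB⟩
    refine ⟨B.relabel A.subtype, ?_⟩
    rwa [hc, Atom.holds_relabel]
  · rintro ⟨B, hB⟩
    obtain ⟨B, rfl⟩ := B.exists_relabel A.subtype fun a ha => by
      refine ⟨⟨a, hw a fun x hx => ?_⟩, rfl⟩
      have h : x ∈ B.code num el := by
        rw [Atom.code_eq]
        exact List.mem_cons_of_mem _ (List.mem_flatMap.mpr ⟨_, ha, by simp [tokenCode, hx]⟩)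
      rcases hB with ⟨-, rfl⟩ | ⟨-, rfl⟩ <;> exact List.mem_cons_of_mem _ h
    refine ⟨B, ?_⟩
    rwa [hc, Atom.holds_relabel] at hB

/-! ### Parsing of words of natural numbers. -/

/-- The step of the decomposition of a word into symbols; the first component of the state is the
number of letters that are missing from an element. -/
def parseStep (p : ℕ × List (ℕ ⊕ ℕ)) (n : ℕ) : ℕ × List (ℕ ⊕ ℕ) :=
  -- A zero announces two more letters, the length and the element. The length is always `1` in a
  -- genuine code and is skipped unread.
  if p.1 = 0 then if n = 0 then (2, p.2) else (0, p.2 ++ [Sum.inl (n - 1)])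
  else if p.1 = 1 then (0, p.2 ++ [Sum.inr n]) else (1, p.2)

/-- The decomposition of a word into symbols. -/
def parse (w : List ℕ) : List (ℕ ⊕ ℕ) := (w.foldl parseStep (0, [])).2

theorem parse_flatMap (ts : List (ℕ ⊕ ℕ)) :
    parse (ts.flatMap (tokenCode id fun a : ℕ => [a])) = ts := by
  have : ∀ acc, (ts.flatMap (tokenCode id fun a : ℕ => [a])).foldl parseStep (0, acc) =
      (0, acc ++ ts) := by
    induction ts with
    | nil => simp
    | cons t ts ih =>
      intro acc
      rw [List.flatMap_cons, List.foldl_append]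
      rcases t with k | a <;> simp [tokenCode, parseStep, ih]
  rw [parse, this, List.nil_append]

theorem computable_parse : Computable parse := by
  have h1 : Computable fun x : (ℕ × List (ℕ ⊕ ℕ)) × ℕ => x.1.2 ++ [Sum.inl (x.2 - 1)] :=
    Computable.list_append.comp (Computable.snd.comp .fst) (Computable.list_cons.comp
      (Computable.sumInl.comp (Primrec.pred.to_comp.comp .snd)) (.const []))
  have h2 : Computable fun x : (ℕ × List (ℕ ⊕ ℕ)) × ℕ => x.1.2 ++ [Sum.inr x.2] :=
    Computable.list_append.comp (Computable.snd.comp .fst) (Computable.list_cons.comp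
      (Computable.sumInr.comp .snd) (.const []))
  have h3 : Computable fun x : (ℕ × List (ℕ ⊕ ℕ)) × ℕ => x.1.2 := Computable.snd.comp .fst
  have h4 (k : ℕ) : ComputablePred fun x : (ℕ × List (ℕ ⊕ ℕ)) × ℕ => x.1.1 = k :=
    ComputablePred.eq (Computable.fst.comp .fst) (.const k)
  have h5 : ComputablePred fun x : (ℕ × List (ℕ ⊕ ℕ)) × ℕ => x.2 = 0 :=
    ComputablePred.eq .snd (.const 0)
  have h6 : Computable fun x : (ℕ × List (ℕ ⊕ ℕ)) × ℕ => parseStep x.1 x.2 :=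
    (h4 0).ite' (h5.ite' (.pair (.const 2) h3) (.pair (.const 0) h1))
      ((h4 1).ite' (.pair (.const 0) h2) (.pair (.const 1) h3))
  exact Computable.snd.comp (Computable.list_foldl .id (.const (0, []))
    (h := fun _ x => parseStep x.1 x.2) (h6.comp .snd))

theorem computable_tokenCode : Computable (tokenCode (id : ℕ → ℕ) fun a : ℕ => [a]) := by
  have h1 : Computable fun x : (ℕ ⊕ ℕ) × ℕ => [x.2 + 1] :=
    Computable.list_cons.comp (Computable.succ.comp .snd) (.const [])
  have h2 : Computable fun x : (ℕ ⊕ ℕ) × ℕ => [0, 1, x.2] :=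
    Computable.list_cons.comp (.const 0) (Computable.list_cons.comp (.const 1)
      (Computable.list_cons.comp .snd (.const [])))
  refine (Computable.sumCasesOn (f := fun x : ℕ ⊕ ℕ => x) (g := fun _ k => [k + 1])
    (h := fun _ a => [0, 1, a]) .id h1 h2).of_eq fun x => ?_
  rcases x with k | a <;> rfl

section Transfer

variable {β : Type*} [Primcodable β] {θ : β → X}

theorem computablePred_map_eq (heq : ComputablePred fun p : β × β => θ p.1 = θ p.2) :
    ComputablePred fun p : List β × List β => p.1.map θ = p.2.map θ := by
  have h1 : ComputablePred fun p : List β × List β => p.1.length = p.2.length :=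
    ComputablePred.eq (Computable.list_length.comp .fst) (Computable.list_length.comp .snd)
  have h2 : Computable fun x : (List β × List β) × ℕ => x.1.1[x.2]? :=
    Computable.list_getElem?.comp (Computable.fst.comp .fst) .snd
  have h3 : Computable fun x : ((List β × List β) × ℕ) × β => x.1.1.2[x.1.2]? :=
    Computable.list_getElem?.comp (Computable.snd.comp (Computable.fst.comp .fst))
      (Computable.snd.comp .fst)
  have h4 : Computable fun x : (((List β × List β) × ℕ) × β) × β => (x.1.2, x.2) :=
    .pair (Computable.snd.comp .fst) .snd
  have h5 := ComputablePred.exists_some h3 (p := fun x b => θ x.2 = θ b) (heq.comp h4)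
  have h6 := ComputablePred.exists_some h2
    (p := fun x a => ∃ b, x.1.2[x.2]? = some b ∧ θ a = θ b) h5
  have h7 : Computable fun p : List β × List β => List.range p.1.length :=
    Primrec.list_range.to_comp.comp (Computable.list_length.comp .fst)
  refine (h1.and (ComputablePred.forall_mem h7
    (p := fun x i => ∃ a, x.1[i]? = some a ∧ ∃ b, x.2[i]? = some b ∧ θ a = θ b) h6)).of_eq
    fun p => ?_
  obtain ⟨l, l'⟩ := p
  constructor
  · rintro ⟨hlen, h⟩
    refine List.ext_getElem (by simpa using hlen) fun i hi hi' => ?_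
    rw [List.length_map] at hi hi'
    obtain ⟨a, ha, b, hb, hab⟩ := h i (List.mem_range.mpr hi)
    simp only [List.getElem?_eq_getElem hi, List.getElem?_eq_getElem hi', Option.some_inj] at ha hb
    rw [List.getElem_map, List.getElem_map, ha, hb, hab]
  · intro h
    have hlen : l.length = l'.length := by simpa using congrArg List.length h
    refine ⟨hlen, fun i hi => ?_⟩
    have hi := List.mem_range.mp hi
    refine ⟨l[i], List.getElem?_eq_getElem hi, l'[i]'(hlen ▸ hi), List.getElem?_eq_getElem _, ?_⟩
    have := List.getElem_of_eq h (i := i) (by simpa using hi)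
    simpa using this

variable {num : ℕ → X} {ofNat : ℕ → β} {el : M → List X}

theorem computablePred_map_mem_range (hnum : Function.Injective num) (hof : Computable ofNat)
    (hθ : ∀ n, θ (ofNat n) = num n)
    (hdiag : ComputablePred fun l : List β => l.map θ ∈ atomicDiagram L num el) :
    ComputablePred fun l : List β => l.map θ ∈ Set.range el := by
  have h1 : Computable fun l : List β => ofNat l.length := hof.comp Computable.list_length
  have h2 : Computable fun l : List β => ofNat 0 :: ofNat l.length :: l :=
    Computable.list_cons.comp (.const _) (Computable.list_cons.comp h1 .id)
  have h3 : Computable fun l : List β =>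
      ofNat 1 :: ofNat 0 :: ofNat 0 :: ofNat l.length :: (l ++ ofNat 0 :: ofNat l.length :: l) :=
    Computable.list_cons.comp (.const _) (Computable.list_cons.comp (.const _)
      (Computable.list_cons.comp (.const _) (Computable.list_cons.comp h1
        (Computable.list_append.comp .id h2))))
  refine (hdiag.comp h3).of_eq fun l => ?_
  have h4 : (ofNat 1 :: ofNat 0 :: ofNat 0 :: ofNat l.length ::
      (l ++ ofNat 0 :: ofNat l.length :: l)).map θ = num 1 :: num 0 :: num 0 ::
        num (l.map θ).length :: l.map θ ++ num 0 :: num (l.map θ).length :: l.map θ := by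
    simp [hθ]
  rw [h4]
  exact ⟨mem_range_of_mem_atomicDiagram hnum, mem_atomicDiagram_of_mem_range⟩

/-- The translation of a symbol whose elements are given by numbers of words. -/
def translate (ofNat : ℕ → β) : ℕ ⊕ ℕ → List β :=
  tokenCode ofNat fun n => (Encodable.decode (α := List β) n).getD []

theorem computable_translate (hof : Computable ofNat) : Computable (translate ofNat) := by
  have h1 : Computable fun x : (ℕ ⊕ ℕ) × ℕ => [ofNat (x.2 + 1)] :=
    Computable.list_cons.comp (hof.comp (Computable.succ.comp .snd)) (.const [])
  have h2 : Computable fun x : (ℕ ⊕ ℕ) × ℕ => (Encodable.decode (α := List β) x.2).getD [] :=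
    Computable.option_getD (Computable.decode.comp .snd) (.const [])
  have h3 : Computable fun x : (ℕ ⊕ ℕ) × ℕ =>
      ofNat 0 :: ofNat ((Encodable.decode (α := List β) x.2).getD []).length ::
        (Encodable.decode (α := List β) x.2).getD [] :=
    Computable.list_cons.comp (.const _) (Computable.list_cons.comp
      (hof.comp (Computable.list_length.comp h2)) h2)
  refine (Computable.sumCasesOn (f := fun x : ℕ ⊕ ℕ => x) (g := fun _ k => [ofNat (k + 1)])
    (h := fun _ n => ofNat 0 :: ofNat ((Encodable.decode (α := List β) n).getD []).length ::
        (Encodable.decode (α := List β) n).getD []) .id h1 h3).of_eq fun x => ?_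
  rcases x with k | a <;> rfl

/-- A structure whose elements are words, with a decidable presentation of the letters in which
the atomic diagram is decidable, is isomorphic to a computable structure. -/
theorem exists_isComputableStructure (hnum : Function.Injective num) (hof : Computable ofNat)
    (hθ : ∀ n, θ (ofNat n) = num n) (heq : ComputablePred fun p : β × β => θ p.1 = θ p.2)
    (hel : Function.Injective el) (hsurj : ∀ a, ∃ l : List β, l.map θ = el a)
    (hdiag : ComputablePred fun l : List β => l.map θ ∈ atomicDiagram L num el) :
    ∃ (D : Set ℕ) (_ : L.Structure D), IsComputableStructure L D ∧ Nonempty (M ≃[L] D) := by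
  classical
  have hex : ∀ a : M, ∃ n : ℕ, ∃ l : List β, Encodable.decode n = some l ∧ l.map θ = el a :=
    fun a => by
      obtain ⟨l, hl⟩ := hsurj a
      exact ⟨Encodable.encode l, l, Encodable.encodek l, hl⟩
  -- An element of `M` may be represented by many words of codes. Its least one makes the numbering
  -- injective, and leastness is decidable because equality of represented words is.
  let e : M → ℕ := fun a => Nat.find (hex a)
  have he : ∀ a, ∃ l : List β, Encodable.decode (e a) = some l ∧ l.map θ = el a :=
    fun a => Nat.find_spec (hex a)
  have hinj : Function.Injective e := fun a b hab => by
    obtain ⟨l, hl, h1⟩ := he a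
    obtain ⟨l', hl', h2⟩ := he b
    rw [hab, hl', Option.some_inj] at hl
    exact hel (by rw [← h1, ← h2, hl])
  have hmem : ∀ n, n ∈ Set.range e ↔ ∃ l : List β, Encodable.decode n = some l ∧
      (l.map θ ∈ Set.range el ∧ ∀ m ∈ List.range n,
        ¬ ∃ l' : List β, Encodable.decode m = some l' ∧ l'.map θ = l.map θ) := by
    intro n
    constructor
    · rintro ⟨a, rfl⟩
      obtain ⟨l, hl, h1⟩ := he a
      refine ⟨l, hl, ⟨a, h1.symm⟩, fun m hm ⟨l', hl', h2⟩ => ?_⟩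
      exact Nat.find_min (hex a) (List.mem_range.mp hm) ⟨l', hl', h2.trans h1⟩
    · rintro ⟨l, hl, ⟨a, ha⟩, hmin⟩
      refine ⟨a, (Nat.find_eq_iff _).mpr ⟨⟨l, hl, ha.symm⟩, fun m hm ⟨l', hl', h2⟩ => ?_⟩⟩
      exact hmin m (List.mem_range.mpr hm) ⟨l', hl', h2.trans ha⟩
  have hD : ComputablePred fun n => n ∈ Set.range e := by
    have h1 : Computable fun x : (ℕ × List β) × ℕ => Encodable.decode (α := List β) x.2 :=
      Computable.decode.comp .snd
    have h2 : Computable fun x : ((ℕ × List β) × ℕ) × List β => (x.2, x.1.1.2) :=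
      .pair .snd (Computable.snd.comp (Computable.fst.comp .fst))
    have h3 := (ComputablePred.exists_some h1 (p := fun x l' => l'.map θ = x.1.2.map θ)
      ((computablePred_map_eq heq).comp h2)).not
    have h4 : Computable fun x : ℕ × List β => List.range x.1 :=
      Primrec.list_range.to_comp.comp .fst
    have h5 := ComputablePred.forall_mem h4 (p := fun x m => ¬ ∃ l' : List β,
      Encodable.decode m = some l' ∧ l'.map θ = x.2.map θ) h3
    have h6 : ComputablePred fun x : ℕ × List β => x.2.map θ ∈ Set.range el :=
      (computablePred_map_mem_range hnum hof hθ hdiag).comp (f := fun x : ℕ × List β => x.2) .snd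
    exact (ComputablePred.exists_some (f := fun n => Encodable.decode (α := List β) n)
      Computable.decode (p := fun n l => l.map θ ∈ Set.range el ∧ ∀ m ∈ List.range n,
        ¬ ∃ l' : List β, Encodable.decode m = some l' ∧ l'.map θ = l.map θ) (h6.and h5)).of_eq
      fun n => (hmem n).symm
  let E₀ : M ≃ Set.range e := Equiv.ofInjective e hinj
  let _ : L.Structure (Set.range e) := E₀.inducedStructure
  let E : M ≃[L] Set.range e := E₀.inducedStructureEquiv
  -- For numbers in the range of `e` decoding succeeds, so the default word in `translate` plays no
  -- part.
  have htr : ∀ ts : List (ℕ ⊕ Set.range e), ((ts.map (Sum.map id Subtype.val)).flatMap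
      (translate ofNat)).map θ = (ts.map (Sum.map id E.symm)).flatMap (tokenCode num el) := by
    intro ts
    rw [List.map_flatMap, List.flatMap_map, List.flatMap_map]
    congr 1
    funext t
    rcases t with k | d
    · simp [translate, tokenCode, hθ]
    · obtain ⟨a, rfl⟩ := E.surjective d
      obtain ⟨l, hl, h1⟩ := he a
      have h2 : ((E a : Set.range e) : ℕ) = e a := rfl
      simp [translate, tokenCode, hθ, h2, hl, ← h1]
  have hcode : ∀ ts : List (ℕ ⊕ Set.range e), ts.flatMap
      (tokenCode id fun d : Set.range e => [(d : ℕ)]) =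
        (ts.map (Sum.map id Subtype.val)).flatMap (tokenCode id fun n : ℕ => [n]) := by
    intro ts
    rw [List.flatMap_map]
    congr 1
    funext t
    rcases t with k | d <;> rfl
  refine ⟨Set.range e, inferInstance, ?_, ⟨E⟩⟩
  have hhead (k : ℕ) : Computable fun w : List ℕ => w.getD k 0 := TapeCode.computable_getD 0 k
  have hts : Computable fun w : List ℕ => parse w.tail.tail :=
    computable_parse.comp (Primrec.list_tail.to_comp.comp Primrec.list_tail.to_comp)
  have hfm : Computable fun w : List ℕ =>
      (parse w.tail.tail).flatMap (tokenCode (id : ℕ → ℕ) fun n : ℕ => [n]) :=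
    Computable.list_flatMap hts (computable_tokenCode.comp .snd)
  have htm : Computable fun w : List ℕ => (parse w.tail.tail).flatMap (translate ofNat) :=
    Computable.list_flatMap hts ((computable_translate hof).comp .snd)
  -- The parser accepts every word. Encoding its result again and comparing with `w` rejects the
  -- malformed ones.
  have hwf : ComputablePred fun w : List ℕ => w = w.getD 0 0 :: w.getD 1 0 ::
      (parse w.tail.tail).flatMap (tokenCode (id : ℕ → ℕ) fun n : ℕ => [n]) :=
    ComputablePred.eq .id (Computable.list_cons.comp (hhead 0)
      (Computable.list_cons.comp (hhead 1) hfm))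
  have helt : ComputablePred fun t : ℕ ⊕ ℕ => ∀ n, t = Sum.inr n → n ∈ Set.range e := by
    obtain ⟨_, hD⟩ := hD
    have h1 : Computable fun x : (ℕ ⊕ ℕ) × ℕ => decide (x.2 ∈ Set.range e) := hD.comp .snd
    refine ⟨fun _ => Classical.dec _, (Computable.sumCasesOn (f := fun x : ℕ ⊕ ℕ => x)
      (g := fun _ _ => true) (h := fun _ n => decide (n ∈ Set.range e)) .id (.const true)
        h1).of_eq fun x => ?_⟩
    rcases x with k | n <;> simp
  have hall : ComputablePred fun w : List ℕ => ∀ t ∈ parse w.tail.tail,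
      ∀ n, t = Sum.inr n → n ∈ Set.range e :=
    ComputablePred.forall_mem hts (p := fun _ t => ∀ n, t = Sum.inr n → n ∈ Set.range e)
      (helt.comp (f := fun x : List ℕ × (ℕ ⊕ ℕ) => x.2) .snd)
  have htrans : ComputablePred fun w : List ℕ => (ofNat (w.getD 0 0) :: ofNat (w.getD 1 0) ::
      (parse w.tail.tail).flatMap (translate ofNat)).map θ ∈ atomicDiagram L num el :=
    hdiag.comp (f := fun w : List ℕ => ofNat (w.getD 0 0) :: ofNat (w.getD 1 0) ::
      (parse w.tail.tail).flatMap (translate ofNat))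
      (Computable.list_cons.comp (hof.comp (hhead 0))
        (Computable.list_cons.comp (hof.comp (hhead 1)) htm))
  refine (hwf.and (hall.and htrans)).of_eq fun w => ?_
  rw [mem_atomicDiagram_iff_of_equiv E hnum hel]
  constructor
  · rintro ⟨hw, hel, hd⟩
    obtain ⟨ts, hts⟩ : ∃ ts : List (ℕ ⊕ Set.range e),
        ts.map (Sum.map id Subtype.val) = parse w.tail.tail := by
      have : parse w.tail.tail ∈
          Set.range (List.map (Sum.map id Subtype.val : ℕ ⊕ Set.range e → ℕ ⊕ ℕ)) := by
        rw [Set.range_list_map]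
        rintro (k | n) ht
        · exact ⟨Sum.inl k, rfl⟩
        · exact ⟨Sum.inr ⟨n, hel _ ht n rfl⟩, rfl⟩
      exact this
    refine ⟨w.getD 0 0, w.getD 1 0, ts, by rw [hcode, hts]; exact hw, ?_⟩
    rwa [← htr, hts, ← hθ, ← hθ, ← List.map_cons, ← List.map_cons]
  · rintro ⟨b, r, ts, rfl, hd⟩
    have hp : parse (ts.flatMap (tokenCode id fun d : Set.range e => [(d : ℕ)])) =
        ts.map (Sum.map id Subtype.val) := by rw [hcode, parse_flatMap]
    refine ⟨?_, ?_, ?_⟩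
    · simp only [List.tail_cons, hcode, parse_flatMap]
      rfl
    · simp only [List.tail_cons, hp]
      intro t ht n htn
      obtain ⟨d, -, hd⟩ := List.mem_map.mp ht
      rcases d with k | d
      · simp [← hd] at htn
      · rw [← hd] at htn
        simp only [Sum.map_inr, Sum.inr.injEq] at htn
        rw [← htn]
        exact d.2
    · simp only [List.tail_cons, hp, List.map_cons, htr, hθ]
      exact hd

end Transfer

end Diagram

/-! ### The main theorem -/

theorem DiffCode.computable_ofNat {V : Type*} [Primcodable V] :
    Computable (DiffCode.ofNat (V := V)) := by
  have h : Computable fun n : ℕ => (List.range n).map fun _ => ([] : List V) :=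
    Computable.list_map Primrec.list_range.to_comp (Computable.const [])
  have h' : Computable fun n : ℕ =>
      (((List.range n).map fun _ => ([] : List V)), ([] : PolyCode V)) := h.pair (.const [])
  exact h'.of_eq fun n => by simp [DiffCode.ofNat]

namespace BSS

/-- The real numbers that describe the map associated with a node, up to zeros. -/
theorem Node.exists_finset_over {k : ℕ} (v : Node k) (hv : v.HasComputableParameters) :
    ∃ S : Finset ℝ, (∀ x ∈ S, IsComputableReal x) ∧
      ∀ F : Subring ℝ, (∀ x ∈ S, x ∈ F) → v.Over F := by
  classical
  have linear : ∀ g : LinearData, (∀ i j, IsComputableReal (g.mat i j)) →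
      ∃ S : Finset ℝ, (∀ x ∈ S, IsComputableReal x) ∧
        ∀ F : Subring ℝ, (∀ x ∈ S, x ∈ F) → g.toRational.Over F := fun g hg => by
    refine ⟨Finset.univ.image fun p : g.window × g.window => g.mat p.1 p.2, fun x hx => ?_,
      fun F hF => LinearData.toRational_over fun i j =>
        hF _ (Finset.mem_image.mpr ⟨(i, j), Finset.mem_univ _, rfl⟩)⟩
    obtain ⟨p, -, rfl⟩ := Finset.mem_image.mp hx
    exact hg _ _
  have poly : ∀ h : MvPolynomial ℤ ℝ, (∀ m, IsComputableReal (h.coeff m)) →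
      ∃ S : Finset ℝ, (∀ x ∈ S, IsComputableReal x) ∧
        ∀ F : Subring ℝ, (∀ x ∈ S, x ∈ F) → PolyOver F h := fun h hh => by
    -- Only the coefficients in the support count as parameters; the others are zero and lie in
    -- every subring.
    refine ⟨h.support.image h.coeff, fun x hx => ?_, fun F hF => polyOver_of_coeff_mem fun m => ?_⟩
    · obtain ⟨m, -, rfl⟩ := Finset.mem_image.mp hx
      exact hh m
    · by_cases hm : m ∈ h.support
      · exact hF _ (Finset.mem_image_of_mem _ hm)
      · rw [MvPolynomial.notMem_support_iff.mp hm]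
        exact F.zero_mem
  match v, hv with
  | .input g _, hv => exact linear g hv
  | .compute g _, hv =>
    choose S hS hSF using fun i => poly (g.num i) fun m => (hv i m).1
    choose T hT hTF using fun i => poly (g.den i) fun m => (hv i m).2
    refine ⟨Finset.univ.biUnion fun i => S i ∪ T i, fun x hx => ?_, fun F hF i =>
      ⟨hSF i F fun x hx => hF x ?_, hTF i F fun x hx => hF x ?_⟩⟩
    · obtain ⟨i, -, hi⟩ := Finset.mem_biUnion.mp hx
      exact (Finset.mem_union.mp hi).elim (hS i x) (hT i x)
    · exact Finset.mem_biUnion.mpr ⟨i, Finset.mem_univ _, Finset.mem_union_left _ hx⟩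
    · exact Finset.mem_biUnion.mpr ⟨i, Finset.mem_univ _, Finset.mem_union_right _ hx⟩
  | .branch h _ _, hv => exact poly h hv
  | .shiftLeft _, _ => exact ⟨∅, by simp, fun _ _ => trivial⟩
  | .shiftRight _, _ => exact ⟨∅, by simp, fun _ _ => trivial⟩
  | .output g, hv => exact linear g hv

theorem Machine.HasComputableParameters.exists_finset_over {K : Machine}
    (hK : K.HasComputableParameters) :
    ∃ S : Finset ℝ, (∀ x ∈ S, IsComputableReal x) ∧
      ∀ F : Subring ℝ, (∀ x ∈ S, x ∈ F) → ∀ v, (K.node v).Over F := by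
  classical
  choose S hS hSF using fun v => (K.node v).exists_finset_over (hK v)
  refine ⟨Finset.univ.biUnion S, fun x hx => ?_, fun F hF v => hSF v F fun x hx =>
    hF x (Finset.mem_biUnion.mpr ⟨v, Finset.mem_univ _, hx⟩)⟩
  obtain ⟨v, -, hv⟩ := Finset.mem_biUnion.mp hx
  exact hS v x hv

end BSS

theorem mainTheorem5 (L : FirstOrder.Language)
    [Encodable (Σ n, L.Functions n)] [Encodable (Σ n, L.Relations n)]
    (U : Set (List ℝ)) [L.Structure U] (K : BSS.Machine)
    (hK : K.Defines L U) (hpar : K.HasComputableParameters) :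
    ∃ A : L.Substructure U, A.LeOne ∧
      ∃ (D : Set ℕ) (_ : L.Structure D), IsComputableStructure L D ∧ Nonempty (A ≃[L] D) := by
  obtain ⟨S, hS, hover⟩ := hpar.exists_finset_over
  obtain ⟨F, V, _, s, hrc, hSF, hmem, heq, hlt⟩ := exists_computable_rootClosed S hS
  have hF := hover F hSF
  have hpres : BSS.IsPresentation F s := ⟨hrc, hmem, heq, hlt⟩
  refine ⟨hK.restrict hF hrc, hK.restrict_leOne hF hrc, ?_⟩
  have hof : Computable (DiffCode.ofNat (V := V)) := DiffCode.computable_ofNat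
  refine Diagram.exists_isComputableStructure (num := (Nat.cast : ℕ → ℝ))
    (el := fun a : hK.restrict hF hrc => ((a : U) : List ℝ)) (θ := DiffCode.val s)
    Nat.cast_injective hof (DiffCode.val_ofNat s) heq
    (Subtype.val_injective.comp Subtype.val_injective) (fun a => ?_) ?_
  · choose c hc using fun x : F => (hmem x).mp x.2
    have ha := (hK.mem_restrict hF hrc a).mp a.2
    refine ⟨((a : U) : List ℝ).pmap (fun x hx => c ⟨x, hx⟩) ha, ?_⟩
    simp [List.map_pmap, hc]
  -- The machine decides the diagram of the whole structure. On words with letters in `F` this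
  -- agrees with the diagram of the substructure, since such words mention only elements with
  -- entries in `F`.
  · refine (hpres.decides_computablePred hF hK).of_eq fun l => ?_
    refine (Diagram.mem_atomicDiagram_substructure_iff (hK.restrict hF hrc)
      (el := fun u : U => (u : List ℝ)) fun a ha x hx => ?_).symm
    obtain ⟨c, -, rfl⟩ := List.mem_map.mp (ha x hx)
    exact hpres.val_mem c
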